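/- Let $\mathbf k$ be a field and let $K$ be a simplicial complex on the vertex set $[m]=\{1,\dots,m\}$ (a set of subsets of $[m]$ closed under passing to subsets and containing $\varnothing$ and all one-point sets). Suppose that $K$ is an $(n-1)$-dimensional simplicial sphere, i.e. its geometric realization $|K|$ is homeomorphic to $S^{n-1}$. Let $$\mathcal Z_K=\bigcup_{J\in K}\{z\in\mathbb C^m : |z_i|\le 1 \text{ for all } i,\ |z_j|=1 \text{ for } j\notin J\}$$ be the corresponding moment-angle manifold, of dimension $m+n$. Let $\mathbf k(K)=\mathbf k[v_1,\dots,v_m]/(v_{i_1}\cdots v_{i_s}:\{i_1,\dots,i_s\}\notin K)$ be the face ring, and consider the complex $\mathbf k(K)\otimes\Lambda[u_1,\dots,u_m]$ with the differential determined by $dv_i=0$, $du_i=v_i$, and with $\operatorname{bideg}v_i=(0,2)$, $\operatorname{bideg}u_i=(-1,2)$. Let $\mathcal C^*(K)$ be its subcomplex spanned by the monomials $v_Iu_J=v_{i_1}\cdots v_{i_p}u_{j_1}\cdots u_{j_q}$ with $I=\{i_1,\dots,i_p\}\in K$, $J=\{j_1<\dots<j_q\}$ and $I\cap J=\varnothing$.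 It is identified with the cellular cochain complex of $\mathcal Z_K$ by $v_Iu_J\mapsto (D_IT_J)^*$, the cochain dual to the oriented product cell $D_IT_J$ whose $i$-th factor is the unit disc for $i\in I$, the circle minus the point $1$ for $i\in J$, and the point $1$ otherwise. Hence elements of $\mathcal C^*(K)$ that are cocycles represent cohomology classes of $\mathcal Z_K$. Then $H_{m+n}(\mathcal Z_K;\mathbb Z)$ is infinite cyclic. For each of its generators $\mu$ (that is, for each orientation of $\mathcal Z_K$) there is exactly one class $\omega\in H^{m+n}(\mathcal Z_K;\mathbf k)$ with $\langle\omega,\mu\rangle=1$, the fundamental cohomology class. For every monomial $v_Iu_J$ of bidegree $(-(m-n),2m)$ such that $I$ is an $(n-1)$-simplex of $K$ and $I\cap J=\varnothing$ (so that $J=[m]\setminus I$), the class $\omega$ is represented by $v_Iu_J$ or by $-v_Iu_J$; the sign depends on $I$ and on the orientation $\mu$. -/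

import Mathlib

open scoped TensorProduct

namespace MomentAngle

noncomputable section

/-! ### Singular homology and cohomology

Singular homology in its cubical form: chains are generated by the continuous maps of the
cubes `[0,1]ⁿ` to `X`, modulo the degenerate ones. -/

/-- Singular `n`-cubes of `X`. -/
abbrev SingularCube (n : ℕ) (X : Type*) [TopologicalSpace X] : Type _ :=
  C(Fin n → unitInterval, X)

/-- The inclusion of the face `xᵢ = e` of the cube `[0,1]ⁿ⁺¹`. -/
def cubeFace {n : ℕ} (i : Fin (n + 1)) (e : unitInterval) :
    C(Fin n → unitInterval, Fin (n + 1) → unitInterval) where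
  toFun x := i.insertNth (α := fun _ => unitInterval) e x
  continuous_toFun := by fun_prop

/-- A singular cube is degenerate if it does not depend on one of its coordinates. -/
def IsDegenerate {n : ℕ} {X : Type*} [TopologicalSpace X] (c : SingularCube n X) : Prop :=
  ∃ i : Fin n, ∀ x y : Fin n → unitInterval, (∀ j, j ≠ i → x j = y j) → c x = c y

/-- The chains spanned by the degenerate singular `n`-cubes. -/
def degenerateChains (n : ℕ) (X : Type*) [TopologicalSpace X] :
    Submodule ℤ (SingularCube n X →₀ ℤ) :=
  Submodule.span ℤ {a | ∃ c : SingularCube n X, IsDegenerate c ∧ a = Finsupp.single c 1}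

/-- Singular `n`-chains with integer coefficients. -/
abbrev Chain (n : ℕ) (X : Type*) [TopologicalSpace X] : Type _ :=
  (SingularCube n X →₀ ℤ) ⧸ degenerateChains n X

/-- The chain of one singular cube. -/
def Chain.of {n : ℕ} {X : Type*} [TopologicalSpace X] (c : SingularCube n X) : Chain n X :=
  Submodule.Quotient.mk (Finsupp.single c 1)

/-- `∂ c = ∑ᵢ (-1)ⁱ (c|_{xᵢ = 1} - c|_{xᵢ = 0})`, coordinates being numbered from `0`. -/
def freeBoundary (n : ℕ) (X : Type*) [TopologicalSpace X] :
    (SingularCube (n + 1) X →₀ ℤ) →ₗ[ℤ] (SingularCube n X →₀ ℤ) :=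
  Finsupp.linearCombination ℤ fun c => ∑ i : Fin (n + 1), (-1 : ℤ) ^ (i : ℕ) •
    (Finsupp.single (c.comp (cubeFace i 1)) (1 : ℤ) - Finsupp.single (c.comp (cubeFace i 0)) 1)

theorem degenerateChains_le_comap (n : ℕ) (X : Type*) [TopologicalSpace X] :
    degenerateChains (n + 1) X ≤ (degenerateChains n X).comap (freeBoundary n X) := by
  refine Submodule.span_le.2 ?_
  rintro _ ⟨c, ⟨i, hi⟩, rfl⟩
  simp only [SetLike.mem_coe, Submodule.mem_comap, freeBoundary,
    Finsupp.linearCombination_single, one_smul]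
  refine Submodule.sum_mem _ fun j _ => Submodule.smul_mem _ _ ?_
  by_cases hij : i = j
  · subst hij
    have h : c.comp (cubeFace i 1) = c.comp (cubeFace i 0) := by
      ext x
      refine hi _ _ fun l hl => ?_
      obtain ⟨l, rfl⟩ := Fin.exists_succAbove_eq hl
      simp [cubeFace]
    rw [h, sub_self]
    exact Submodule.zero_mem _
  · obtain ⟨l, hl⟩ := Fin.exists_succAbove_eq hij
    have key : ∀ e, IsDegenerate (c.comp (cubeFace j e)) := by
      refine fun e => ⟨l, fun x y hxy => hi _ _ fun a ha => ?_⟩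
      rcases eq_or_ne a j with rfl | haj
      · simp [cubeFace]
      · obtain ⟨a, rfl⟩ := Fin.exists_succAbove_eq haj
        have : a ≠ l := fun h => ha (by rw [h, hl])
        simpa [cubeFace] using hxy a this
    exact Submodule.sub_mem _ (Submodule.subset_span ⟨_, key 1, rfl⟩)
      (Submodule.subset_span ⟨_, key 0, rfl⟩)

/-- The boundary operator on singular chains. -/
def boundary (n : ℕ) (X : Type*) [TopologicalSpace X] : Chain (n + 1) X →ₗ[ℤ] Chain n X :=
  Submodule.mapQ _ _ (freeBoundary n X) (degenerateChains_le_comap n X)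

/-- Singular cycles. -/
def cycles : (n : ℕ) → (X : Type*) → [TopologicalSpace X] → Submodule ℤ (Chain n X)
  | 0, _, _ => ⊤
  | n + 1, X, _ => LinearMap.ker (boundary n X)

/-- The singular homology group `H_n(X; ℤ)`. -/
abbrev Homology (n : ℕ) (X : Type*) [TopologicalSpace X] : Type _ :=
  cycles n X ⧸ (LinearMap.range (boundary n X)).submoduleOf (cycles n X)

/-- Singular cochains with coefficients in `k`. -/
abbrev Cochain (k : Type*) [CommRing k] (n : ℕ) (X : Type*) [TopologicalSpace X] : Type _ :=
  Chain n X →ₗ[ℤ] k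

/-- The coboundary operator on singular cochains. -/
def coboundary (k : Type*) [CommRing k] (n : ℕ) (X : Type*) [TopologicalSpace X] :
    Cochain k n X →ₗ[k] Cochain k (n + 1) X where
  toFun z := z.comp (boundary n X)
  map_add' _ _ := rfl
  map_smul' _ _ := rfl

/-- Singular cocycles. -/
def cocycles (k : Type*) [CommRing k] (n : ℕ) (X : Type*) [TopologicalSpace X] :
    Submodule k (Cochain k n X) :=
  LinearMap.ker (coboundary k n X)

/-- Singular coboundaries. -/
def coboundaries (k : Type*) [CommRing k] :
    (n : ℕ) → (X : Type*) → [TopologicalSpace X] → Submodule k (Cochain k n X)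
  | 0, _, _ => ⊥
  | n + 1, X, _ => LinearMap.range (coboundary k n X)

/-- The singular cohomology group `Hⁿ(X; k)`. -/
abbrev Cohomology (k : Type*) [CommRing k] (n : ℕ) (X : Type*) [TopologicalSpace X] : Type _ :=
  cocycles k n X ⧸ (coboundaries k n X).submoduleOf (cocycles k n X)

/-- Evaluation of a cocycle on homology classes. -/
def evalCocycle {k : Type*} [CommRing k] {n : ℕ} {X : Type*} [TopologicalSpace X]
    (z : cocycles k n X) : Homology n X →ₗ[ℤ] k :=
  Submodule.liftQ _ (z.1.comp (cycles n X).subtype) (by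
    rintro ⟨_, _⟩ ⟨b, rfl⟩
    exact LinearMap.congr_fun (LinearMap.mem_ker.1 z.2) b)

theorem evalCocycle_eq_zero {k : Type*} [CommRing k] {n : ℕ} {X : Type*} [TopologicalSpace X]
    (z : cocycles k n X) (hz : z.1 ∈ coboundaries k n X) : evalCocycle z = 0 := by
  refine LinearMap.ext fun μ => ?_
  obtain ⟨⟨c, hc⟩, rfl⟩ := Submodule.Quotient.mk_surjective _ μ
  obtain ⟨z, _⟩ := z
  change z c = 0
  cases n with
  | zero =>
    have : z = 0 := hz
    simp [this]
  | succ n =>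
    obtain ⟨y, rfl⟩ := hz
    change y (boundary n X c) = 0
    rw [LinearMap.mem_ker.1 hc, map_zero]

/-- The Kronecker pairing `Hⁿ(X; k) × H_n(X; ℤ) → k`. -/
def kronecker {k : Type*} [CommRing k] {n : ℕ} {X : Type*} [TopologicalSpace X] :
    Cohomology k n X →ₗ[k] Homology n X →ₗ[ℤ] k :=
  Submodule.liftQ _
    { toFun := fun z => evalCocycle z
      map_add' := fun a b => by
        refine LinearMap.ext fun μ => ?_
        obtain ⟨c, rfl⟩ := Submodule.Quotient.mk_surjective _ μ
        rfl
      map_smul' := fun a b => by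
        refine LinearMap.ext fun μ => ?_
        obtain ⟨c, rfl⟩ := Submodule.Quotient.mk_surjective _ μ
        rfl }
    (fun z hz => evalCocycle_eq_zero z hz)

/-- For a closed connected `d`-manifold `X`: `μ` is the fundamental homology class of one of the
orientations of `X`, that is, `H_d(X; ℤ)` is infinite cyclic with generator `μ`. -/
def IsFundamentalClass {d : ℕ} {X : Type*} [TopologicalSpace X] (μ : Homology d X) : Prop :=
  (∀ x : Homology d X, ∃ a : ℤ, x = a • μ) ∧ ∀ a : ℤ, a • μ = 0 → a = 0

/-- The fundamental cohomology class with coefficients in `k` of the orientation given by `μ`. -/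
def IsFundamentalCohomologyClass {k : Type*} [CommRing k] {d : ℕ} {X : Type*}
    [TopologicalSpace X] (μ : Homology d X) (ω : Cohomology k d X) : Prop :=
  kronecker ω μ = 1

/-! ### Simplicial complexes and moment-angle complexes

Complexes on the vertex set `[m]` are terms of `AbstractSimplicialComplex (Fin m)`; the faces there
are nonempty, so the empty simplex is added by hand. -/

/-- `I` is a (possibly empty) simplex of `K`. -/
def IsSimplex {m : ℕ} (K : AbstractSimplicialComplex (Fin m)) (I : Finset (Fin m)) : Prop :=
  I = ∅ ∨ I ∈ K

/-- The geometric realization `|K|`, in barycentric coordinates. -/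
def realization {m : ℕ} (K : AbstractSimplicialComplex (Fin m)) : Set (Fin m → ℝ) :=
  {x | x ∈ stdSimplex ℝ (Fin m) ∧ Finset.univ.filter (fun i => x i ≠ 0) ∈ K}

/-- `K` is an `(n-1)`-dimensional simplicial sphere: `|K|` is homeomorphic to `Sⁿ⁻¹ ⊂ ℝⁿ`. -/
def IsSimplicialSphere {m : ℕ} (K : AbstractSimplicialComplex (Fin m)) (n : ℕ) : Prop :=
  Nonempty (realization K ≃ₜ Metric.sphere (0 : EuclideanSpace ℝ (Fin n)) 1)

/-- The moment-angle complex `𝒵_K ⊂ (D²)ᵐ ⊂ ℂᵐ`: the union over the simplices `J` of `K` of the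
blocks `{z ∈ (D²)ᵐ : |z_j| = 1 for j ∉ J}`. -/
def momentAngle {m : ℕ} (K : AbstractSimplicialComplex (Fin m)) : Set (Fin m → ℂ) :=
  {z | (∀ i, ‖z i‖ ≤ 1) ∧ ∃ J, IsSimplex K J ∧ ∀ j, j ∉ J → ‖z j‖ = 1}

/-! ### The cells of `𝒵_K`

The cell `D_I T_J` is the product over `i = 1, …, m` of the open disc (for `i ∈ I`), the circle
without the point `1` (for `i ∈ J`) and the point `1` (for the other `i`). It is parametrized by a
cube: the disc by `(s, t) ↦ s exp(2πit)` and the circle by `t ↦ exp(2πit)`. -/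

/-- The number of coordinates of the cube that belong to the factors before the `a`-th one. -/
def offset {m : ℕ} (I J : Finset (Fin m)) (a : Fin m) : ℕ :=
  ∑ b ∈ Finset.univ.filter (· < a), if b ∈ I then 2 else if b ∈ J then 1 else 0

/-- The coordinate with number `p` of a point of the cube (`0` if there is no such coordinate,
which does not occur for the parametrization of `D_I T_J` by a cube of dimension `2|I| + |J|`). -/
def coord {d : ℕ} (x : Fin d → unitInterval) (p : ℕ) : ℝ :=
  if h : p < d then x ⟨p, h⟩ else 0

/-- `exp(2πit)`. -/
def circlePoint (t : ℝ) : ℂ := Complex.exp (2 * Real.pi * t * Complex.I)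

/-- The parametrization of `D_I T_J`, as a map to `ℂᵐ`. -/
def cellMap {m : ℕ} (d : ℕ) (I J : Finset (Fin m)) (x : Fin d → unitInterval) (a : Fin m) : ℂ :=
  if a ∈ I then coord x (offset I J a) * circlePoint (coord x (offset I J a + 1))
  else if a ∈ J then circlePoint (coord x (offset I J a))
  else 1

theorem continuous_coord {d : ℕ} (p : ℕ) :
    Continuous fun x : Fin d → unitInterval => coord x p := by
  unfold coord
  split_ifs <;> fun_prop

theorem continuous_cellMap {m : ℕ} (d : ℕ) (I J : Finset (Fin m)) :
    Continuous (cellMap d I J) := by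
  refine continuous_pi fun a => ?_
  have h := continuous_coord (d := d)
  unfold cellMap circlePoint
  split_ifs
  · have h1 := h (offset I J a)
    have h2 := h (offset I J a + 1)
    fun_prop
  · have h1 := h (offset I J a)
    fun_prop
  · fun_prop

theorem norm_circlePoint (t : ℝ) : ‖circlePoint t‖ = 1 := by
  have := Complex.norm_exp_ofReal_mul_I (2 * Real.pi * t)
  simpa [circlePoint] using this

theorem norm_coord_le {d : ℕ} (x : Fin d → unitInterval) (p : ℕ) : |coord x p| ≤ 1 := by
  unfold coord
  split_ifs with h
  · rw [abs_of_nonneg (x _).2.1]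
    exact (x _).2.2
  · simp

theorem cellMap_mem {m : ℕ} {K : AbstractSimplicialComplex (Fin m)} (d : ℕ)
    {I : Finset (Fin m)} (hI : IsSimplex K I) (J : Finset (Fin m)) (x : Fin d → unitInterval) :
    cellMap d I J x ∈ momentAngle K := by
  refine ⟨fun a => ?_, I, hI, fun a ha => ?_⟩
  · unfold cellMap
    split_ifs <;> simp [norm_circlePoint, norm_coord_le]
  · unfold cellMap
    split_ifs <;> simp [norm_circlePoint]

/-- The cell `D_I T_J` as a singular cube of `𝒵_K`. -/
def cellCube {m : ℕ} {K : AbstractSimplicialComplex (Fin m)} (d : ℕ)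
    {I : Finset (Fin m)} (hI : IsSimplex K I) (J : Finset (Fin m)) :
    SingularCube d (momentAngle K) where
  toFun x := ⟨cellMap d I J x, cellMap_mem d hI J x⟩
  continuous_toFun := (continuous_cellMap d I J).subtype_mk _

/-! ### The Koszul complex of the face ring -/

/-- The face ring `k(K) = k[v₁, …, v_m] / (v_{i₁} ⋯ v_{i_s} : {i₁, …, i_s} ∉ K)`. -/
abbrev FaceRing (k : Type*) [CommRing k] {m : ℕ} (K : AbstractSimplicialComplex (Fin m)) : Type _ :=
  MvPolynomial (Fin m) k ⧸
    Ideal.span {f : MvPolynomial (Fin m) k | ∃ I : Finset (Fin m), ¬ IsSimplex K I ∧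
      f = ∏ i ∈ I, MvPolynomial.X i}

/-- The element `v_i` of the face ring. -/
def v (k : Type*) [CommRing k] {m : ℕ} (K : AbstractSimplicialComplex (Fin m)) (i : Fin m) :
    FaceRing k K :=
  Ideal.Quotient.mk _ (MvPolynomial.X i)

/-- The generator `u_i` of the exterior algebra `Λ[u₁, …, u_m]`. -/
def u (k : Type*) [CommRing k] {m : ℕ} (i : Fin m) : ExteriorAlgebra k (Fin m → k) :=
  ExteriorAlgebra.ι k (Pi.single i 1)

/-- The underlying module of `k(K) ⊗ Λ[u₁, …, u_m]`. -/
abbrev Koszul (k : Type*) [CommRing k] {m : ℕ} (K : AbstractSimplicialComplex (Fin m)) : Type _ :=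
  FaceRing k K ⊗[k] ExteriorAlgebra k (Fin m → k)

/-- The differential of the Koszul complex: the antiderivation with `d v_i = 0`, `d u_i = v_i`,
that is, `d = ∑ᵢ v_i ⊗ ∂/∂u_i`, where `∂/∂u_i` is the left contraction with the `i`-th
coordinate form. -/
def koszulD (k : Type*) [CommRing k] {m : ℕ} (K : AbstractSimplicialComplex (Fin m)) :
    Koszul k K →ₗ[k] Koszul k K :=
  ∑ i : Fin m, TensorProduct.map (LinearMap.mulLeft k (v k K i))
    (CliffordAlgebra.contractLeft (LinearMap.proj i : (Fin m → k) →ₗ[k] k))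

/-- The monomial `v_I u_J = v_{i₁} ⋯ v_{i_p} u_{j₁} ⋯ u_{j_q}`, where `j₁ < ⋯ < j_q`. -/
def monomial (k : Type*) [CommRing k] {m : ℕ} (K : AbstractSimplicialComplex (Fin m))
    (I J : Finset (Fin m)) : Koszul k K :=
  (∏ i ∈ I, v k K i) ⊗ₜ[k] ((J.sort (· ≤ ·)).map (u k)).prod

/-- The bidegree of `v_I u_J`, where `bideg v_i = (0, 2)` and `bideg u_j = (-1, 2)`. -/
def bidegree {m : ℕ} (I J : Finset (Fin m)) : ℤ × ℤ :=
  ∑ _i ∈ I, ((0 : ℤ), (2 : ℤ)) + ∑ _j ∈ J, ((-1 : ℤ), (2 : ℤ))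

/-- The subcomplex `𝒞*(K)` of the Koszul complex, spanned by the monomials `v_I u_J` such that
`I` is a simplex of `K` and `I ∩ J = ∅`. -/
def subcomplexC (k : Type*) [CommRing k] {m : ℕ} (K : AbstractSimplicialComplex (Fin m)) :
    Submodule k (Koszul k K) :=
  Submodule.span k {x | ∃ I J : Finset (Fin m), IsSimplex K I ∧ Disjoint I J ∧
    x = monomial k K I J}

open Classical in
/-- The restriction of a singular `d`-cochain of `𝒵_K` to the cells, where the cochain dual to the
cell `D_I T_J` is identified with `v_I u_J`; so the result is an element of `𝒞*(K)`. -/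
def cellularCochain {k : Type*} [CommRing k] {m : ℕ} {K : AbstractSimplicialComplex (Fin m)}
    {d : ℕ} (z : Cochain k d (momentAngle K)) : Koszul k K :=
  ∑ I : Finset (Fin m), ∑ J : Finset (Fin m),
    if h : IsSimplex K I ∧ Disjoint I J ∧ 2 * I.card + J.card = d then
      z (Chain.of (cellCube d h.1 J)) • monomial k K I J
    else 0

/-- The element `x` of `𝒞*(K)` represents the cohomology class `ω` of `𝒵_K`: it is a cocycle of
`𝒞*(K)` and, in the complex `𝒞*(K)`, it is cohomologous to the restriction to the cells of every
singular cocycle in the class `ω`. -/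
def Represents {k : Type*} [CommRing k] {m : ℕ} {K : AbstractSimplicialComplex (Fin m)} {d : ℕ}
    (x : Koszul k K) (ω : Cohomology k d (momentAngle K)) : Prop :=
  x ∈ subcomplexC k K ∧ koszulD k K x = 0 ∧
    ∀ z : cocycles k d (momentAngle K), Submodule.Quotient.mk z = ω →
      ∃ b ∈ subcomplexC k K, cellularCochain z.1 - x = koszulD k K b

end

end MomentAngle

/-! The whole statement lives in the top degree. The cells of `𝒵_K` of dimension `m + n` are the
`D_I T_J` with `I` an `(n-1)`-simplex and `J` its complement, and there are no larger cells. The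
boundary of `D_I T_J` is a signed sum of the cells obtained by moving one `i` from `I` to `J`, which
has the shape of the boundary of the simplex `I`; after a twist by `(-1) ^ ∑ i ∈ I, i` the signs
agree as well (`formalBoundary_discChain`). Hence the top homology of `𝒵_K` is the group of
augmented simplicial cycles of dimension `n - 1` of `K` (`homologyMap_surjective`,
`homologyMap_injective`).

For a sphere this group is infinite cyclic. Remove the centre of a top simplex `I`: what is left is
a sphere without a point, so it is contractible, and it also retracts radially to the complex
without the open simplex `I`. So the chains of that complex are acyclic. The boundary of `I`
therefore bounds there, which gives a cycle with coefficient `1` at `I` (`exists_cycle`), and a top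
cycle with coefficient `0` at `I` is zero (`cycle_eq_zero`). As `I` is arbitrary, a generator has
coefficient `1` or `-1` at every top simplex. That top simplices have `n` vertices is the invariance
of dimension `card_eq_of_homeomorph`.

Over a field a cochain that kills all cycles is a coboundary, which gives the existence and
uniqueness of `ω`. On the Koszul side, `koszulD` on the monomials `v_I u_J` with `J` complementary
to `I` is the twisted simplicial coboundary (`koszulD_koszulSum`), so a top cochain that kills the
simplicial cycles is a coboundary in `𝒞*(K)` (`exists_koszulD_eq`). A cocycle in `ω` and a suitably
signed `v_I u_J` both take the value `1` on the fundamental cycle, so they differ by such a cochain.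

All of this needs cellular chains to compute cubical singular homology, for `|K|` and for `𝒵_K`.
That is proved by subdivision (`relEq_sup_of_isOpen`), homotopy invariance (`relEq_of_homotopy`) and
the attachment of one cell at a time (`relEq_of_cubeRelEq`). Acyclicity of a quotient complex is
expressed by `RelEq`. Formal cubes need not be continuous, so that an `(n+1)`-cube is literally an
`n`-cube of paths without a topology on path spaces; continuity comes back in `chainsIn`, which
contains all degenerate cubes as well. -/

set_option linter.unusedSectionVars false

namespace MomentAngle

/-! ### Formal cubes -/

/-- A formal cube of `X`: any function from a cube `[0,1]ⁿ` to `X`. -/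
abbrev FormalCube (X : Type*) : Type _ := Σ n : ℕ, (Fin n → unitInterval) → X

/-- Linear combinations of formal cubes. -/
abbrev FormalChain (R : Type*) [CommRing R] (X : Type*) : Type _ := FormalCube X →₀ R

/-- The chain of one formal cube. -/
noncomputable def cube (R : Type*) [CommRing R] {X : Type*} {n : ℕ}
    (c : (Fin n → unitInterval) → X) : FormalChain R X :=
  Finsupp.single ⟨n, c⟩ 1

section Basic

variable {R : Type*} [CommRing R] {X Y Z : Type*}

theorem chain_hom_ext {M : Type*} [AddCommGroup M] [Module R M] {f g : FormalChain R X →ₗ[R] M}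
    (h : ∀ n (c : (Fin n → unitInterval) → X), f (cube R c) = g (cube R c)) : f = g := by
  refine Finsupp.lhom_ext' fun ⟨n, c⟩ => LinearMap.ext_ring ?_
  exact h n c

variable (R) in
/-- Push-forward of formal chains along a function. -/
noncomputable def push (f : X → Y) : FormalChain R X →ₗ[R] FormalChain R Y :=
  Finsupp.lmapDomain R R fun c => ⟨c.1, f ∘ c.2⟩

variable (R) in
/-- A cube of paths as a cube with one more coordinate, the new coordinate being the first one. -/
noncomputable def uncurryChain : FormalChain R (unitInterval → X) →ₗ[R] FormalChain R X :=
  Finsupp.lmapDomain R R fun c => ⟨c.1 + 1, fun x => c.2 (Fin.tail x) (x 0)⟩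

/-- A cube as a cube of paths, given by the first coordinate. -/
def curryCube {n : ℕ} (c : (Fin (n + 1) → unitInterval) → X) :
    (Fin n → unitInterval) → (unitInterval → X) :=
  fun y a => c (Fin.cons a y)

/-- Evaluation of paths. -/
def evalAt (a : unitInterval) (φ : unitInterval → X) : X := φ a

@[simp] theorem push_cube (f : X → Y) {n : ℕ} (c : (Fin n → unitInterval) → X) :
    push R f (cube R c) = cube R (f ∘ c) := by
  simp [push, cube, Finsupp.mapDomain_single]

@[simp] theorem uncurryChain_cube {n : ℕ} (c : (Fin n → unitInterval) → unitInterval → X) :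
    uncurryChain R (cube R c) =
      cube R (n := n + 1) (fun x => c (Fin.tail x) (x 0)) := by
  simp [uncurryChain, cube, Finsupp.mapDomain_single]

theorem uncurryChain_curryCube {n : ℕ} (c : (Fin (n + 1) → unitInterval) → X) :
    uncurryChain R (cube R (curryCube c)) = cube R c := by
  simp [curryCube]

@[simp] theorem curryCube_uncurry {n : ℕ} (c : (Fin n → unitInterval) → unitInterval → X) :
    curryCube (n := n) (fun x => c (Fin.tail x) (x 0)) = c := by
  funext y a
  simp [curryCube]

theorem push_push (f : Y → Z) (g : X → Y) (z : FormalChain R X) :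
    push R f (push R g z) = push R (f ∘ g) z := by
  refine LinearMap.congr_fun (f := push R f ∘ₗ push R g) (chain_hom_ext fun n c => ?_) z
  simp [Function.comp_assoc]

theorem push_id (z : FormalChain R X) : push R id z = z := by
  refine LinearMap.congr_fun (g := LinearMap.id) (chain_hom_ext fun n c => ?_) z
  simp

theorem push_uncurryChain (f : X → Y) (z : FormalChain R (unitInterval → X)) :
    push R f (uncurryChain R z) = uncurryChain R (push R (f ∘ ·) z) := by
  refine LinearMap.congr_fun (f := push R f ∘ₗ uncurryChain R)
    (g := uncurryChain R ∘ₗ push R (f ∘ ·)) (chain_hom_ext fun n c => ?_) z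
  simp [Function.comp_def]

/-! ### The boundary -/

variable (R) in
/-- The boundary of a formal cube, by recursion on the dimension. -/
noncomputable def boundaryCube : (n : ℕ) → {X : Type*} → ((Fin n → unitInterval) → X) →
    FormalChain R X
  | 0, _, _ => 0
  | n + 1, _, c => cube R (evalAt 1 ∘ curryCube c) - cube R (evalAt 0 ∘ curryCube c) -
      uncurryChain R (boundaryCube n (curryCube c))

variable (R) in
/-- The boundary of formal chains. -/
noncomputable def formalBoundary : FormalChain R X →ₗ[R] FormalChain R X :=
  Finsupp.linearCombination R fun c => boundaryCube R c.1 c.2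

theorem formalBoundary_cube {n : ℕ} (c : (Fin n → unitInterval) → X) :
    formalBoundary R (cube R c) = boundaryCube R n c := by
  simp [formalBoundary, cube]

theorem formalBoundary_cube_zero (c : (Fin 0 → unitInterval) → X) :
    formalBoundary R (cube R c) = 0 := by
  rw [formalBoundary_cube]; rfl

theorem formalBoundary_cube_succ {n : ℕ} (c : (Fin (n + 1) → unitInterval) → X) :
    formalBoundary R (cube R c) = cube R (evalAt 1 ∘ curryCube c) -
      cube R (evalAt 0 ∘ curryCube c) -
        uncurryChain R (formalBoundary R (cube R (curryCube c))) := by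
  rw [formalBoundary_cube, formalBoundary_cube]; rfl

/-- The prism formula. Currying is a bijection on cubes, so the recursive definition of the boundary
holds for all chains of paths; every chain homotopy below is a computation with this identity. -/
theorem formalBoundary_uncurryChain (z : FormalChain R (unitInterval → X)) :
    formalBoundary R (uncurryChain R z) = push R (evalAt 1) z - push R (evalAt 0) z -
      uncurryChain R (formalBoundary R z) := by
  refine LinearMap.congr_fun (f := formalBoundary R ∘ₗ uncurryChain R)
    (g := push R (evalAt 1) - push R (evalAt 0) - uncurryChain R ∘ₗ formalBoundary R)
    (chain_hom_ext fun n c => ?_) z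
  simp [formalBoundary_cube_succ]

/-- The induction step passes to the curried cube, whose values are paths, so the spaces have to
stay universally quantified. The same holds for all inductions on the dimension of a cube below. -/
theorem push_boundaryCube {n : ℕ} : ∀ {X Y : Type*} (f : X → Y)
    (c : (Fin n → unitInterval) → X),
    push R f (formalBoundary R (cube R c)) = formalBoundary R (cube R (f ∘ c)) := by
  induction n with
  | zero => intro X Y f c; simp [formalBoundary_cube_zero]
  | succ n ih =>
    intro X Y f c
    rw [formalBoundary_cube_succ, formalBoundary_cube_succ]
    simp only [map_sub, push_cube, push_uncurryChain, ih]
    rfl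

theorem push_formalBoundary (f : X → Y) (z : FormalChain R X) :
    push R f (formalBoundary R z) = formalBoundary R (push R f z) := by
  refine LinearMap.congr_fun (f := push R f ∘ₗ formalBoundary R)
    (g := formalBoundary R ∘ₗ push R f) (chain_hom_ext fun n c => ?_) z
  simp [push_boundaryCube]

/-- The boundaries of the two end faces cancel against the end faces of the prism over the boundary,
because evaluation of paths commutes with the boundary. -/
theorem formalBoundary_boundaryCube {n : ℕ} : ∀ {X : Type*} (c : (Fin n → unitInterval) → X),
    formalBoundary R (formalBoundary R (cube R c)) = 0 := by
  induction n with
  | zero => intro X c; simp [formalBoundary_cube_zero]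
  | succ n ih =>
    intro X c
    rw [formalBoundary_cube_succ]
    simp only [map_sub, formalBoundary_uncurryChain, ih, push_boundaryCube, map_zero]
    abel

@[simp] theorem formalBoundary_formalBoundary (z : FormalChain R X) :
    formalBoundary R (formalBoundary R z) = 0 := by
  refine LinearMap.congr_fun (f := formalBoundary R ∘ₗ formalBoundary R) (g := 0)
    (chain_hom_ext fun n c => ?_) z
  simp [formalBoundary_boundaryCube]

/-- The boundary of a cube as the alternating sum of its faces. -/
theorem formalBoundary_cube_eq_sum {n : ℕ} : ∀ {X : Type*}
    (c : (Fin (n + 1) → unitInterval) → X),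
    formalBoundary R (cube R c) = ∑ i : Fin (n + 1), (-1 : R) ^ (i : ℕ) •
      (cube R (fun x => c (i.insertNth (α := fun _ => unitInterval) 1 x)) -
        cube R (fun x => c (i.insertNth (α := fun _ => unitInterval) 0 x))) := by
  induction n with
  | zero =>
    intro X c
    rw [formalBoundary_cube_succ, formalBoundary_cube_zero]
    rw [Fin.sum_univ_succ, Fin.sum_univ_zero]
    simp only [map_zero, sub_zero, add_zero, Fin.val_zero, pow_zero, one_smul, Fin.insertNth_zero']
    rfl
  | succ n ih =>
    intro X c
    rw [formalBoundary_cube_succ, Fin.sum_univ_succ, ih, map_sum]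
    simp only [Fin.val_zero, pow_zero, one_smul, Fin.insertNth_zero', Fin.val_succ, pow_succ,
      mul_neg, mul_one, neg_smul, Finset.sum_neg_distrib, map_smul, map_sub, uncurryChain_cube]
    rw [sub_eq_add_neg]
    congr 1
    congr 1
    refine Finset.sum_congr rfl fun i _ => ?_
    have h : ∀ e : unitInterval,
        (fun x : Fin (n + 1) → unitInterval => curryCube c
          (i.insertNth (α := fun _ => unitInterval) e (Fin.tail x)) (x 0)) =
        fun x => c (i.succ.insertNth (α := fun _ => unitInterval) e x) := by
      intro e
      funext x
      conv_rhs => rw [← Fin.cons_self_tail x, Fin.insertNth_succ_cons]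
      rfl
    rw [h, h]

/-! ### Degenerate cubes -/

/-- A formal cube is degenerate if it does not depend on one of its coordinates. -/
def DegenerateCube {n : ℕ} (c : (Fin n → unitInterval) → X) : Prop :=
  ∃ i : Fin n, ∀ x y : Fin n → unitInterval, (∀ j, j ≠ i → x j = y j) → c x = c y

variable (R X) in
/-- The span of the degenerate formal cubes. -/
noncomputable def degenerate : Submodule R (FormalChain R X) :=
  Finsupp.supported R R {c | DegenerateCube c.2}

theorem cube_mem_degenerate {n : ℕ} {c : (Fin n → unitInterval) → X} (h : DegenerateCube c) :
    cube R c ∈ degenerate R X :=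
  Finsupp.single_mem_supported R _ h

theorem supported_le_of_cube {S : Set (FormalCube X)} {M : Submodule R (FormalChain R X)}
    (h : ∀ n (c : (Fin n → unitInterval) → X), ⟨n, c⟩ ∈ S → cube R c ∈ M) :
    Finsupp.supported R R S ≤ M := by
  rw [Finsupp.supported_eq_span_single, Submodule.span_le]
  rintro _ ⟨⟨n, c⟩, hc, rfl⟩
  exact h n c hc

theorem push_mem_degenerate (f : X → Y) {z : FormalChain R X} (hz : z ∈ degenerate R X) :
    push R f z ∈ degenerate R Y := by
  have : degenerate R X ≤ (degenerate R Y).comap (push R f) := by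
    refine supported_le_of_cube ?_
    rintro n c ⟨i, hi⟩
    rw [Submodule.mem_comap, push_cube]
    exact cube_mem_degenerate ⟨i, fun x y h => congrArg f (hi x y h)⟩
  exact this hz

theorem uncurryChain_mem_degenerate {z : FormalChain R (unitInterval → X)}
    (hz : z ∈ degenerate R (unitInterval → X)) : uncurryChain R z ∈ degenerate R X := by
  have : degenerate R (unitInterval → X) ≤ (degenerate R X).comap (uncurryChain R) := by
    refine supported_le_of_cube ?_
    rintro n c ⟨i, hi⟩
    rw [Submodule.mem_comap, uncurryChain_cube]
    refine cube_mem_degenerate ⟨i.succ, fun x y h => ?_⟩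
    change c (Fin.tail x) (x 0) = c (Fin.tail y) (y 0)
    have h1 : c (Fin.tail x) = c (Fin.tail y) :=
      hi _ _ fun j hj => h _ fun h' => hj (Fin.succ_injective _ h')
    rw [h1, h 0 (Fin.succ_ne_zero i).symm]
  exact this hz

/-- A cube of paths whose paths are constant is degenerate. -/
theorem uncurryChain_push_const_mem (z : FormalChain R X) :
    uncurryChain R (push R (fun a (_ : unitInterval) => a) z) ∈ degenerate R X := by
  have : (⊤ : Submodule R (FormalChain R X)) ≤ (degenerate R X).comap
      (uncurryChain R ∘ₗ push R (fun a (_ : unitInterval) => a)) := by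
    rw [← Finsupp.supported_univ]
    refine supported_le_of_cube fun n c _ => ?_
    simp only [Submodule.mem_comap, LinearMap.comp_apply, push_cube, uncurryChain_cube]
    refine cube_mem_degenerate ⟨0, fun x y h => ?_⟩
    have : Fin.tail x = Fin.tail y := funext fun j => h _ (Fin.succ_ne_zero j)
    simp [this]
  exact this (Submodule.mem_top (x := z))

/-- A degenerate cube of positive dimension does not depend on its first coordinate, or it is a
degenerate cube of paths. -/
theorem DegenerateCube.curry {n : ℕ} {c : (Fin (n + 1) → unitInterval) → X}
    (h : DegenerateCube c) :
    curryCube c = (fun a (_ : unitInterval) => a) ∘ (evalAt 0 ∘ curryCube c) ∨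
      DegenerateCube (curryCube c) := by
  obtain ⟨i, hi⟩ := h
  induction i using Fin.cases with
  | zero =>
    left
    funext y a
    exact hi _ _ fun j hj => by
      obtain ⟨j, rfl⟩ := Fin.exists_succ_eq.2 hj
      simp
  | succ i =>
    right
    refine ⟨i, fun x y h => funext fun a => hi _ _ fun j hj => ?_⟩
    induction j using Fin.cases with
    | zero => simp
    | succ j => simpa using h j fun h' => hj (h' ▸ rfl)

/-- If the cube is independent of the first coordinate, its two end faces cancel and the rest is a
prism of constant paths. Otherwise the curried cube is degenerate and induction applies. -/
theorem formalBoundary_degenerateCube {n : ℕ} : ∀ {X : Type*} {c : (Fin n → unitInterval) → X},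
    DegenerateCube c → formalBoundary R (cube R c) ∈ degenerate R X := by
  induction n with
  | zero => rintro X c ⟨i, _⟩; exact i.elim0
  | succ n ih =>
    intro X c hc
    rw [formalBoundary_cube_succ]
    rcases hc.curry with h | h
    · rw [h, ← push_cube (R := R) _ (evalAt 0 ∘ curryCube c), ← push_formalBoundary]
      refine sub_mem ?_ (uncurryChain_push_const_mem _)
      change cube R (evalAt 0 ∘ curryCube c) - cube R (evalAt 0 ∘ curryCube c) ∈ _
      rw [sub_self]
      exact zero_mem _
    · refine sub_mem (sub_mem ?_ ?_) (uncurryChain_mem_degenerate (ih h)) <;>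
        rw [← push_cube] <;> exact push_mem_degenerate _ (cube_mem_degenerate h)

theorem formalBoundary_mem_degenerate {z : FormalChain R X} (hz : z ∈ degenerate R X) :
    formalBoundary R z ∈ degenerate R X := by
  have : degenerate R X ≤ (degenerate R X).comap (formalBoundary R) :=
    supported_le_of_cube fun n c hc => formalBoundary_degenerateCube hc
  exact this hz

end Basic

/-! ### Subdivision -/

/-- The map `a ↦ a / 2`. -/
noncomputable def lowerHalf (a : unitInterval) : unitInterval :=
  ⟨a / 2, by have := a.2.1; have := a.2.2; constructor <;> linarith⟩

/-- The map `a ↦ (1 + a) / 2`. -/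
noncomputable def upperHalf (a : unitInterval) : unitInterval :=
  ⟨(1 + a) / 2, by have := a.2.1; have := a.2.2; constructor <;> linarith⟩

/-- The map `(a, b) ↦ b (1 + a) / 2`. -/
noncomputable def halfGrid (a b : unitInterval) : unitInterval :=
  ⟨b * ((1 + a) / 2), by
    have := a.2.1; have := a.2.2
    exact ⟨mul_nonneg b.2.1 (by linarith), mul_le_one₀ b.2.2 (by linarith) (by linarith)⟩⟩

/-- Reparametrization of paths. -/
def precomp {X : Type*} (h : unitInterval → unitInterval) (φ : unitInterval → X) :
    unitInterval → X := φ ∘ h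

/-- The square of paths given by `halfGrid`. -/
noncomputable def precompGrid {X : Type*} (φ : unitInterval → X) :
    unitInterval → unitInterval → X :=
  fun b a => φ (halfGrid a b)

section Subdivision

variable {R : Type*} [CommRing R] {X Y : Type*}

variable (R) in
/-- The subdivision of a cube into `2ⁿ` cubes. -/
noncomputable def subdivideCube : (n : ℕ) → {X : Type*} → ((Fin n → unitInterval) → X) →
    FormalChain R X
  | 0, _, c => cube R c
  | n + 1, _, c => uncurryChain R (subdivideCube n (precomp lowerHalf ∘ curryCube c)) +
      uncurryChain R (subdivideCube n (precomp upperHalf ∘ curryCube c))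

variable (R) in
/-- The subdivision of chains. -/
noncomputable def subdivide : FormalChain R X →ₗ[R] FormalChain R X :=
  Finsupp.linearCombination R fun c => subdivideCube R c.1 c.2

variable (R) in
/-- The homotopy from the identity to the subdivision, on cubes. -/
noncomputable def subdivisionHomotopyCube : (n : ℕ) → {X : Type*} →
    ((Fin n → unitInterval) → X) → FormalChain R X
  | 0, _, _ => 0
  | n + 1, _, c => uncurryChain R (uncurryChain R (cube R (precompGrid ∘ curryCube c))) -
      uncurryChain R (subdivisionHomotopyCube n (precomp lowerHalf ∘ curryCube c)) -
      uncurryChain R (subdivisionHomotopyCube n (precomp upperHalf ∘ curryCube c))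

variable (R) in
/-- The homotopy from the identity to the subdivision. -/
noncomputable def subdivisionHomotopy : FormalChain R X →ₗ[R] FormalChain R X :=
  Finsupp.linearCombination R fun c => subdivisionHomotopyCube R c.1 c.2

theorem subdivide_cube_zero (c : (Fin 0 → unitInterval) → X) :
    subdivide R (cube R c) = cube R c := by
  simp [subdivide, cube, subdivideCube]

theorem subdivide_cube_succ {n : ℕ} (c : (Fin (n + 1) → unitInterval) → X) :
    subdivide R (cube R c) =
      uncurryChain R (subdivide R (cube R (precomp lowerHalf ∘ curryCube c))) +
      uncurryChain R (subdivide R (cube R (precomp upperHalf ∘ curryCube c))) := by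
  simp [subdivide, cube, subdivideCube]

theorem subdivisionHomotopy_cube_zero (c : (Fin 0 → unitInterval) → X) :
    subdivisionHomotopy R (cube R c) = 0 := by
  simp [subdivisionHomotopy, cube, subdivisionHomotopyCube]

theorem subdivisionHomotopy_cube_succ {n : ℕ} (c : (Fin (n + 1) → unitInterval) → X) :
    subdivisionHomotopy R (cube R c) =
      uncurryChain R (uncurryChain R (cube R (precompGrid ∘ curryCube c))) -
      uncurryChain R (subdivisionHomotopy R (cube R (precomp lowerHalf ∘ curryCube c))) -
      uncurryChain R (subdivisionHomotopy R (cube R (precomp upperHalf ∘ curryCube c))) := by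
  simp [subdivisionHomotopy, cube, subdivisionHomotopyCube]

theorem subdivide_uncurryChain (z : FormalChain R (unitInterval → X)) :
    subdivide R (uncurryChain R z) =
      uncurryChain R (subdivide R (push R (precomp lowerHalf) z)) +
      uncurryChain R (subdivide R (push R (precomp upperHalf) z)) := by
  refine LinearMap.congr_fun (f := subdivide R ∘ₗ uncurryChain R)
    (g := uncurryChain R ∘ₗ subdivide R ∘ₗ push R (precomp lowerHalf) +
      uncurryChain R ∘ₗ subdivide R ∘ₗ push R (precomp upperHalf))
    (chain_hom_ext fun n c => ?_) z
  simp [subdivide_cube_succ]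

theorem subdivisionHomotopy_uncurryChain (z : FormalChain R (unitInterval → X)) :
    subdivisionHomotopy R (uncurryChain R z) =
      uncurryChain R (uncurryChain R (push R precompGrid z)) -
      uncurryChain R (subdivisionHomotopy R (push R (precomp lowerHalf) z)) -
      uncurryChain R (subdivisionHomotopy R (push R (precomp upperHalf) z)) := by
  refine LinearMap.congr_fun (f := subdivisionHomotopy R ∘ₗ uncurryChain R)
    (g := uncurryChain R ∘ₗ uncurryChain R ∘ₗ push R precompGrid -
      uncurryChain R ∘ₗ subdivisionHomotopy R ∘ₗ push R (precomp lowerHalf) -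
      uncurryChain R ∘ₗ subdivisionHomotopy R ∘ₗ push R (precomp upperHalf))
    (chain_hom_ext fun n c => ?_) z
  simp [subdivisionHomotopy_cube_succ]

theorem push_subdivide_cube {n : ℕ} : ∀ {X Y : Type*} (f : X → Y)
    (c : (Fin n → unitInterval) → X),
    push R f (subdivide R (cube R c)) = subdivide R (cube R (f ∘ c)) := by
  induction n with
  | zero => intro X Y f c; simp [subdivide_cube_zero]
  | succ n ih =>
    intro X Y f c
    rw [subdivide_cube_succ, subdivide_cube_succ]
    simp only [map_add, push_uncurryChain, ih]
    rfl

theorem push_subdivisionHomotopy_cube {n : ℕ} : ∀ {X Y : Type*} (f : X → Y)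
    (c : (Fin n → unitInterval) → X),
    push R f (subdivisionHomotopy R (cube R c)) = subdivisionHomotopy R (cube R (f ∘ c)) := by
  induction n with
  | zero => intro X Y f c; simp [subdivisionHomotopy_cube_zero]
  | succ n ih =>
    intro X Y f c
    rw [subdivisionHomotopy_cube_succ, subdivisionHomotopy_cube_succ]
    simp only [map_sub, push_uncurryChain, ih, push_cube]
    rfl

theorem lowerHalf_zero : lowerHalf 0 = 0 := Subtype.ext (by simp [lowerHalf])

theorem upperHalf_one : upperHalf 1 = 1 := Subtype.ext (by norm_num [upperHalf])

theorem upperHalf_zero : upperHalf 0 = lowerHalf 1 :=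
  Subtype.ext (by simp [lowerHalf, upperHalf])

theorem halfGrid_one_left (b : unitInterval) : halfGrid 1 b = b :=
  Subtype.ext (by norm_num [halfGrid])

theorem halfGrid_zero_left (b : unitInterval) : halfGrid 0 b = lowerHalf b :=
  Subtype.ext (by simp [halfGrid, lowerHalf]; ring)

theorem halfGrid_one_right (a : unitInterval) : halfGrid a 1 = upperHalf a :=
  Subtype.ext (by simp [halfGrid, upperHalf])

theorem halfGrid_zero_right (a : unitInterval) : halfGrid a 0 = 0 :=
  Subtype.ext (by simp [halfGrid])

theorem formalBoundary_subdivide_cube {n : ℕ} : ∀ {X : Type*} (c : (Fin n → unitInterval) → X),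
    formalBoundary R (subdivide R (cube R c)) = subdivide R (formalBoundary R (cube R c)) := by
  induction n with
  | zero => intro X c; simp [subdivide_cube_zero, formalBoundary_cube_zero]
  | succ n ih =>
    intro X c
    have h1 : evalAt 1 ∘ precomp lowerHalf ∘ curryCube c =
        evalAt 0 ∘ precomp upperHalf ∘ curryCube c := by
      funext x; simp [evalAt, precomp, upperHalf_zero]
    have h2 : evalAt 1 ∘ precomp upperHalf ∘ curryCube c = evalAt 1 ∘ curryCube c := by
      funext x; simp [evalAt, precomp, upperHalf_one]
    have h3 : evalAt 0 ∘ precomp lowerHalf ∘ curryCube c = evalAt 0 ∘ curryCube c := by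
      funext x; simp [evalAt, precomp, lowerHalf_zero]
    rw [subdivide_cube_succ, formalBoundary_cube_succ]
    simp only [map_add, map_sub, formalBoundary_uncurryChain, subdivide_uncurryChain, ih,
      push_subdivide_cube, push_formalBoundary, push_cube, h1, h2, h3]
    abel

theorem formalBoundary_subdivide (z : FormalChain R X) :
    formalBoundary R (subdivide R z) = subdivide R (formalBoundary R z) := by
  refine LinearMap.congr_fun (f := formalBoundary R ∘ₗ subdivide R)
    (g := subdivide R ∘ₗ formalBoundary R) (chain_hom_ext fun n c => ?_) z
  simp [formalBoundary_subdivide_cube]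

/-- The square `halfGrid a b` carries the argument: its edge `a = 1` is the whole interval, `a = 0`
the lower half, `b = 1` the upper half and `b = 0` a constant. So its boundary is the identity minus
the two halves, up to a degenerate edge. The recursive terms subdivide the remaining coordinates. -/
theorem subdivisionHomotopy_cube_spec {n : ℕ} : ∀ {X : Type*} (c : (Fin n → unitInterval) → X),
    formalBoundary R (subdivisionHomotopy R (cube R c)) +
      subdivisionHomotopy R (formalBoundary R (cube R c)) - (cube R c - subdivide R (cube R c)) ∈
        degenerate R X := by
  induction n with
  | zero =>
    intro X c
    simp [subdivide_cube_zero, formalBoundary_cube_zero, subdivisionHomotopy_cube_zero]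
  | succ n ih =>
    intro X c
    have h1 : evalAt 1 ∘ precomp lowerHalf ∘ curryCube c =
        evalAt 0 ∘ precomp upperHalf ∘ curryCube c := by
      funext x; simp [evalAt, precomp, upperHalf_zero]
    have h2 : evalAt 1 ∘ precomp upperHalf ∘ curryCube c = evalAt 1 ∘ curryCube c := by
      funext x; simp [evalAt, precomp, upperHalf_one]
    have h3 : evalAt 0 ∘ precomp lowerHalf ∘ curryCube c = evalAt 0 ∘ curryCube c := by
      funext x; simp [evalAt, precomp, lowerHalf_zero]
    have g1 : (evalAt 1 ∘ ·) ∘ precompGrid ∘ curryCube c = curryCube c := by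
      funext x b; simp [evalAt, precompGrid, halfGrid_one_left]
    have g2 : (evalAt 0 ∘ ·) ∘ precompGrid ∘ curryCube c = precomp lowerHalf ∘ curryCube c := by
      funext x b; simp [evalAt, precompGrid, precomp, halfGrid_zero_left]
    have g3 : evalAt 1 ∘ precompGrid ∘ curryCube c = precomp upperHalf ∘ curryCube c := by
      funext x b; simp [evalAt, precompGrid, precomp, halfGrid_one_right]
    have g4 : evalAt 0 ∘ precompGrid ∘ curryCube c =
        (fun a (_ : unitInterval) => a) ∘ evalAt 0 ∘ curryCube c := by
      funext x b; simp [evalAt, precompGrid, halfGrid_zero_right]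
    have e1 := uncurryChain_mem_degenerate (ih (precomp lowerHalf ∘ curryCube c))
    have e2 := uncurryChain_mem_degenerate (ih (precomp upperHalf ∘ curryCube c))
    have e3 := uncurryChain_push_const_mem (R := R) (cube R (evalAt 0 ∘ curryCube c))
    -- The defect is the sum of the defects for the two halves, known by induction, and of the
    -- constant edge of the square.
    convert add_mem (add_mem e1 e2) e3 using 1
    rw [subdivisionHomotopy_cube_succ, formalBoundary_cube_succ, subdivide_cube_succ]
    simp only [map_add, map_sub, formalBoundary_uncurryChain, subdivisionHomotopy_uncurryChain,
      push_subdivisionHomotopy_cube, push_formalBoundary, push_cube, push_uncurryChain,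
      g1, g2, g3, g4, h1, h2, h3, uncurryChain_curryCube]
    abel

theorem subdivisionHomotopy_spec (z : FormalChain R X) :
    formalBoundary R (subdivisionHomotopy R z) + subdivisionHomotopy R (formalBoundary R z) -
      (z - subdivide R z) ∈ degenerate R X := by
  have : (⊤ : Submodule R (FormalChain R X)) ≤ (degenerate R X).comap
      (formalBoundary R ∘ₗ subdivisionHomotopy R + subdivisionHomotopy R ∘ₗ formalBoundary R -
        (LinearMap.id - subdivide R)) := by
    rw [← Finsupp.supported_univ]
    refine supported_le_of_cube fun n c _ => ?_
    exact subdivisionHomotopy_cube_spec c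
  exact this (Submodule.mem_top (x := z))

end Subdivision

/-! ### Chains in a subset -/

section ChainsIn

variable {R : Type*} [CommRing R] {X Y : Type*} [TopologicalSpace X] [TopologicalSpace Y]

variable (R) in
/-- The chains spanned by the singular cubes of the subset `U`, and by the degenerate cubes. -/
noncomputable def chainsIn (U : Set X) : Submodule R (FormalChain R X) :=
  Finsupp.supported R R ({c | Continuous c.2 ∧ ∀ x, c.2 x ∈ U} ∪ {c | DegenerateCube c.2})

theorem cube_mem_chainsIn {U : Set X} {n : ℕ} {c : (Fin n → unitInterval) → X}
    (hc : Continuous c) (hU : ∀ x, c x ∈ U) : cube R c ∈ chainsIn R U :=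
  Finsupp.single_mem_supported R _ (Or.inl ⟨hc, hU⟩)

theorem degenerate_le_chainsIn (U : Set X) : degenerate R X ≤ chainsIn R U :=
  Finsupp.supported_mono Set.subset_union_right

theorem chainsIn_mono {U V : Set X} (h : U ⊆ V) : chainsIn R U ≤ chainsIn R V :=
  Finsupp.supported_mono (Set.union_subset_union_left _ fun _ hc => ⟨hc.1, fun x => h (hc.2 x)⟩)

/-- Both modules are spanned by basis cubes, so membership can be tested on supports. This is needed
in excision, where a chain known to lie in each of two sets has to be pulled back from their
intersection. -/
theorem mem_chainsIn_inter {U V : Set X} {z : FormalChain R X} (hU : z ∈ chainsIn R U)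
    (hV : z ∈ chainsIn R V) : z ∈ chainsIn R (U ∩ V) := by
  have : z ∈ chainsIn R U ⊓ chainsIn R V := ⟨hU, hV⟩
  rw [chainsIn, chainsIn, ← Finsupp.supported_inter] at this
  refine Finsupp.supported_mono ?_ this
  rintro c ⟨h1 | h1, h2 | h2⟩
  · exact Or.inl ⟨h1.1, fun x => ⟨h1.2 x, h2.2 x⟩⟩
  all_goals exact Or.inr (by assumption)

theorem chainsIn_le {U : Set X} {M : Submodule R (FormalChain R X)} (hd : degenerate R X ≤ M)
    (h : ∀ n (c : (Fin n → unitInterval) → X), Continuous c → (∀ x, c x ∈ U) → cube R c ∈ M) :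
    chainsIn R U ≤ M := by
  refine supported_le_of_cube ?_
  rintro n c (hc | hc)
  · exact h n c hc.1 hc.2
  · exact hd (cube_mem_degenerate hc)

theorem push_mem_chainsIn {f : X → Y} {U : Set X} {V : Set Y} (hf : ContinuousOn f U)
    (hUV : Set.MapsTo f U V) {z : FormalChain R X} (hz : z ∈ chainsIn R U) :
    push R f z ∈ chainsIn R V := by
  have : chainsIn R U ≤ (chainsIn R V).comap (push R f) := by
    refine chainsIn_le (fun z hz => degenerate_le_chainsIn _ (push_mem_degenerate f hz))
      fun n c hc hU => ?_
    rw [Submodule.mem_comap, push_cube]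
    exact cube_mem_chainsIn (hf.comp_continuous hc hU) fun x => hUV (hU x)
  exact this hz

/-- The difference is only degenerate and not zero, since `chainsIn R U` contains degenerate cubes
that leave `U`, where `f` and `g` may differ. -/
theorem push_congr {Z : Type*} {f g : X → Z} {U : Set X} (h : Set.EqOn f g U)
    {z : FormalChain R X} (hz : z ∈ chainsIn R U) : push R f z - push R g z ∈ degenerate R Z := by
  have : chainsIn R U ≤ (degenerate R Z).comap (push R f - push R g) := by
    refine chainsIn_le
      (fun z hz => sub_mem (push_mem_degenerate f hz) (push_mem_degenerate g hz))
      fun n c hc hU => ?_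
    have : f ∘ c = g ∘ c := funext fun x => h (hU x)
    simp [this]
  exact this hz

theorem formalBoundary_mem_chainsIn {U : Set X} {z : FormalChain R X} (hz : z ∈ chainsIn R U) :
    formalBoundary R z ∈ chainsIn R U := by
  have : chainsIn R U ≤ (chainsIn R U).comap (formalBoundary R) := by
    refine chainsIn_le (fun z hz => degenerate_le_chainsIn _ (formalBoundary_mem_degenerate hz))
      fun n c hc hU => ?_
    rw [Submodule.mem_comap]
    cases n with
    | zero => rw [formalBoundary_cube_zero]; exact zero_mem _
    | succ n =>
      rw [formalBoundary_cube_eq_sum]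
      refine sum_mem fun i _ => Submodule.smul_mem _ _ (sub_mem ?_ ?_) <;>
        exact cube_mem_chainsIn (by fun_prop) fun x => hU _
  exact this hz

/-! ### Subdivision of chains in a subset -/

theorem subdivide_mem_degenerate_cube {n : ℕ} : ∀ {X : Type*} {c : (Fin n → unitInterval) → X},
    DegenerateCube c → subdivide R (cube R c) ∈ degenerate R X := by
  induction n with
  | zero => rintro X c ⟨i, _⟩; exact i.elim0
  | succ n ih =>
    intro X c hc
    rw [subdivide_cube_succ]
    rcases hc.curry with h | h
    · have h' : ∀ p : unitInterval → unitInterval, precomp p ∘ curryCube c =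
          (fun a (_ : unitInterval) => a) ∘ (evalAt 0 ∘ curryCube c) := by
        intro p; rw [h]; rfl
      rw [h', h', ← push_subdivide_cube]
      exact add_mem (uncurryChain_push_const_mem _) (uncurryChain_push_const_mem _)
    · refine add_mem (uncurryChain_mem_degenerate ?_) (uncurryChain_mem_degenerate ?_) <;>
        rw [← push_subdivide_cube] <;> exact push_mem_degenerate _ (ih h)

theorem subdivisionHomotopy_mem_degenerate_cube {n : ℕ} :
    ∀ {X : Type*} {c : (Fin n → unitInterval) → X},
    DegenerateCube c → subdivisionHomotopy R (cube R c) ∈ degenerate R X := by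
  induction n with
  | zero => rintro X c ⟨i, _⟩; exact i.elim0
  | succ n ih =>
    intro X c hc
    rw [subdivisionHomotopy_cube_succ]
    rcases hc.curry with h | h
    · have h' : ∀ p : unitInterval → unitInterval, precomp p ∘ curryCube c =
          (fun a (_ : unitInterval) => a) ∘ (evalAt 0 ∘ curryCube c) := by
        intro p; rw [h]; rfl
      have h2 : precompGrid ∘ curryCube c =
          (fun a (_ : unitInterval) => a) ∘
            (fun a (_ : unitInterval) => a) ∘ (evalAt 0 ∘ curryCube c) := by
        rw [h]; rfl
      rw [h', h', h2, ← push_subdivisionHomotopy_cube, ← push_cube]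
      exact sub_mem (sub_mem (uncurryChain_mem_degenerate (uncurryChain_push_const_mem _))
        (uncurryChain_push_const_mem _)) (uncurryChain_push_const_mem _)
    · refine sub_mem (sub_mem (uncurryChain_mem_degenerate (uncurryChain_mem_degenerate ?_))
        (uncurryChain_mem_degenerate ?_)) (uncurryChain_mem_degenerate ?_)
      · rw [← push_cube]
        exact push_mem_degenerate _ (cube_mem_degenerate h)
      all_goals rw [← push_subdivisionHomotopy_cube]; exact push_mem_degenerate _ (ih h)

theorem dist_lowerHalf (a b : unitInterval) : dist (lowerHalf a) (lowerHalf b) = dist a b / 2 := by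
  simp only [Subtype.dist_eq, Real.dist_eq, lowerHalf]
  rw [← sub_div, abs_div, abs_of_pos (two_pos : (0 : ℝ) < 2)]

theorem dist_upperHalf (a b : unitInterval) : dist (upperHalf a) (upperHalf b) = dist a b / 2 := by
  simp only [Subtype.dist_eq, Real.dist_eq, upperHalf]
  rw [← sub_div, abs_div, abs_of_pos (two_pos : (0 : ℝ) < 2), add_sub_add_left_eq_sub]

theorem dist_cons_tail_le {n : ℕ} {h : unitInterval → unitInterval}
    (hh : ∀ a b, dist (h a) (h b) = dist a b / 2) {f : (Fin n → unitInterval) → Fin n → unitInterval}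
    (hf : ∀ x y, dist (f x) (f y) ≤ dist x y / 2) (x y : Fin (n + 1) → unitInterval) :
    dist (Fin.cons (h (x 0)) (f (Fin.tail x)) : Fin (n + 1) → unitInterval)
      (Fin.cons (h (y 0)) (f (Fin.tail y))) ≤ dist x y / 2 := by
  have h0 : (0 : ℝ) ≤ dist x y / 2 := by positivity
  refine (dist_pi_le_iff h0).2 fun i => ?_
  induction i using Fin.cases with
  | zero =>
    simp only [Fin.cons_zero, hh]
    linarith [dist_le_pi_dist x y 0]
  | succ i =>
    simp only [Fin.cons_succ]
    have h1 := (dist_le_pi_dist (f (Fin.tail x)) (f (Fin.tail y)) i).trans (hf _ _)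
    have h2 : dist (Fin.tail x) (Fin.tail y) ≤ dist x y :=
      (dist_pi_le_iff dist_nonneg).2 fun j => dist_le_pi_dist x y j.succ
    linarith

/-- Writing the pieces as reparametrizations `c ∘ f` with `f` contracting by `1 / 2` serves two
purposes: the pieces stay in any set that contains the image of `c`, and iteration makes them small.
-/
theorem subdivide_cube_mem_span {n : ℕ} : ∀ {X : Type*} (c : (Fin n → unitInterval) → X),
    subdivide R (cube R c) ∈ Submodule.span R {z | ∃ f : (Fin n → unitInterval) →
      (Fin n → unitInterval), (∀ x y, dist (f x) (f y) ≤ dist x y / 2) ∧ z = cube R (c ∘ f)} := by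
  induction n with
  | zero =>
    intro X c
    rw [subdivide_cube_zero]
    refine Submodule.subset_span ⟨id, fun x y => ?_, rfl⟩
    rw [Subsingleton.elim x y]; simp
  | succ n ih =>
    intro X c
    have key : ∀ h : unitInterval → unitInterval, (∀ a b, dist (h a) (h b) = dist a b / 2) →
        uncurryChain R (subdivide R (cube R (precomp h ∘ curryCube c))) ∈
        Submodule.span R {z | ∃ f : (Fin (n + 1) → unitInterval) → (Fin (n + 1) → unitInterval),
          (∀ x y, dist (f x) (f y) ≤ dist x y / 2) ∧ z = cube R (c ∘ f)} := by
      intro h hh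
      have := Submodule.mem_map_of_mem (f := uncurryChain R) (ih (precomp h ∘ curryCube c))
      rw [Submodule.map_span] at this
      refine Submodule.span_mono ?_ this
      rintro _ ⟨_, ⟨f, hf, rfl⟩, rfl⟩
      refine ⟨fun x => Fin.cons (h (x 0)) (f (Fin.tail x)), dist_cons_tail_le hh hf, ?_⟩
      rw [uncurryChain_cube]
      rfl
    rw [subdivide_cube_succ]
    exact add_mem (key _ dist_lowerHalf) (key _ dist_upperHalf)

theorem continuous_lowerHalf : Continuous lowerHalf := by unfold lowerHalf; fun_prop

theorem continuous_upperHalf : Continuous upperHalf := by unfold upperHalf; fun_prop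

/-- The homotopy need not shrink anything; continuity of the reparametrizations is enough to keep it
inside a given set. -/
theorem subdivisionHomotopy_cube_mem_span {n : ℕ} : ∀ {X : Type*} (c : (Fin n → unitInterval) → X),
    subdivisionHomotopy R (cube R c) ∈ Submodule.span R {z | ∃ f : (Fin (n + 1) → unitInterval) →
      (Fin n → unitInterval), Continuous f ∧ z = cube R (c ∘ f)} := by
  induction n with
  | zero =>
    intro X c
    rw [subdivisionHomotopy_cube_zero]
    exact zero_mem _
  | succ n ih =>
    intro X c
    have key : ∀ h : unitInterval → unitInterval, Continuous h →
        uncurryChain R (subdivisionHomotopy R (cube R (precomp h ∘ curryCube c))) ∈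
        Submodule.span R {z | ∃ f : (Fin (n + 1 + 1) → unitInterval) → (Fin (n + 1) → unitInterval),
          Continuous f ∧ z = cube R (c ∘ f)} := by
      intro h hh
      have := Submodule.mem_map_of_mem (f := uncurryChain R) (ih (precomp h ∘ curryCube c))
      rw [Submodule.map_span] at this
      refine Submodule.span_mono ?_ this
      rintro _ ⟨_, ⟨f, hf, rfl⟩, rfl⟩
      refine ⟨fun x => Fin.cons (h (x 0)) (f (Fin.tail x)), ?_, ?_⟩
      · exact Continuous.finCons (by fun_prop) (hf.comp (by unfold Fin.tail; fun_prop))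
      · rw [uncurryChain_cube]
        rfl
    rw [subdivisionHomotopy_cube_succ]
    refine sub_mem (sub_mem ?_ (key _ continuous_lowerHalf)) (key _ continuous_upperHalf)
    refine Submodule.subset_span
      ⟨fun x => Fin.cons (halfGrid (x 0) (x 1)) (Fin.tail (Fin.tail x)), ?_, ?_⟩
    · refine Continuous.finCons ?_ (by unfold Fin.tail; fun_prop)
      unfold halfGrid; fun_prop
    · rw [uncurryChain_cube, uncurryChain_cube]
      rfl

theorem subdivide_mem_chainsIn {U : Set X} {z : FormalChain R X} (hz : z ∈ chainsIn R U) :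
    subdivide R z ∈ chainsIn R U := by
  have : chainsIn R U ≤ (chainsIn R U).comap (subdivide R) := by
    refine chainsIn_le ?_ fun n c hc hU => ?_
    · exact supported_le_of_cube fun n c hc =>
        degenerate_le_chainsIn _ (subdivide_mem_degenerate_cube hc)
    · change subdivide R (cube R c) ∈ chainsIn R U
      refine Submodule.span_le.2 ?_ (subdivide_cube_mem_span c)
      rintro _ ⟨f, hf, rfl⟩
      have hf' : Continuous f := (LipschitzWith.of_dist_le_mul (K := 1) fun x y => by
        have := hf x y
        have h0 : (0 : ℝ) ≤ dist x y := dist_nonneg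
        simp only [NNReal.coe_one, one_mul]; linarith).continuous
      exact cube_mem_chainsIn (hc.comp hf') fun x => hU _
  exact this hz

theorem subdivisionHomotopy_mem_chainsIn {U : Set X} {z : FormalChain R X}
    (hz : z ∈ chainsIn R U) : subdivisionHomotopy R z ∈ chainsIn R U := by
  have : chainsIn R U ≤ (chainsIn R U).comap (subdivisionHomotopy R) := by
    refine chainsIn_le ?_ fun n c hc hU => ?_
    · exact supported_le_of_cube fun n c hc =>
        degenerate_le_chainsIn _ (subdivisionHomotopy_mem_degenerate_cube hc)
    · change subdivisionHomotopy R (cube R c) ∈ chainsIn R U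
      refine Submodule.span_le.2 ?_ (subdivisionHomotopy_cube_mem_span c)
      rintro _ ⟨f, hf, rfl⟩
      exact cube_mem_chainsIn (hc.comp hf) fun x => hU _
  exact this hz

theorem subdivide_iterate_cube_mem_span {n : ℕ} (c : (Fin n → unitInterval) → X) (N : ℕ) :
    (subdivide R)^[N] (cube R c) ∈ Submodule.span R {z | ∃ f : (Fin n → unitInterval) →
      (Fin n → unitInterval), (∀ x y, dist (f x) (f y) ≤ dist x y / 2 ^ N) ∧
        z = cube R (c ∘ f)} := by
  induction N with
  | zero => exact Submodule.subset_span ⟨id, fun x y => by simp, rfl⟩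
  | succ N ih =>
    rw [Function.iterate_succ_apply']
    have := Submodule.mem_map_of_mem (f := subdivide R) ih
    rw [Submodule.map_span] at this
    refine Submodule.span_le.2 ?_ this
    rintro _ ⟨_, ⟨f, hf, rfl⟩, rfl⟩
    refine Submodule.span_mono ?_ (subdivide_cube_mem_span (R := R) (c ∘ f))
    rintro _ ⟨g, hg, rfl⟩
    refine ⟨f ∘ g, fun x y => ?_, rfl⟩
    calc dist (f (g x)) (f (g y)) ≤ dist (g x) (g y) / 2 ^ N := hf _ _
      _ ≤ (dist x y / 2) / 2 ^ N := by gcongr; exact hg x y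
      _ = dist x y / 2 ^ (N + 1) := by rw [div_div, pow_succ']

/-- A cube in the union of two open sets becomes small with respect to them after subdivision. -/
theorem exists_subdivide_iterate_cube_mem {S U V : Set X} (hU : IsOpen U) (hV : IsOpen V)
    (hS : S ⊆ U ∪ V) {n : ℕ} {c : (Fin n → unitInterval) → X} (hc : Continuous c)
    (hcS : ∀ x, c x ∈ S) :
    ∃ N, (subdivide R)^[N] (cube R c) ∈ chainsIn R (S ∩ U) ⊔ chainsIn R (S ∩ V) := by
  obtain ⟨δ, hδ, hball⟩ := lebesgue_number_lemma_of_metric (s := (Set.univ : Set (Fin n → unitInterval)))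
    (c := fun b : Bool => if b then c ⁻¹' U else c ⁻¹' V) isCompact_univ
    (by rintro (_ | _) <;> simp <;> exact IsOpen.preimage hc (by assumption))
    (fun x _ => by
      rcases hS (hcS x) with h | h
      · exact Set.mem_iUnion.2 ⟨true, by simpa using h⟩
      · exact Set.mem_iUnion.2 ⟨false, by simpa using h⟩)
  -- The cube has diameter at most `1` in the sup metric, so after `N` subdivisions the pieces have
  -- diameter at most `(1 / 2) ^ N`, below the Lebesgue number `δ` of the two preimages.
  obtain ⟨N, hN⟩ := exists_pow_lt_of_lt_one hδ (show (1 / 2 : ℝ) < 1 by norm_num)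
  refine ⟨N, Submodule.span_le.2 ?_ (subdivide_iterate_cube_mem_span c N)⟩
  rintro _ ⟨f, hf, rfl⟩
  have hdist : ∀ x y, dist (f x) (f y) ≤ (1 / 2) ^ N := fun x y => by
    refine (hf x y).trans ?_
    rw [one_div_pow]
    have : dist x y ≤ 1 := (dist_pi_le_iff zero_le_one).2 fun i => by
      rw [Subtype.dist_eq, Real.dist_eq, abs_le]
      have := (x i).2.1; have := (x i).2.2; have := (y i).2.1; have := (y i).2.2
      constructor <;> linarith
    gcongr
  have hf' : Continuous f := (LipschitzWith.of_dist_le_mul (K := 1) fun x y => by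
    refine (hf x y).trans ?_
    rw [NNReal.coe_one, one_mul]
    exact div_le_self dist_nonneg (one_le_pow₀ one_le_two)).continuous
  obtain ⟨b, hb⟩ := hball (f fun _ => 0) (Set.mem_univ _)
  have hx : ∀ x, f x ∈ Metric.ball (f fun _ => 0) δ := fun x => (hdist _ _).trans_lt hN
  cases b with
  | true =>
    refine Submodule.mem_sup_left (cube_mem_chainsIn (hc.comp hf') fun x => ⟨hcS _, ?_⟩)
    simpa using hb (hx x)
  | false =>
    refine Submodule.mem_sup_right (cube_mem_chainsIn (hc.comp hf') fun x => ⟨hcS _, ?_⟩)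
    simpa using hb (hx x)

theorem subdivide_iterate_mem {M : Submodule R (FormalChain R X)}
    (hM : ∀ z ∈ M, subdivide R z ∈ M) (N : ℕ) {z : FormalChain R X} (hz : z ∈ M) :
    (subdivide R)^[N] z ∈ M := by
  induction N with
  | zero => exact hz
  | succ N ih => rw [Function.iterate_succ_apply']; exact hM _ ih

theorem exists_subdivide_iterate_mem {S U V : Set X} (hU : IsOpen U) (hV : IsOpen V)
    (hS : S ⊆ U ∪ V) {z : FormalChain R X} (hz : z ∈ chainsIn R S) :
    ∃ N, (subdivide R)^[N] z ∈ chainsIn R (S ∩ U) ⊔ chainsIn R (S ∩ V) := by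
  set M := chainsIn R (S ∩ U) ⊔ chainsIn R (S ∩ V) with hMdef
  have hM : ∀ z ∈ M, subdivide R z ∈ M := by
    intro z hz
    obtain ⟨a, ha, b, hb, rfl⟩ := Submodule.mem_sup.1 hz
    rw [map_add]
    exact Submodule.add_mem_sup (subdivide_mem_chainsIn ha) (subdivide_mem_chainsIn hb)
  have hiter : ∀ N, ((subdivide R)^[N] : FormalChain R X → FormalChain R X) =
      ((subdivide R (X := X)) ^ N : Module.End R (FormalChain R X)) := fun N => by
    rw [Module.End.coe_pow]
  rw [chainsIn, Finsupp.supported_eq_span_single] at hz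
  induction hz using Submodule.span_induction with
  | mem x hx =>
    obtain ⟨⟨n, c⟩, hc | hc, rfl⟩ := hx
    · exact exists_subdivide_iterate_cube_mem hU hV hS hc.1 hc.2
    · exact ⟨0, Submodule.mem_sup_left (degenerate_le_chainsIn _ (cube_mem_degenerate hc))⟩
  | zero => exact ⟨0, zero_mem _⟩
  | add x y _ _ hx hy =>
    obtain ⟨N₁, h₁⟩ := hx
    obtain ⟨N₂, h₂⟩ := hy
    -- Small chains stay small under further subdivision, so the two exponents may be added.
    refine ⟨N₁ + N₂, ?_⟩
    rw [hiter, map_add, ← hiter]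
    refine add_mem ?_ ?_
    · rw [add_comm, Function.iterate_add_apply]
      exact subdivide_iterate_mem hM _ h₁
    · rw [Function.iterate_add_apply]
      exact subdivide_iterate_mem hM _ h₂
  | smul r x _ hx =>
    obtain ⟨N, h⟩ := hx
    refine ⟨N, ?_⟩
    rw [hiter, map_smul, ← hiter]
    exact Submodule.smul_mem _ _ h

end ChainsIn

/-! ### Relative acyclicity -/

section RelEq

variable {R : Type*} [CommRing R] {X Y : Type*}

/-- `A ≤ B` and the complex `B / A` is acyclic. -/
def RelEq (A B : Submodule R (FormalChain R X)) : Prop :=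
  A ≤ B ∧ ∀ b ∈ B, formalBoundary R b ∈ A → ∃ a ∈ A, ∃ s ∈ B, b = a + formalBoundary R s

theorem RelEq.trans {A B C : Submodule R (FormalChain R X)} (h₁ : RelEq A B) (h₂ : RelEq B C) :
    RelEq A C := by
  refine ⟨h₁.1.trans h₂.1, fun c hc hcA => ?_⟩
  obtain ⟨b, hb, s, hs, rfl⟩ := h₂.2 c hc (h₁.1 hcA)
  obtain ⟨a, ha, t, ht, rfl⟩ := h₁.2 b hb (by simpa using hcA)
  exact ⟨a, ha, t + s, add_mem (h₂.1 ht) hs, by rw [map_add, add_assoc]⟩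

/-- Together with `RelEq.trans` these are two cases of the long exact sequence of the triple `A ≤ B
≤ C`: if `B / A` and `C / A` are acyclic, so is `C / B`. -/
theorem RelEq.cancel_left {A B C : Submodule R (FormalChain R X)} (h₁ : RelEq A B)
    (h₂ : RelEq A C) (hBC : B ≤ C) : RelEq B C := by
  refine ⟨hBC, fun c hc hcB => ?_⟩
  obtain ⟨a, ha, b, hb, h⟩ := h₁.2 _ hcB (by simp)
  obtain ⟨a', ha', s, hs, h'⟩ := h₂.2 (c - b) (sub_mem hc (hBC hb)) (by
    rw [map_sub, h]; simpa using ha)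
  exact ⟨a' + b, add_mem (h₁.1 ha') hb, s, hs, by rw [eq_add_of_sub_eq h']; abel⟩

end RelEq

section Topology

variable {R : Type*} [CommRing R] {X Y : Type*} [TopologicalSpace X] [TopologicalSpace Y]

/-- Excision: a chain becomes small after finitely many subdivisions, and each subdivision changes
it by a boundary plus the homotopy applied to its boundary, which is already small. The induction is
on the number of subdivisions. -/
theorem relEq_sup_of_isOpen {S U V : Set X} (hU : IsOpen U) (hV : IsOpen V) (hS : S ⊆ U ∪ V) :
    RelEq (chainsIn R (S ∩ U) ⊔ chainsIn R (S ∩ V)) (chainsIn R S) := by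
  refine ⟨sup_le (chainsIn_mono Set.inter_subset_left) (chainsIn_mono Set.inter_subset_left),
    fun b hb hbA => ?_⟩
  obtain ⟨N, hN⟩ := exists_subdivide_iterate_mem hU hV hS hb
  set M := chainsIn R (S ∩ U) ⊔ chainsIn R (S ∩ V) with hMdef
  induction N generalizing b with
  | zero => exact ⟨b, hN, 0, zero_mem _, by simp⟩
  | succ N ih =>
    rw [Function.iterate_succ_apply] at hN
    have hM : ∀ z ∈ M, subdivide R z ∈ M := by
      intro z hz
      obtain ⟨a, ha, b, hb, rfl⟩ := Submodule.mem_sup.1 hz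
      rw [map_add]
      exact Submodule.add_mem_sup (subdivide_mem_chainsIn ha) (subdivide_mem_chainsIn hb)
    have hM' : ∀ z ∈ M, subdivisionHomotopy R z ∈ M := by
      intro z hz
      obtain ⟨a, ha, b, hb, rfl⟩ := Submodule.mem_sup.1 hz
      rw [map_add]
      exact Submodule.add_mem_sup (subdivisionHomotopy_mem_chainsIn ha)
        (subdivisionHomotopy_mem_chainsIn hb)
    obtain ⟨a, ha, s, hs, h⟩ := ih (subdivide R b) (subdivide_mem_chainsIn hb)
      (by rw [formalBoundary_subdivide]; exact hM _ hbA) hN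
    have hd := subdivisionHomotopy_spec b
    set d := formalBoundary R (subdivisionHomotopy R b) +
      subdivisionHomotopy R (formalBoundary R b) - (b - subdivide R b) with hdef
    refine ⟨a + subdivisionHomotopy R (formalBoundary R b) - d, sub_mem (add_mem ha (hM' _ hbA))
      (Submodule.mem_sup_left (degenerate_le_chainsIn _ hd)), s + subdivisionHomotopy R b,
      add_mem hs (subdivisionHomotopy_mem_chainsIn hb), ?_⟩
    rw [hdef, map_add]
    rw [h]
    abel

/-- The prism operator of `H` moves a chain of `U` into `A`. Since `A` is preserved at all times,
the prism over a boundary lying in `A` also lies in `A`, so `A` need not be fixed pointwise. -/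
theorem relEq_of_homotopy {A U : Set X} (H : X → unitInterval → X) (hAU : A ⊆ U)
    (hH : ContinuousOn (fun p : X × unitInterval => H p.1 p.2) (U ×ˢ Set.univ))
    (h0 : ∀ x ∈ U, H x 0 = x) (h1 : ∀ x ∈ U, H x 1 ∈ A) (hU : ∀ x ∈ U, ∀ t, H x t ∈ U)
    (hA : ∀ x ∈ A, ∀ t, H x t ∈ A) : RelEq (chainsIn R A) (chainsIn R U) := by
  have hP : ∀ W : Set X, W ⊆ U → (∀ x ∈ W, ∀ t, H x t ∈ W) → ∀ z ∈ chainsIn R W,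
      uncurryChain R (push R H z) ∈ chainsIn R W := by
    intro W hWU hW z hz
    have : chainsIn R W ≤ (chainsIn R W).comap (uncurryChain R ∘ₗ push R H) := by
      refine chainsIn_le (fun z hz => degenerate_le_chainsIn _
        (uncurryChain_mem_degenerate (push_mem_degenerate H hz))) fun n c hc hcW => ?_
      simp only [Submodule.mem_comap, LinearMap.comp_apply, push_cube, uncurryChain_cube]
      refine cube_mem_chainsIn ?_ fun x => hW _ (hcW _) _
      have : Continuous fun x : Fin (n + 1) → unitInterval => (c (Fin.tail x), x 0) :=
        (hc.comp (by unfold Fin.tail; fun_prop)).prodMk (continuous_apply 0)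
      exact hH.comp_continuous this fun x => ⟨hWU (hcW _), Set.mem_univ _⟩
    exact this hz
  refine ⟨chainsIn_mono hAU, fun b hb hbA => ?_⟩
  have hb1 : push R (evalAt 1 ∘ H) b ∈ chainsIn R A := by
    refine push_mem_chainsIn (U := U) ?_ h1 hb
    exact hH.comp (f := fun x => (x, (1 : unitInterval))) (by fun_prop)
      fun x hx => ⟨hx, Set.mem_univ _⟩
  have hb0 : push R (evalAt 0 ∘ H) b - push R id b ∈ degenerate R X := push_congr h0 hb
  rw [push_id] at hb0
  have key := formalBoundary_uncurryChain (push R H b)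
  rw [push_push, push_push, ← push_formalBoundary] at key
  -- The middle term corrects for `H` at time `0` being the identity on `U` only, so that `b` is
  -- recovered modulo degenerate cubes.
  refine ⟨push R (evalAt 1 ∘ H) b - (push R (evalAt 0 ∘ H) b - b) -
    uncurryChain R (push R H (formalBoundary R b)), sub_mem (sub_mem hb1
      (degenerate_le_chainsIn _ hb0)) (hP A hAU hA _ hbA), -uncurryChain R (push R H b),
      neg_mem (hP U subset_rfl hU b hb), ?_⟩
  rw [map_neg, key]
  abel

variable (R) in
/-- A point as a cube of dimension `0`. -/
noncomputable def pointChain (p : X) : FormalChain R X := cube R fun _ : Fin 0 → unitInterval => p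

/-- The only cubes at a point are constant, and a constant cube of positive dimension is degenerate.
-/
theorem chainsIn_singleton (p : X) :
    chainsIn R {p} ≤ degenerate R X ⊔ Submodule.span R {pointChain R p} := by
  refine chainsIn_le le_sup_left fun n c hc hp => ?_
  have : c = fun _ => p := funext hp
  subst this
  cases n with
  | zero => exact Submodule.mem_sup_right (Submodule.mem_span_singleton_self _)
  | succ n => exact Submodule.mem_sup_left (cube_mem_degenerate ⟨0, fun _ _ _ => rfl⟩)

end Topology

/-! ### The cube and its boundary -/

section CubeGeometry

/-- The boundary of the cube. -/
def cubeBoundary (d : ℕ) : Set (Fin d → unitInterval) := {x | ∃ i, x i = 0 ∨ x i = 1}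

/-- The center of the cube. -/
noncomputable def cubeCenter (d : ℕ) : Fin d → unitInterval :=
  fun _ => ⟨1 / 2, by norm_num, by norm_num⟩

/-- The distance from the center, normalized to be `1` on the boundary. -/
noncomputable def cubeRadius {d : ℕ} (x : Fin d → unitInterval) : ℝ :=
  ‖fun i => 2 * (x i : ℝ) - 1‖

/-- The radial homotopy from the identity to the projection from the center to the boundary. -/
noncomputable def radialHomotopy {d : ℕ} (x : Fin d → unitInterval) (t : unitInterval) :
    Fin d → unitInterval := fun i =>
  Set.projIcc (0 : ℝ) 1 zero_le_one
    (1 / 2 + ((x i : ℝ) - 1 / 2) * ((1 - (t : ℝ)) + t / cubeRadius x))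

variable {d : ℕ}

theorem abs_le_cubeRadius (x : Fin d → unitInterval) (i : Fin d) :
    |2 * (x i : ℝ) - 1| ≤ cubeRadius x :=
  norm_le_pi_norm (fun i => 2 * (x i : ℝ) - 1) i

theorem cubeRadius_nonneg (x : Fin d → unitInterval) : 0 ≤ cubeRadius x := norm_nonneg _

theorem cubeRadius_le_one (x : Fin d → unitInterval) : cubeRadius x ≤ 1 :=
  (pi_norm_le_iff_of_nonneg zero_le_one).2 fun i => by
    have := (x i).2.1; have := (x i).2.2
    rw [Real.norm_eq_abs, abs_le]
    constructor <;> linarith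

theorem cubeRadius_eq_one {x : Fin d → unitInterval} (hx : x ∈ cubeBoundary d) :
    cubeRadius x = 1 := by
  obtain ⟨i, hi⟩ := hx
  refine le_antisymm (cubeRadius_le_one x) ?_
  refine le_trans (le_of_eq ?_) (abs_le_cubeRadius x i)
  rcases hi with hi | hi <;> norm_num [hi]

theorem cubeRadius_pos {x : Fin d → unitInterval} (hx : x ≠ cubeCenter d) : 0 < cubeRadius x := by
  refine (cubeRadius_nonneg x).lt_of_ne' fun h => hx ?_
  funext i
  have := abs_le_cubeRadius x i
  rw [h] at this
  have := abs_nonpos_iff.1 this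
  exact Subtype.ext (by simp [cubeCenter]; linarith)

theorem continuous_cubeRadius : Continuous (cubeRadius (d := d)) := by
  unfold cubeRadius; fun_prop

theorem cubeCenter_notMem : cubeCenter d ∉ cubeBoundary d := by
  rintro ⟨i, hi | hi⟩ <;> · have := congrArg Subtype.val hi; norm_num [cubeCenter] at this

/-- The projection to `[0,1]` in the definition only makes the map total. Away from the centre the
rescaled offset has absolute value at most `1 / 2`, because each offset is at most half of
`cubeRadius x`. -/
theorem radialHomotopy_val {x : Fin d → unitInterval} (hx : x ≠ cubeCenter d) (t : unitInterval)
    (i : Fin d) : (radialHomotopy x t i : ℝ) =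
      1 / 2 + ((x i : ℝ) - 1 / 2) * ((1 - (t : ℝ)) + t / cubeRadius x) := by
  have hs := cubeRadius_pos hx
  have h1 := cubeRadius_le_one x
  have h2 := abs_le_cubeRadius x i
  have ht0 := t.2.1
  have ht1 := t.2.2
  have hk : 0 ≤ (1 - (t : ℝ)) + t / cubeRadius x := by
    have : 0 ≤ (t : ℝ) / cubeRadius x := by positivity
    linarith
  have hb : |((x i : ℝ) - 1 / 2) * ((1 - (t : ℝ)) + t / cubeRadius x)| ≤ 1 / 2 := by
    rw [abs_mul, abs_of_nonneg hk]
    have h3 : |(x i : ℝ) - 1 / 2| ≤ cubeRadius x / 2 := by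
      rw [abs_le] at h2 ⊢; constructor <;> linarith [h2.1, h2.2]
    calc _ ≤ cubeRadius x / 2 * ((1 - (t : ℝ)) + t / cubeRadius x) := by gcongr
      _ = (cubeRadius x * (1 - t) + t) / 2 := by field_simp
      _ ≤ (1 * (1 - t) + t) / 2 := by gcongr
      _ = 1 / 2 := by ring
  rw [abs_le] at hb
  unfold radialHomotopy
  rw [Set.projIcc_of_mem zero_le_one (show _ ∈ Set.Icc (0 : ℝ) 1 from ⟨by linarith [hb.1], by linarith [hb.2]⟩)]

theorem radialHomotopy_zero (x : Fin d → unitInterval) : radialHomotopy x 0 = x := by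
  funext i
  simp [radialHomotopy]

theorem radialHomotopy_of_mem {x : Fin d → unitInterval} (hx : x ∈ cubeBoundary d)
    (t : unitInterval) : radialHomotopy x t = x := by
  have h : x ≠ cubeCenter d := fun h => cubeCenter_notMem (h ▸ hx)
  funext i
  refine Subtype.ext ?_
  rw [radialHomotopy_val h, cubeRadius_eq_one hx]
  ring

/-- A coordinate that attains the sup norm is rescaled to offset `1 / 2` or `-1 / 2`, that is, to
`1` or `0`. -/
theorem radialHomotopy_one_mem {x : Fin d → unitInterval} (hx : x ≠ cubeCenter d) :
    radialHomotopy x 1 ∈ cubeBoundary d := by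
  have hs := cubeRadius_pos hx
  obtain ⟨i, hi⟩ : ∃ i, |2 * (x i : ℝ) - 1| = cubeRadius x := by
    by_contra! h
    have := (pi_norm_lt_iff (x := fun i => 2 * (x i : ℝ) - 1) hs).2 fun i =>
      (abs_le_cubeRadius x i).lt_of_ne (h i)
    exact lt_irrefl _ this
  have hv := radialHomotopy_val hx 1 i
  refine ⟨i, ?_⟩
  simp only [Set.Icc.coe_one, sub_self, zero_add] at hv
  rcases abs_choice (2 * (x i : ℝ) - 1) with h | h
  · right
    refine Subtype.ext ?_
    rw [hv, Set.Icc.coe_one, ← hi, h]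
    have : 2 * (x i : ℝ) - 1 ≠ 0 := by rw [← h, hi]; exact hs.ne'
    field_simp
    ring
  · left
    refine Subtype.ext ?_
    rw [hv, Set.Icc.coe_zero, ← hi, h]
    have : -(2 * (x i : ℝ) - 1) ≠ 0 := by rw [← h, hi]; exact hs.ne'
    have h' : 2 * (x i : ℝ) - 1 ≠ 0 := fun h0 => this (by rw [h0, neg_zero])
    rw [div_neg]
    field_simp
    ring

theorem radialHomotopy_ne {x : Fin d → unitInterval} (hx : x ≠ cubeCenter d) (t : unitInterval) :
    radialHomotopy x t ≠ cubeCenter d := by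
  intro h
  refine hx (funext fun i => Subtype.ext ?_)
  have hs := cubeRadius_pos hx
  have h1 := congrArg Subtype.val (congrFun h i)
  rw [radialHomotopy_val hx] at h1
  have hk : (1 - (t : ℝ)) + t / cubeRadius x ≠ 0 := by
    have ht0 := t.2.1
    have ht1 := t.2.2
    have h2 : (t : ℝ) ≤ t / cubeRadius x := by
      rw [le_div_iff₀ hs]
      exact mul_le_of_le_one_right ht0 (cubeRadius_le_one x)
    intro h3
    linarith
  have h4 : ((cubeCenter d i : unitInterval) : ℝ) = 1 / 2 := rfl
  rw [h4] at h1 ⊢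
  have h5 : ((x i : ℝ) - 1 / 2) * ((1 - (t : ℝ)) + t / cubeRadius x) = 0 := by linarith
  rcases mul_eq_zero.1 h5 with h6 | h6
  · linarith
  · exact absurd h6 hk

theorem continuousOn_radialHomotopy :
    ContinuousOn (fun p : (Fin d → unitInterval) × unitInterval => radialHomotopy p.1 p.2)
      ({cubeCenter d}ᶜ ×ˢ Set.univ) := by
  unfold radialHomotopy
  refine continuousOn_pi.2 fun i => continuous_projIcc.comp_continuousOn ?_
  have h1 : ContinuousOn (fun p : (Fin d → unitInterval) × unitInterval =>
      (p.2 : ℝ) / cubeRadius p.1) ({cubeCenter d}ᶜ ×ˢ Set.univ) := by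
    refine ContinuousOn.div (by fun_prop) (continuous_cubeRadius.comp continuous_fst).continuousOn ?_
    rintro ⟨x, t⟩ ⟨hx, _⟩
    exact (cubeRadius_pos hx).ne'
  fun_prop

end CubeGeometry

/-- A continuous map from a compact space to a Hausdorff space is closed, and so is its restriction
to a full preimage; so it is a quotient map onto `W`. Continuity on an attached cell can thus be
checked through the characteristic map. -/
theorem continuousOn_of_comp_of_compact {A B C : Type*} [TopologicalSpace A] [TopologicalSpace B]
    [TopologicalSpace C] [CompactSpace A] [T2Space B] {g : A → B} (hg : Continuous g) {h : B → C}
    {W : Set B} (hW : W ⊆ Set.range g) (hh : ContinuousOn (h ∘ g) (g ⁻¹' W)) :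
    ContinuousOn h W := by
  rw [continuousOn_iff_continuous_domRestrict] at hh ⊢
  have hq : Topology.IsQuotientMap (W.restrictPreimage g) := by
    refine IsClosedMap.isQuotientMap ?_ (hg.restrictPreimage) ?_
    · exact (hg.isClosedMap).restrictPreimage W
    · rintro ⟨y, hy⟩
      obtain ⟨x, rfl⟩ := hW hy
      exact ⟨⟨x, hy⟩, rfl⟩
  exact hq.continuous_iff.2 hh

/-- Changing one coordinate of the centre to `1 / 4` gives another interior point, so independence
of that coordinate contradicts injectivity. -/
theorem not_degenerateCube_of_injOn {E : Type*} {d : ℕ} {c : (Fin d → unitInterval) → E}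
    (hinj : Set.InjOn c (cubeBoundary d)ᶜ) : ¬ DegenerateCube c := by
  rintro ⟨i, hi⟩
  have hy : Function.update (cubeCenter d) i ⟨1 / 4, by norm_num, by norm_num⟩ ∉ cubeBoundary d := by
    rintro ⟨j, hj⟩
    rcases eq_or_ne j i with rfl | hji
    · rw [Function.update_self] at hj
      rcases hj with hj | hj <;> · have := congrArg Subtype.val hj; norm_num at this
    · rw [Function.update_of_ne hji] at hj
      exact cubeCenter_notMem ⟨j, hj⟩
  have := hinj cubeCenter_notMem hy (hi _ _ fun j hj => by rw [Function.update_of_ne hj])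
  have h1 := congrArg Subtype.val (congrFun this i)
  rw [Function.update_self] at h1
  norm_num [cubeCenter] at h1

/-! ### Attaching a cell -/

/-- `X` is obtained from `A` by attaching a cell with the characteristic map `c`. -/
structure IsCellAttachment {E : Type*} [TopologicalSpace E] (A X : Set E) {d : ℕ}
    (c : (Fin d → unitInterval) → E) : Prop where
  continuous : Continuous c
  isClosed : IsClosed A
  subset : A ⊆ X
  mem : ∀ x, c x ∈ X
  boundary_mem : ∀ x ∈ cubeBoundary d, c x ∈ A
  interior_notMem : ∀ x ∉ cubeBoundary d, c x ∉ A
  injOn : Set.InjOn c (cubeBoundary d)ᶜ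
  cover : ∀ y ∈ X, y ∉ A → ∃ x, c x = y

section Attach

variable {R : Type*} [CommRing R] {E : Type*} [TopologicalSpace E]

theorem smul_cube_mem_chainsIn {A : Set E} {d : ℕ} {c : (Fin d → unitInterval) → E}
    (hA : ∃ x, c x ∉ A) (hc : ¬ DegenerateCube c) {r : R} (h : r • cube R c ∈ chainsIn R A) :
    r = 0 := by
  rw [chainsIn, Finsupp.mem_supported'] at h
  have := h ⟨d, c⟩ (by
    rintro (h | h)
    · obtain ⟨x, hx⟩ := hA
      exact hx (h.2 x)
    · exact hc h)
  simpa [cube] using this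

theorem boundary_cube_mem_chainsIn {A : Set E} {d : ℕ} {c : (Fin d → unitInterval) → E}
    (hc : Continuous c) (hA : ∀ x ∈ cubeBoundary d, c x ∈ A) :
    formalBoundary R (cube R c) ∈ chainsIn R A := by
  cases d with
  | zero => rw [formalBoundary_cube_zero]; exact zero_mem _
  | succ n =>
    rw [formalBoundary_cube_eq_sum]
    refine sum_mem fun i _ => Submodule.smul_mem _ _ (sub_mem ?_ ?_)
    · exact cube_mem_chainsIn (by fun_prop) fun x => hA _ ⟨i, Or.inr (by simp)⟩
    · exact cube_mem_chainsIn (by fun_prop) fun x => hA _ ⟨i, Or.inl (by simp)⟩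

/-- Adding the same free generator to `A` and to `B` does not change the quotient complex. The last
hypothesis says that the sum with `B` is direct, which is what compares the coefficients of `c`. -/
theorem RelEq.sup_span {A B : Submodule R (FormalChain R E)} (h : RelEq A B)
    (hB : ∀ b ∈ B, formalBoundary R b ∈ B) {c : FormalChain R E} (hc : formalBoundary R c ∈ A)
    (hcB : ∀ r : R, r • c ∈ B → r = 0) :
    RelEq (A ⊔ Submodule.span R {c}) (B ⊔ Submodule.span R {c}) := by
  refine ⟨sup_le_sup_right h.1 _, fun b hb hbA => ?_⟩
  obtain ⟨u, hu, _, hr, rfl⟩ := Submodule.mem_sup.1 hb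
  obtain ⟨r, rfl⟩ := Submodule.mem_span_singleton.1 hr
  obtain ⟨a, ha, _, hr', h'⟩ := Submodule.mem_sup.1 hbA
  obtain ⟨r', rfl⟩ := Submodule.mem_span_singleton.1 hr'
  have h0 : r' = 0 := by
    refine hcB r' ?_
    have : r' • c = formalBoundary R u + r • formalBoundary R c - a := by
      rw [← map_smul, ← map_add, ← h']; abel
    rw [this]
    exact sub_mem (add_mem (hB _ hu) (B.smul_mem _ (h.1 hc))) (h.1 ha)
  subst h0
  rw [zero_smul, add_zero] at h'
  obtain ⟨a', ha', s, hs, h2⟩ := h.2 u hu (by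
    have : formalBoundary R u = a - r • formalBoundary R c := by rw [h', map_add, map_smul]; abel
    rw [this]
    exact sub_mem ha (A.smul_mem _ hc))
  exact ⟨a' + r • c, Submodule.add_mem_sup ha' hr, s, Submodule.mem_sup_left hs, by rw [h2]; abel⟩

variable [T2Space E]

namespace IsCellAttachment

variable {A X : Set E} {d : ℕ} {c : (Fin d → unitInterval) → E}

theorem not_degenerate (h : IsCellAttachment A X c) : ¬ DegenerateCube c :=
  not_degenerateCube_of_injOn h.injOn

theorem center_notMem (h : IsCellAttachment A X c) : c (cubeCenter d) ∉ A :=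
  h.interior_notMem _ cubeCenter_notMem

theorem eq_center (h : IsCellAttachment A X c) {x : Fin d → unitInterval}
    (hx : c x = c (cubeCenter d)) : x = cubeCenter d := by
  refine h.injOn (fun hb => ?_) cubeCenter_notMem hx
  exact h.center_notMem (hx ▸ h.boundary_mem x hb)

/-- The inverse of the characteristic map on the open cell. -/
noncomputable def inv (_ : IsCellAttachment A X c) : E → (Fin d → unitInterval) :=
  Function.invFunOn c (cubeBoundary d)ᶜ

theorem inv_apply (h : IsCellAttachment A X c) {x : Fin d → unitInterval}
    (hx : x ∉ cubeBoundary d) : h.inv (c x) = x :=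
  h.injOn.leftInvOn_invFunOn hx

theorem exists_interior (h : IsCellAttachment A X c) {y : E} (hy : y ∈ X) (hyA : y ∉ A) :
    ∃ x ∉ cubeBoundary d, c x = y := by
  obtain ⟨x, rfl⟩ := h.cover y hy hyA
  exact ⟨x, fun hx => hyA (h.boundary_mem x hx), rfl⟩

theorem continuousOn_inv (h : IsCellAttachment A X c) : ContinuousOn h.inv (X ∩ Aᶜ) := by
  refine continuousOn_of_comp_of_compact h.continuous (fun y hy => h.cover y hy.1 hy.2) ?_
  refine continuousOn_id.congr fun x hx => ?_
  exact h.inv_apply fun hb => hx.2 (h.boundary_mem x hb)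

open Classical in
/-- The radial homotopy in the attached cell. -/
noncomputable def homotopy (h : IsCellAttachment A X c) (y : E) (t : unitInterval) : E :=
  if y ∈ A then y else c (radialHomotopy (h.inv y) t)

theorem homotopy_apply (h : IsCellAttachment A X c) (x : Fin d → unitInterval) (t : unitInterval) :
    h.homotopy (c x) t = c (radialHomotopy x t) := by
  unfold homotopy
  by_cases hx : x ∈ cubeBoundary d
  · rw [if_pos (h.boundary_mem x hx), radialHomotopy_of_mem hx]
  · rw [if_neg (h.interior_notMem x hx), h.inv_apply hx]

theorem homotopy_of_mem (h : IsCellAttachment A X c) {y : E} (hy : y ∈ A) (t : unitInterval) :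
    h.homotopy y t = y := if_pos hy

/-- The closed sets `A` and `Set.range c` cover `X`. On the first the homotopy is constant in time,
on the second it is continuous because it is so after composition with the characteristic map. -/
theorem continuousOn_homotopy (h : IsCellAttachment A X c) :
    ContinuousOn (fun p : E × unitInterval => h.homotopy p.1 p.2)
      ((X ∩ {c (cubeCenter d)}ᶜ) ×ˢ Set.univ) := by
  have hclosed : IsClosed (Set.range c) := (isCompact_range h.continuous).isClosed
  have hsub : (X ∩ {c (cubeCenter d)}ᶜ) ×ˢ (Set.univ : Set unitInterval) ⊆
      (A ×ˢ Set.univ) ∪ ((Set.range c ∩ {c (cubeCenter d)}ᶜ) ×ˢ Set.univ) := by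
    rintro ⟨y, t⟩ ⟨⟨hy, hyp⟩, _⟩
    by_cases hyA : y ∈ A
    · exact Or.inl ⟨hyA, trivial⟩
    · exact Or.inr ⟨⟨h.cover y hy hyA, hyp⟩, trivial⟩
  have h1 : ContinuousOn (fun p : E × unitInterval => h.homotopy p.1 p.2) (A ×ˢ Set.univ) :=
    continuousOn_fst.congr fun p hp => h.homotopy_of_mem hp.1 _
  have h2 : ContinuousOn (fun p : E × unitInterval => h.homotopy p.1 p.2)
      ((Set.range c ∩ {c (cubeCenter d)}ᶜ) ×ˢ Set.univ) := by
    refine continuousOn_of_comp_of_compact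
      (g := fun p : (Fin d → unitInterval) × unitInterval => (c p.1, p.2))
      (by have := h.continuous; fun_prop) ?_ ?_
    · rintro ⟨y, t⟩ ⟨⟨⟨x, hx⟩, _⟩, _⟩
      exact ⟨(x, t), by simp [hx]⟩
    · refine (h.continuous.comp_continuousOn continuousOn_radialHomotopy).congr_mono
        (fun p _ => h.homotopy_apply _ _) ?_
      rintro ⟨x, t⟩ ⟨⟨_, hx⟩, _⟩
      exact ⟨fun hxc => hx (congrArg c (Set.mem_singleton_iff.1 hxc)), trivial⟩
  intro p hp
  -- Gluing over a closed cover: at a point outside a closed piece, continuity within that piece is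
  -- vacuous.
  have key : ∀ W : Set E, IsClosed W →
      ContinuousOn (fun p : E × unitInterval => h.homotopy p.1 p.2)
        ((W ∩ {c (cubeCenter d)}ᶜ) ×ˢ Set.univ) →
      ContinuousWithinAt (fun p : E × unitInterval => h.homotopy p.1 p.2)
        ((W ∩ {c (cubeCenter d)}ᶜ) ×ˢ Set.univ) p := by
    intro W hW hcont
    by_cases hpW : p.1 ∈ W
    · exact hcont p ⟨⟨hpW, hp.1.2⟩, trivial⟩
    · refine continuousWithinAt_of_notMem_closure fun hcl => hpW ?_
      have : closure ((W ∩ {c (cubeCenter d)}ᶜ) ×ˢ (Set.univ : Set unitInterval)) ⊆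
          W ×ˢ Set.univ :=
        closure_minimal (Set.prod_mono Set.inter_subset_left subset_rfl) (hW.prod isClosed_univ)
      exact (this hcl).1
  have hA := key A h.isClosed (h1.mono (Set.prod_mono Set.inter_subset_left subset_rfl))
  have hr := key _ hclosed h2
  refine (hA.union hr).mono ?_
  rintro ⟨y, t⟩ hq
  rcases hsub hq with hq' | hq'
  · exact Or.inl ⟨⟨hq'.1, hq.1.2⟩, trivial⟩
  · exact Or.inr hq'

theorem relEq_compl_center (h : IsCellAttachment A X c) :
    RelEq (chainsIn R A) (chainsIn R (X ∩ {c (cubeCenter d)}ᶜ)) := by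
  have hne : ∀ y ∈ X ∩ {c (cubeCenter d)}ᶜ, y ∉ A → ∃ x, x ≠ cubeCenter d ∧ c x = y := by
    rintro y ⟨hy, hyp⟩ hyA
    obtain ⟨x, rfl⟩ := h.cover y hy hyA
    exact ⟨x, fun hx => hyp (by rw [hx]; rfl), rfl⟩
  refine relEq_of_homotopy h.homotopy
    (fun a ha => ⟨h.subset ha, fun hap => h.center_notMem (by rwa [← Set.mem_singleton_iff.1 hap])⟩)
    h.continuousOn_homotopy ?_ ?_ ?_ ?_
  · intro y hy
    by_cases hyA : y ∈ A
    · exact h.homotopy_of_mem hyA _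
    · obtain ⟨x, hx, rfl⟩ := hne y hy hyA
      rw [h.homotopy_apply, radialHomotopy_zero]
  · intro y hy
    by_cases hyA : y ∈ A
    · rwa [h.homotopy_of_mem hyA]
    · obtain ⟨x, hx, rfl⟩ := hne y hy hyA
      rw [h.homotopy_apply]
      exact h.boundary_mem _ (radialHomotopy_one_mem hx)
  · intro y hy t
    by_cases hyA : y ∈ A
    · rwa [h.homotopy_of_mem hyA]
    · obtain ⟨x, hx, rfl⟩ := hne y hy hyA
      rw [h.homotopy_apply]
      exact ⟨h.mem _, fun hc => radialHomotopy_ne hx t (h.eq_center hc)⟩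
  · intro y hy t
    rwa [h.homotopy_of_mem hy]

end IsCellAttachment

/-! ### The homology of the cube relative to its boundary -/

theorem isCellAttachment_id (d : ℕ) :
    IsCellAttachment (cubeBoundary d) Set.univ (id : (Fin d → unitInterval) → _) where
  continuous := continuous_id
  isClosed := by
    have : cubeBoundary d = ⋃ i : Fin d, {x | x i = 0} ∪ {x | x i = 1} := by
      ext x; simp [cubeBoundary]
    rw [this]
    exact isClosed_iUnion_of_finite fun i =>
      (isClosed_eq (continuous_apply i) continuous_const).union
        (isClosed_eq (continuous_apply i) continuous_const)
  subset := Set.subset_univ _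
  mem _ := trivial
  boundary_mem _ hx := hx
  interior_notMem _ hx := hx
  injOn := Function.injective_id.injOn
  cover y _ _ := ⟨y, rfl⟩

variable (R) in
/-- The homology of the cube `[0,1]ᵈ` relative to its boundary is generated by the cube. -/
def CubeRelEq (d : ℕ) : Prop :=
  RelEq (chainsIn R (cubeBoundary d) ⊔
    Submodule.span R {cube R (id : (Fin d → unitInterval) → _)}) (chainsIn R Set.univ)

namespace IsCellAttachment

variable {A X : Set E} {d : ℕ} {c : (Fin d → unitInterval) → E}

theorem smul_cube_mem (h : IsCellAttachment A X c) {r : R}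
    (hr : r • cube R c ∈ chainsIn R (X ∩ {c (cubeCenter d)}ᶜ)) : r = 0 :=
  smul_cube_mem_chainsIn ⟨cubeCenter d, fun hx => hx.2 rfl⟩ h.not_degenerate hr

theorem relEq_sup_compl_center {A₀ : Submodule R (FormalChain R E)} (h : IsCellAttachment A X c)
    (hA₀ : RelEq A₀ (chainsIn R A)) (hc : formalBoundary R (cube R c) ∈ A₀) :
    RelEq (A₀ ⊔ Submodule.span R {cube R c})
      (chainsIn R (X ∩ {c (cubeCenter d)}ᶜ) ⊔ Submodule.span R {cube R c}) :=
  (hA₀.trans h.relEq_compl_center).sup_span (fun _ => formalBoundary_mem_chainsIn) hc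
    fun _ => h.smul_cube_mem

/-- Excision for the pair of `X` and `X` without the centre of the cell. Cover `X` by the punctured
space `U` and the open cell `V`, and the cube by the corresponding `U'` and `V'`. The characteristic
map identifies `V'` with `V` and sends `U'` to `U`, so the relative homology is computed in the
cube, where `hd` gives it. -/
theorem relEq_compl_center_sup (h : IsCellAttachment A X c) (hd : CubeRelEq R d) :
    RelEq (chainsIn R (X ∩ {c (cubeCenter d)}ᶜ) ⊔ Submodule.span R {cube R c})
      (chainsIn R X) := by
  set ι : FormalChain R (Fin d → unitInterval) := cube R id with hι
  have hcι : push R c ι = cube R c := by simp [hι]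
  set U := X ∩ {c (cubeCenter d)}ᶜ with hU
  set V := X ∩ Aᶜ with hV
  set U' : Set (Fin d → unitInterval) := Set.univ ∩ {id (cubeCenter d)}ᶜ with hU'
  set V' : Set (Fin d → unitInterval) := Set.univ ∩ (cubeBoundary d)ᶜ with hV'
  have hI := isCellAttachment_id d
  -- The hypothesis `hd` with the boundary of the cube enlarged to the punctured cube.
  have hd' : RelEq (chainsIn R U' ⊔ Submodule.span R {ι}) (chainsIn R Set.univ) :=
    (hI.relEq_sup_compl_center ⟨le_rfl, fun b hb _ => ⟨b, hb, 0, zero_mem _, by simp⟩⟩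
      (boundary_cube_mem_chainsIn continuous_id fun x hx => hx)).cancel_left hd
      (sup_le (chainsIn_mono (Set.subset_univ _)) (Submodule.span_le.2
        (Set.singleton_subset_iff.2 (cube_mem_chainsIn continuous_id fun _ => trivial))))
  have hexI : RelEq (chainsIn R U' ⊔ chainsIn R V') (chainsIn R Set.univ) :=
    relEq_sup_of_isOpen isClosed_singleton.isOpen_compl hI.isClosed.isOpen_compl fun x _ => by
      by_cases hx : x ∈ cubeBoundary d
      · exact Or.inl fun hx' => cubeCenter_notMem (Set.mem_singleton_iff.1 hx' ▸ hx)
      · exact Or.inr hx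
  have hexX : RelEq (chainsIn R U ⊔ chainsIn R V) (chainsIn R X) :=
    relEq_sup_of_isOpen isClosed_singleton.isOpen_compl h.isClosed.isOpen_compl fun x _ => by
      by_cases hx : x ∈ A
      · exact Or.inl fun hx' => h.center_notMem (by rwa [← Set.mem_singleton_iff.1 hx'])
      · exact Or.inr hx
  have hpU : ∀ z ∈ chainsIn R U', push R c z ∈ chainsIn R U := fun z hz =>
    push_mem_chainsIn (U := U') (V := U) h.continuous.continuousOn
      (fun x hx => ⟨h.mem x, fun hx' => hx.2 (h.eq_center hx')⟩) hz
  have hpV : ∀ z ∈ chainsIn R V', push R c z ∈ chainsIn R V := fun z hz =>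
    push_mem_chainsIn (U := V') (V := V) h.continuous.continuousOn
      (fun x hx => ⟨h.mem x, h.interior_notMem x hx.2⟩) hz
  have hpX : ∀ z ∈ chainsIn R Set.univ, push R c z ∈ chainsIn R X := fun z hz =>
    push_mem_chainsIn h.continuous.continuousOn (fun x _ => h.mem x) hz
  have hqV : ∀ z ∈ chainsIn R V, push R h.inv z ∈ chainsIn R Set.univ := fun z hz =>
    push_mem_chainsIn h.continuousOn_inv (Set.mapsTo_univ _ _) hz
  have hqUV : ∀ z ∈ chainsIn R U, z ∈ chainsIn R V → push R h.inv z ∈ chainsIn R U' :=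
    fun z hz hz' => push_mem_chainsIn (h.continuousOn_inv.mono Set.inter_subset_right)
      (by
        rintro y ⟨hy, hy'⟩
        obtain ⟨x, hx, rfl⟩ := h.exists_interior hy'.1 hy'.2
        rw [h.inv_apply hx]
        exact ⟨trivial, fun hx' => hy.2 (congrArg c (Set.mem_singleton_iff.1 hx'))⟩)
      (mem_chainsIn_inter hz hz')
  have hqc : ∀ z ∈ chainsIn R V', push R h.inv (push R c z) - z ∈ degenerate R _ := by
    intro z hz
    rw [push_push]
    have := push_congr (f := h.inv ∘ c) (g := id) (fun x hx => h.inv_apply hx.2) hz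
    rwa [push_id] at this
  have hcq : ∀ z ∈ chainsIn R V, push R c (push R h.inv z) - z ∈ degenerate R _ := by
    intro z hz
    rw [push_push]
    have := push_congr (f := c ∘ h.inv) (g := id) (fun y hy => by
      obtain ⟨x, hx, rfl⟩ := h.exists_interior hy.1 hy.2
      simp [h.inv_apply hx]) hz
    rwa [push_id] at this
  refine ⟨sup_le (chainsIn_mono Set.inter_subset_left) (Submodule.span_le.2
    (Set.singleton_subset_iff.2 (cube_mem_chainsIn h.continuous h.mem))), fun b hb hbA => ?_⟩
  obtain ⟨a, ha, _, hr, hab⟩ := Submodule.mem_sup.1 hbA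
  obtain ⟨r, rfl⟩ := Submodule.mem_span_singleton.1 hr
  -- The boundary of `b` may involve the big cube `c`, which is not small with respect to the cover.
  -- Replacing the identity cube by small chains `x + y`, up to the boundary of `t`, removes this
  -- obstacle.
  obtain ⟨_, hxy, t, ht, hιt⟩ := hexI.2 ι (cube_mem_chainsIn continuous_id fun _ => trivial)
    (Submodule.mem_sup_left (chainsIn_mono (U := cubeBoundary d) (V := U')
      (fun x hx => ⟨trivial, fun hx' => cubeCenter_notMem (Set.mem_singleton_iff.1 hx' ▸ hx)⟩)
      (boundary_cube_mem_chainsIn continuous_id fun x hx => hx)))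
  obtain ⟨x, hx, y, hy, rfl⟩ := Submodule.mem_sup.1 hxy
  have hct : cube R c = push R c x + push R c y + formalBoundary R (push R c t) := by
    rw [← hcι, hιt, map_add, map_add, push_formalBoundary]
  obtain ⟨_, huv, s, hs, hb1⟩ := hexX.2 (b - r • push R c t)
    (sub_mem hb (Submodule.smul_mem _ _ (hpX t ht))) (by
      have : formalBoundary R (b - r • push R c t) =
          (a + r • push R c x) + r • push R c y := by
        rw [map_sub, map_smul, ← hab, hct, smul_add, smul_add]; abel
      rw [this]
      exact Submodule.add_mem_sup (add_mem ha (Submodule.smul_mem _ _ (hpU x hx)))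
        (Submodule.smul_mem _ _ (hpV y hy)))
  obtain ⟨u, hu, v, hv, rfl⟩ := Submodule.mem_sup.1 huv
  -- The left side is a chain of the open cell, the right side one of the punctured space. Hence it
  -- lies in their intersection, where the inverse of the characteristic map is continuous and
  -- avoids the centre.
  have hdv : formalBoundary R v - r • push R c y = a + r • push R c x - formalBoundary R u := by
    have h1 := congrArg (formalBoundary R) hb1
    simp only [map_sub, map_add, map_smul, formalBoundary_formalBoundary, add_zero] at h1
    rw [← hab, hct] at h1
    simp only [smul_add] at h1
    have h2 : formalBoundary R v = a + (r • push R c x + r • push R c y +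
      r • formalBoundary R (push R c t)) - r • formalBoundary R (push R c t) -
        formalBoundary R u := by rw [h1]; abel
    rw [h2]; abel
  have hdvU : formalBoundary R v - r • push R c y ∈ chainsIn R U := by
    rw [hdv]
    exact sub_mem (add_mem ha (Submodule.smul_mem _ _ (hpU x hx))) (formalBoundary_mem_chainsIn hu)
  have hdvV : formalBoundary R v - r • push R c y ∈ chainsIn R V :=
    sub_mem (formalBoundary_mem_chainsIn hv) (Submodule.smul_mem _ _ (hpV y hy))
  have hpull := hqUV _ hdvU hdvV
  have hyd := hqc y hy
  -- The part `v` is pulled back to the cube, with `r • t` added so that its boundary becomes a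
  -- chain of the punctured cube plus a multiple of `ι`.
  obtain ⟨_, hxr, y', hy', hv'⟩ := hd'.2 (push R h.inv v + r • t)
    (add_mem (hqV v hv) (Submodule.smul_mem _ _ ht)) (by
      have : formalBoundary R (push R h.inv v + r • t) =
          (push R h.inv (formalBoundary R v - r • push R c y) +
            r • (push R h.inv (push R c y) - y) - r • x) + r • ι := by
        rw [map_add, map_smul, hιt, map_sub, map_smul, push_formalBoundary]
        simp only [smul_add, smul_sub]
        abel
      rw [this]
      refine Submodule.add_mem_sup (sub_mem (add_mem hpull (Submodule.smul_mem _ _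
        (degenerate_le_chainsIn _ hyd))) (Submodule.smul_mem _ _ hx)) 
        (Submodule.smul_mem _ _ (Submodule.mem_span_singleton_self _)))
  obtain ⟨x', hx', _, hr', rfl⟩ := Submodule.mem_sup.1 hxr
  obtain ⟨r', rfl⟩ := Submodule.mem_span_singleton.1 hr'
  have hpush := congrArg (push R c) hv'
  simp only [map_add, map_smul, hcι, push_formalBoundary] at hpush
  refine ⟨(u + push R c x' - (push R c (push R h.inv v) - v)) + r' • cube R c,
    Submodule.add_mem_sup (sub_mem (add_mem hu (hpU x' hx')) (degenerate_le_chainsIn _ (hcq v hv)))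
      (Submodule.smul_mem _ _ (Submodule.mem_span_singleton_self _)),
    s + push R c y', add_mem hs (hpX y' hy'), ?_⟩
  rw [sub_eq_iff_eq_add.1 hb1, map_add]
  have : push R c (push R h.inv v) =
    push R c x' + r' • cube R c + formalBoundary R (push R c y') - r • push R c t := by
    rw [← hpush]; abel
  rw [this]
  abel

theorem relEq_of_cubeRelEq {A₀ : Submodule R (FormalChain R E)} (h : IsCellAttachment A X c)
    (hd : CubeRelEq R d) (hA₀ : RelEq A₀ (chainsIn R A))
    (hc : formalBoundary R (cube R c) ∈ A₀) :
    RelEq (A₀ ⊔ Submodule.span R {cube R c}) (chainsIn R X) :=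
  (h.relEq_sup_compl_center hA₀ hc).trans (h.relEq_compl_center_sup hd)

end IsCellAttachment

end Attach

/-! ### Relative homology of the cube, by induction on the dimension -/

/-- The boundary of the cube without the interior of the face `x₀ = 1`. -/
def cubeBox (d : ℕ) : Set (Fin (d + 1) → unitInterval) :=
  {x | x 0 = 0 ∨ Fin.tail x ∈ cubeBoundary d}

/-- The face `x₀ = 1` of the cube. -/
def cubeLid (d : ℕ) (x : Fin d → unitInterval) : Fin (d + 1) → unitInterval := Fin.cons 1 x

theorem isCellAttachment_cubeLid (d : ℕ) :
    IsCellAttachment (cubeBox d) (cubeBoundary (d + 1)) (cubeLid d) where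
  continuous := Continuous.finCons continuous_const continuous_id
  isClosed := (isClosed_eq (continuous_apply 0) continuous_const).union
    ((isCellAttachment_id d).isClosed.preimage (by unfold Fin.tail; fun_prop))
  subset := by
    rintro x (hx | ⟨i, hi⟩)
    · exact ⟨0, Or.inl hx⟩
    · exact ⟨i.succ, hi⟩
  mem x := ⟨0, Or.inr rfl⟩
  boundary_mem x hx := Or.inr (by rwa [cubeLid, Fin.tail_cons])
  interior_notMem x hx := by
    rintro (h | h)
    · exact one_ne_zero h
    · exact hx (by rwa [cubeLid, Fin.tail_cons] at h)
  injOn x _ y _ h := (Fin.cons_injective2 h).2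
  cover := by
    rintro y ⟨i, hi⟩ hy
    have hy' : y 0 = 1 := by
      induction i using Fin.cases with
      | zero => exact hi.resolve_left fun h => hy (Or.inl h)
      | succ i => exact absurd (Or.inr ⟨i, hi⟩) hy
    exact ⟨Fin.tail y, by rw [cubeLid, ← hy', Fin.cons_self_tail]⟩

section CubeRel

variable {R : Type*} [CommRing R]

theorem relEq_singleton_zero {d : ℕ} {U : Set (Fin d → unitInterval)} (h0 : (0 : Fin d → unitInterval) ∈ U)
    (hU : ∀ x ∈ U, ∀ t : unitInterval, (fun i => t * x i) ∈ U) :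
    RelEq (chainsIn R {0}) (chainsIn R U) := by
  refine relEq_of_homotopy (fun x t i => unitInterval.symm t * x i) (by simpa using h0) ?_ ?_ ?_ ?_ ?_
  · exact Continuous.continuousOn (by fun_prop)
  · intro x _; simp
  · intro x _
    simp only [unitInterval.symm_one, zero_mul, Set.mem_singleton_iff]
    rfl
  · intro x hx t; exact hU x hx _
  · rintro _ rfl t
    simp only [Pi.zero_apply, mul_zero, Set.mem_singleton_iff]
    rfl

/-- The box is contractible: scaling the first coordinate flattens it to its floor, and the floor is
star-shaped about the origin. -/
theorem relEq_zero_cubeBox (d : ℕ) : RelEq (chainsIn R {0}) (chainsIn R (cubeBox d)) := by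
  have h1 : RelEq (chainsIn R {0})
      (chainsIn R {x : Fin (d + 1) → unitInterval | x 0 = 0}) :=
    relEq_singleton_zero rfl fun x (hx : x 0 = 0) t => by simp [hx]
  refine h1.trans ?_
  refine relEq_of_homotopy (fun x t => Fin.cons (unitInterval.symm t * x 0) (Fin.tail x))
    (fun x hx => Or.inl hx) ?_ ?_ ?_ ?_ ?_
  · refine Continuous.continuousOn (Continuous.finCons (by fun_prop) ?_)
    unfold Fin.tail; fun_prop
  · intro x _; simp
  · intro x _; simp
  · rintro x (hx | hx) t
    · exact Or.inl (by simp [hx])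
    · exact Or.inr (by rwa [Fin.tail_cons])
  · intro x (hx : x 0 = 0) t; simp [hx]

theorem cubeRelEq_zero : CubeRelEq R 0 := by
  have h : chainsIn R (Set.univ : Set (Fin 0 → unitInterval)) ≤ chainsIn R (cubeBoundary 0) ⊔
      Submodule.span R {cube R (id : (Fin 0 → unitInterval) → _)} := by
    have : (Set.univ : Set (Fin 0 → unitInterval)) = {0} := Set.eq_singleton_iff_unique_mem.2
      ⟨trivial, fun _ _ => Subsingleton.elim _ _⟩
    rw [this]
    refine (chainsIn_singleton _).trans (sup_le_sup (degenerate_le_chainsIn _) ?_)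
    rw [pointChain, show (fun _ : Fin 0 → unitInterval => (0 : Fin 0 → unitInterval)) = id from
      funext fun _ => Subsingleton.elim _ _]
  exact ⟨sup_le (chainsIn_mono (Set.subset_univ _)) (Submodule.span_le.2
    (Set.singleton_subset_iff.2 (cube_mem_chainsIn continuous_id fun _ => trivial))),
    fun b hb _ => ⟨b, h hb, 0, zero_mem _, by simp⟩⟩

/-- The lid is the only face of the cube outside the box, and it occurs with the sign `+1`. -/
theorem formalBoundary_cube_id (d : ℕ) :
    formalBoundary R (cube R (id : (Fin (d + 1) → unitInterval) → _)) - cube R (cubeLid d) ∈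
      chainsIn R (cubeBox d) := by
  rw [formalBoundary_cube_eq_sum, Fin.sum_univ_succ]
  simp only [Fin.val_zero, pow_zero, one_smul, Fin.insertNth_zero', id]
  have h1 : cube R (fun x => (Fin.cons 0 x : Fin (d + 1) → unitInterval)) ∈
      chainsIn R (cubeBox d) :=
    cube_mem_chainsIn (Continuous.finCons continuous_const continuous_id) fun x => Or.inl rfl
  have h2 : ∀ (i : Fin d) (e : unitInterval), (e = 0 ∨ e = 1) →
      cube R (fun x => i.succ.insertNth (α := fun _ => unitInterval) e x) ∈
      chainsIn R (cubeBox d) := by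
    intro i e he
    refine cube_mem_chainsIn (by fun_prop) fun x => Or.inr ⟨i, ?_⟩
    simpa [Fin.tail] using he
  have h3 : cube R (cubeLid d) = cube R (fun x => (Fin.cons 1 x : Fin (d + 1) → unitInterval)) :=
    rfl
  rw [h3, add_sub_right_comm, sub_right_comm, sub_self, zero_sub]
  exact add_mem (neg_mem h1) (sum_mem fun i _ => Submodule.smul_mem _ _
    (sub_mem (h2 i 1 (Or.inr rfl)) (h2 i 0 (Or.inl rfl))))

theorem CubeRelEq.relEq_cubeBoundary {d : ℕ} (hd : CubeRelEq R d) :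
    RelEq (chainsIn R (cubeBox d) ⊔ Submodule.span R {cube R (cubeLid d)})
      (chainsIn R (cubeBoundary (d + 1))) :=
  (isCellAttachment_cubeLid d).relEq_of_cubeRelEq hd
    ⟨le_rfl, fun b hb _ => ⟨b, hb, 0, zero_mem _, by simp⟩⟩
    (boundary_cube_mem_chainsIn (isCellAttachment_cubeLid d).continuous
      (isCellAttachment_cubeLid d).boundary_mem)

/-- The triple of box, boundary and cube: the cube modulo the box is acyclic, since both are
contractible, and the boundary modulo the box is generated by the lid, by induction. So the
connecting map is an isomorphism, and it takes the cube to the lid. -/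
theorem CubeRelEq.succ {d : ℕ} (hd : CubeRelEq R d) : CubeRelEq R (d + 1) := by
  have hlid := isCellAttachment_cubeLid d
  have hlidJ : formalBoundary R (cube R (cubeLid d)) ∈ chainsIn R (cubeBox d) :=
    boundary_cube_mem_chainsIn hlid.continuous hlid.boundary_mem
  have h1 : RelEq (chainsIn R (cubeBox d)) (chainsIn R Set.univ) :=
    (relEq_zero_cubeBox d).cancel_left (relEq_singleton_zero trivial fun _ _ _ => trivial)
      (chainsIn_mono (Set.subset_univ _))
  have h2 := hd.relEq_cubeBoundary
  have hι := formalBoundary_cube_id (R := R) d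
  set ι : FormalChain R (Fin (d + 1) → unitInterval) := cube R id with hιdef
  set f := cube R (cubeLid d) with hf
  refine ⟨sup_le (chainsIn_mono (Set.subset_univ _)) (Submodule.span_le.2
    (Set.singleton_subset_iff.2 (cube_mem_chainsIn continuous_id fun _ => trivial))),
    fun b hb hbA => ?_⟩
  obtain ⟨a, ha, _, hr, hab⟩ := Submodule.mem_sup.1 hbA
  obtain ⟨r, rfl⟩ := Submodule.mem_span_singleton.1 hr
  have hda : formalBoundary R a = -(r • (formalBoundary R ι - f)) - r • f := by
    have := congrArg (formalBoundary R) hab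
    rw [map_add, map_smul, formalBoundary_formalBoundary] at this
    rw [eq_neg_of_add_eq_zero_left this, smul_sub]
    abel
  obtain ⟨_, hjr, s, hs, has⟩ := h2.2 a ha (by
    rw [hda]
    exact sub_mem (neg_mem (Submodule.mem_sup_left (Submodule.smul_mem _ _ hι)))
      (Submodule.smul_mem _ _ (Submodule.mem_sup_right (Submodule.mem_span_singleton_self _))))
  obtain ⟨j, hj, _, hr₁, rfl⟩ := Submodule.mem_sup.1 hjr
  obtain ⟨r₁, rfl⟩ := Submodule.mem_span_singleton.1 hr₁
  -- No grading is available to exclude a multiple of the cube from the boundary of `b`. But it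
  -- would force the same multiple of the lid to be a chain of the box.
  have hr0 : r = 0 := by
    refine smul_cube_mem_chainsIn (A := cubeBox d) ⟨_, hlid.center_notMem⟩ hlid.not_degenerate ?_
    have h3 := congrArg (formalBoundary R) has
    simp only [map_add, map_smul, formalBoundary_formalBoundary, add_zero] at h3
    have : r • cube R (cubeLid d) = -(r • (formalBoundary R ι - f)) -
        (formalBoundary R j + r₁ • formalBoundary R f) := by
      rw [← h3, hda]; abel
    rw [this]
    exact sub_mem (neg_mem (Submodule.smul_mem _ _ hι))
      (add_mem (formalBoundary_mem_chainsIn hj) (Submodule.smul_mem _ _ hlidJ))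
  subst hr0
  rw [zero_smul, add_zero] at hab
  have hs' := chainsIn_mono (Set.subset_univ _) hs
  -- Trading the lid for the boundary of `ι` moves the boundary of the chain into the box, where
  -- acyclicity modulo the box applies.
  obtain ⟨j', hj', t, ht, h4⟩ := h1.2 (b - r₁ • ι - s) (sub_mem (sub_mem hb (Submodule.smul_mem _ _
    (cube_mem_chainsIn continuous_id fun _ => trivial))) hs') (by
      have : formalBoundary R (b - r₁ • ι - s) = j - r₁ • (formalBoundary R ι - f) := by
        rw [map_sub, map_sub, map_smul, ← hab, has, smul_sub]
        abel
      rw [this]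
      exact sub_mem hj (Submodule.smul_mem _ _ hι))
  refine ⟨(j' + s) + r₁ • ι, Submodule.add_mem_sup (add_mem (chainsIn_mono hlid.subset hj') hs)
    (Submodule.smul_mem _ _ (Submodule.mem_span_singleton_self _)), t, ht, ?_⟩
  have : b = (b - r₁ • ι - s) + r₁ • ι + s := by abel
  rw [this, h4]
  abel

variable (R) in
theorem cubeRelEq (d : ℕ) : CubeRelEq R d := by
  induction d with
  | zero => exact cubeRelEq_zero
  | succ d ih => exact ih.succ

end CubeRel

/-! ### Finite cell complexes -/

/-- A set `X` decomposed into open cells: `cell y` is the index of the open cell of `y`, and the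
cells are parametrized by cubes. -/
structure CellDecomposition {E : Type*} [TopologicalSpace E] {κ : Type*} (X : Set E)
    (S : Finset κ) (dim : κ → ℕ) (map : ∀ e, (Fin (dim e) → unitInterval) → E)
    (cell : E → κ) : Prop where
  continuous : ∀ e ∈ S, Continuous (map e)
  cell_mem : ∀ y ∈ X, cell y ∈ S
  map_mem : ∀ e ∈ S, ∀ x, map e x ∈ X
  dim_lt : ∀ e ∈ S, ∀ x ∈ cubeBoundary (dim e), dim (cell (map e x)) < dim e
  cell_map : ∀ e ∈ S, ∀ x ∉ cubeBoundary (dim e), cell (map e x) = e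
  injOn : ∀ e ∈ S, Set.InjOn (map e) (cubeBoundary (dim e))ᶜ
  cover : ∀ y ∈ X, ∃ x, map (cell y) x = y

section CellCombination

variable {R : Type*} [CommRing R] {E κ : Type*} {dim : κ → ℕ}
  {map : ∀ e, (Fin (dim e) → unitInterval) → E}

variable (R) in
/-- The cellular chains, together with the degenerate cubes. -/
noncomputable def cellChains (S : Set κ) (dim : κ → ℕ)
    (map : ∀ e, (Fin (dim e) → unitInterval) → E) : Submodule R (FormalChain R E) :=
  degenerate R E ⊔ Submodule.span R ((fun e => cube R (map e)) '' S)

variable (R) in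
/-- The linear combination of cells with given coefficients. -/
noncomputable def cellCombination (dim : κ → ℕ) (map : ∀ e, (Fin (dim e) → unitInterval) → E) :
    (κ →₀ R) →ₗ[R] FormalChain R E :=
  Finsupp.lmapDomain R R fun e => ⟨dim e, map e⟩

theorem cellCombination_single (e : κ) (r : R) :
    cellCombination R dim map (Finsupp.single e r) = r • cube R (map e) := by
  simp [cellCombination, cube, Finsupp.mapDomain_single]

theorem mem_cellChains {T : Set κ} {z : FormalChain R E} :
    z ∈ cellChains R T dim map ↔
      ∃ ξ ∈ Finsupp.supported R R T, z - cellCombination R dim map ξ ∈ degenerate R E := by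
  have h : ∀ ξ, cellCombination R dim map ξ =
      Finsupp.linearCombination R (fun e => cube R (map e)) ξ := by
    refine fun ξ => LinearMap.congr_fun (Finsupp.lhom_ext fun e r => ?_) ξ
    rw [cellCombination_single, Finsupp.linearCombination_single]
  rw [cellChains, Submodule.mem_sup]
  constructor
  · rintro ⟨d, hd, y, hy, rfl⟩
    obtain ⟨ξ, hξ, rfl⟩ := (Finsupp.mem_span_image_iff_linearCombination R).1 hy
    exact ⟨ξ, hξ, by rwa [h, add_sub_cancel_right]⟩
  · rintro ⟨ξ, hξ, hz⟩
    exact ⟨_, hz, _, (Finsupp.mem_span_image_iff_linearCombination R).2 ⟨ξ, hξ, rfl⟩, by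
      rw [h, sub_add_cancel]⟩

end CellCombination

section CellComplex

variable {R : Type*} [CommRing R] {E : Type*} [TopologicalSpace E] [T2Space E] {κ : Type*}
  {X : Set E} {S : Finset κ} {dim : κ → ℕ} {map : ∀ e, (Fin (dim e) → unitInterval) → E}
  {cell : E → κ}

namespace CellDecomposition

/-- Removing a cell of the top dimension. -/
theorem erase [DecidableEq κ] (h : CellDecomposition X S dim map cell) {e : κ}
    (hmax : ∀ f ∈ S, dim f ≤ dim e) :
    CellDecomposition {y ∈ X | cell y ≠ e} (S.erase e) dim map cell where
  continuous f hf := h.continuous f (Finset.mem_of_mem_erase hf)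
  cell_mem y hy := Finset.mem_erase.2 ⟨hy.2, h.cell_mem y hy.1⟩
  map_mem f hf x := by
    have hf' := Finset.mem_erase.1 hf
    refine ⟨h.map_mem f hf'.2 x, fun hx => ?_⟩
    by_cases hxb : x ∈ cubeBoundary (dim f)
    · have := h.dim_lt f hf'.2 x hxb
      rw [hx] at this
      exact absurd (hmax f hf'.2) (not_le.2 this)
    · exact hf'.1 (by rw [← hx, h.cell_map f hf'.2 x hxb])
  dim_lt f hf := h.dim_lt f (Finset.mem_of_mem_erase hf)
  cell_map f hf := h.cell_map f (Finset.mem_of_mem_erase hf)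
  injOn f hf := h.injOn f (Finset.mem_of_mem_erase hf)
  cover y hy := h.cover y hy.1

theorem isClosed (h : CellDecomposition X S dim map cell) : IsClosed X := by
  have : X = ⋃ e ∈ S, Set.range (map e) := by
    ext y
    simp only [Set.mem_iUnion, Set.mem_range]
    constructor
    · intro hy
      obtain ⟨x, hx⟩ := h.cover y hy
      exact ⟨_, h.cell_mem y hy, x, hx⟩
    · rintro ⟨e, he, x, rfl⟩
      exact h.map_mem e he x
  rw [this]
  exact (S.finite_toSet.isCompact_biUnion fun e he => isCompact_range (h.continuous e he)).isClosed

theorem isCellAttachment (h : CellDecomposition X S dim map cell) {e : κ} (he : e ∈ S)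
    (hmax : ∀ f ∈ S, dim f ≤ dim e) :
    IsCellAttachment {y ∈ X | cell y ≠ e} X (map e) where
  continuous := h.continuous e he
  isClosed := by
    classical exact (h.erase hmax).isClosed
  subset := Set.sep_subset _ _
  mem := h.map_mem e he
  boundary_mem x hx := ⟨h.map_mem e he x, fun hxe => by
    have := h.dim_lt e he x hx
    rw [hxe] at this
    exact lt_irrefl _ this⟩
  interior_notMem x hx hxA := hxA.2 (h.cell_map e he x hx)
  injOn := h.injOn e he
  cover y hy hyA := by
    have : cell y = e := by
      by_contra hne
      exact hyA ⟨hy, hne⟩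
    rw [← this]
    exact h.cover y hy

/-- Induction on the number of cells. A cell of the top dimension meets no boundary of another cell,
so removing it leaves a smaller cell complex, to which it is attached. -/
theorem relEq_cellChains (h : CellDecomposition X S dim map cell)
    (hb : ∀ e ∈ S, formalBoundary R (cube R (map e)) ∈
      cellChains R {f | f ∈ S ∧ dim f < dim e} dim map) :
    RelEq (cellChains R (S : Set κ) dim map) (chainsIn R X) := by
  classical
  induction hn : S.card generalizing S X with
  | zero =>
    rw [Finset.card_eq_zero] at hn
    subst hn
    have hX : X = ∅ := Set.eq_empty_of_forall_notMem fun y hy => by simpa using h.cell_mem y hy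
    have : chainsIn R X ≤ cellChains R ((∅ : Finset κ) : Set κ) dim map := by
      rw [hX]
      exact chainsIn_le le_sup_left fun n c _ hc => (hc 0).elim
    refine ⟨sup_le (degenerate_le_chainsIn _) (by simp), fun b hb _ =>
      ⟨b, this hb, 0, zero_mem _, by simp⟩⟩
  | succ n ih =>
    obtain ⟨e, he, hmax⟩ := S.exists_max_image dim (Finset.card_pos.1 (by omega))
    have hsub : ∀ f ∈ S, {g | g ∈ S ∧ dim g < dim f} ⊆ {g | g ∈ S.erase e ∧ dim g < dim f} :=
      fun f hf g hg => ⟨Finset.mem_erase.2 ⟨fun hge => by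
        have := hmax f hf; have := hg.2; rw [hge] at this; omega, hg.1⟩, hg.2⟩
    have hmono : ∀ T T' : Set κ, T ⊆ T' → cellChains R T dim map ≤ cellChains R T' dim map :=
      fun T T' hT => sup_le_sup_left (Submodule.span_mono (Set.image_mono hT)) _
    have hrel := ih (h.erase hmax) (fun f hf => hmono _ _ (hsub f (Finset.mem_of_mem_erase hf))
      (hb f (Finset.mem_of_mem_erase hf))) (by rw [Finset.card_erase_of_mem he, hn]; rfl)
    have := (h.isCellAttachment he hmax).relEq_of_cubeRelEq (cubeRelEq R _) hrel
      (hmono _ _ (fun g hg => (hsub e he hg).1) (hb e he))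
    convert this using 1
    rw [cellChains, cellChains, sup_assoc, ← Submodule.span_union]
    congr 2
    conv_lhs => rw [← Finset.insert_erase he, Finset.coe_insert, Set.image_insert_eq,
      ← Set.union_singleton]

theorem cell_center (h : CellDecomposition X S dim map cell) {e : κ} (he : e ∈ S) :
    cell (map e (cubeCenter _)) = e :=
  h.cell_map e he _ cubeCenter_notMem

end CellDecomposition

/-- The characteristic cubes are nondegenerate and pairwise distinct basis elements: a cell is
recovered from its cube as the cell containing the image of the centre. -/
theorem CellDecomposition.eq_zero_of_mem_degenerate (h : CellDecomposition X S dim map cell)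
    {ξ : κ →₀ R} (hξ : ξ ∈ Finsupp.supported R R (S : Set κ))
    (hd : cellCombination R dim map ξ ∈ degenerate R E) : ξ = 0 := by
  ext e
  by_cases he : e ∈ S
  · have h1 := (Finsupp.mem_supported' R _).1 hd ⟨dim e, map e⟩
      (not_degenerateCube_of_injOn (h.injOn e he))
    rw [cellCombination, Finsupp.lmapDomain_apply, Finsupp.mapDomain_apply' (S : Set κ) ξ hξ ?_ he]
      at h1
    · exact h1
    · intro f hf g hg hfg
      let F : FormalCube E → κ := fun c => cell (c.2 (cubeCenter _))
      have : F ⟨dim f, map f⟩ = F ⟨dim g, map g⟩ := congrArg F hfg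
      exact ((h.cell_center hf).symm.trans this).trans (h.cell_center hg)
  · exact (Finsupp.mem_supported' R _).1 hξ e he

end CellComplex

/-! ### Degrees and augmentation -/

section Degree

variable {R : Type*} [CommRing R] {X Y : Type*}

variable (R) in
/-- The component of degree `q` of a chain. -/
noncomputable def degreePart (q : ℕ) : FormalChain R X →ₗ[R] FormalChain R X :=
  Finsupp.linearCombination R fun c => if c.1 = q then Finsupp.single c 1 else 0

variable (R) in
/-- The augmentation, which is `1` on the cubes of dimension `0`. -/
noncomputable def augmentation : FormalChain R X →ₗ[R] R :=
  Finsupp.linearCombination R fun c => if c.1 = 0 then 1 else 0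

theorem degreePart_cube (q : ℕ) {n : ℕ} (c : (Fin n → unitInterval) → X) :
    degreePart R q (cube R c) = if n = q then cube R c else 0 := by
  simp [degreePart, cube]

theorem augmentation_cube {n : ℕ} (c : (Fin n → unitInterval) → X) :
    augmentation R (cube R c) = if n = 0 then 1 else 0 := by
  simp [augmentation, cube]

theorem degreePart_push (q : ℕ) (f : X → Y) (z : FormalChain R X) :
    degreePart R q (push R f z) = push R f (degreePart R q z) := by
  refine LinearMap.congr_fun (f := degreePart R q ∘ₗ push R f)
    (g := push R f ∘ₗ degreePart R q) (chain_hom_ext fun n c => ?_) z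
  simp only [LinearMap.comp_apply, push_cube, degreePart_cube]
  split_ifs <;> simp

theorem augmentation_push (f : X → Y) (z : FormalChain R X) :
    augmentation R (push R f z) = augmentation R z := by
  refine LinearMap.congr_fun (f := augmentation R ∘ₗ push R f)
    (g := augmentation R) (chain_hom_ext fun n c => ?_) z
  simp only [LinearMap.comp_apply, push_cube, augmentation_cube]

theorem degreePart_formalBoundary (q : ℕ) (z : FormalChain R X) :
    degreePart R q (formalBoundary R z) = formalBoundary R (degreePart R (q + 1) z) := by
  suffices key : degreePart R q ∘ₗ formalBoundary R (X := X) =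
      formalBoundary R ∘ₗ degreePart R (q + 1) by
    rw [← LinearMap.comp_apply, key, LinearMap.comp_apply]
  refine chain_hom_ext fun n c => ?_
  simp only [LinearMap.comp_apply, degreePart_cube]
  cases n with
  | zero => simp [formalBoundary_cube_zero]
  | succ n =>
    rw [formalBoundary_cube_eq_sum]
    simp only [map_sum, map_smul, map_sub, degreePart_cube, add_left_inj]
    split_ifs with h
    · rw [formalBoundary_cube_eq_sum]
    · simp

theorem augmentation_formalBoundary (z : FormalChain R X) :
    augmentation R (formalBoundary R z) = 0 := by
  refine LinearMap.congr_fun (f := augmentation R ∘ₗ formalBoundary R)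
    (g := 0) (chain_hom_ext fun n c => ?_) z
  simp only [LinearMap.comp_apply]
  cases n with
  | zero => simp [formalBoundary_cube_zero]
  | succ n =>
    rw [formalBoundary_cube_eq_sum]
    simp [map_sum, map_smul, map_sub, augmentation_cube]

theorem degreePart_mem_supported (q : ℕ) {T : Set (FormalCube X)} {z : FormalChain R X}
    (hz : z ∈ Finsupp.supported R R T) : degreePart R q z ∈ Finsupp.supported R R T := by
  have : Finsupp.supported R R T ≤ (Finsupp.supported R R T).comap (degreePart R q) := by
    refine supported_le_of_cube fun n c hc => ?_
    rw [Submodule.mem_comap, degreePart_cube]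
    split_ifs
    · exact Finsupp.single_mem_supported R _ hc
    · exact zero_mem _
  exact this hz

theorem degreePart_mem_degenerate (q : ℕ) {z : FormalChain R X} (hz : z ∈ degenerate R X) :
    degreePart R q z ∈ degenerate R X := degreePart_mem_supported q hz

theorem degreePart_mem_chainsIn [TopologicalSpace X] (q : ℕ) {U : Set X} {z : FormalChain R X}
    (hz : z ∈ chainsIn R U) : degreePart R q z ∈ chainsIn R U := degreePart_mem_supported q hz

theorem augmentation_of_mem_degenerate {z : FormalChain R X} (hz : z ∈ degenerate R X) :
    augmentation R z = 0 := by
  have : degenerate R X ≤ LinearMap.ker (augmentation R) := by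
    refine supported_le_of_cube ?_
    rintro n c ⟨i, hi⟩
    rw [LinearMap.mem_ker, augmentation_cube, if_neg (by rintro rfl; exact i.elim0)]
  exact this hz

theorem degreePart_cellCombination {κ : Type*} {dim : κ → ℕ}
    {map : ∀ e, (Fin (dim e) → unitInterval) → X} (q : ℕ) (ξ : κ →₀ R) :
    degreePart R q (cellCombination R dim map ξ) =
      cellCombination R dim map (ξ.filter fun e => dim e = q) := by
  induction ξ using Finsupp.induction_linear with
  | zero => rw [Finsupp.filter_zero]; simp
  | add f g hf hg => rw [map_add, map_add, hf, hg, Finsupp.filter_add, map_add]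
  | single e r =>
    rw [cellCombination_single, map_smul, degreePart_cube]
    split_ifs with h
    · rw [Finsupp.filter_single_of_pos (fun e => dim e = q) h, cellCombination_single]
    · rw [Finsupp.filter_single_of_neg (fun e => dim e = q) h, smul_zero, map_zero]

end Degree

/-! ### The cells of the geometric realization -/

section Position

variable {m : ℕ}

/-- The number of elements of `I` before `a`. -/
def position (I : Finset (Fin m)) (a : Fin m) : ℕ := (I.filter (· < a)).card

theorem position_orderEmbOfFin {I : Finset (Fin m)} {k : ℕ} (h : I.card = k) (p : Fin k) :
    position I (I.orderEmbOfFin h p) = p := by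
  have : I.filter (· < I.orderEmbOfFin h p) =
      (Finset.univ.filter (· < p)).map (I.orderEmbOfFin h).toEmbedding := by
    ext a
    simp only [Finset.mem_filter, Finset.mem_map, Finset.mem_univ, true_and]
    constructor
    · rintro ⟨ha, hap⟩
      have : a ∈ Set.range (I.orderEmbOfFin h) := by rwa [Finset.range_orderEmbOfFin]
      obtain ⟨q, rfl⟩ := this
      exact ⟨q, by simpa using hap, rfl⟩
    · rintro ⟨q, hq, rfl⟩
      exact ⟨Finset.orderEmbOfFin_mem _ _ _, by simpa using hq⟩
  rw [position, this, Finset.card_map, Finset.filter_gt_eq_Iio, Fin.card_Iio]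

theorem exists_position_eq {I : Finset (Fin m)} {p : ℕ} (hp : p < I.card) :
    ∃ a ∈ I, position I a = p :=
  ⟨_, Finset.orderEmbOfFin_mem I rfl ⟨p, hp⟩, position_orderEmbOfFin rfl _⟩

theorem sum_eq_sum_orderEmbOfFin {M : Type*} [AddCommMonoid M] {I : Finset (Fin m)} {k : ℕ}
    (h : I.card = k) (f : Fin m → M) : ∑ a ∈ I, f a = ∑ p : Fin k, f (I.orderEmbOfFin h p) := by
  conv_lhs => rw [← Finset.image_orderEmbOfFin_univ I h]
  rw [Finset.sum_image fun a _ b _ hab => (I.orderEmbOfFin h).injective hab]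

theorem sum_position {M : Type*} [AddCommMonoid M] (I : Finset (Fin m)) (f : ℕ → M) :
    ∑ a ∈ I, f (position I a) = ∑ p ∈ Finset.range I.card, f p := by
  rw [sum_eq_sum_orderEmbOfFin rfl, Finset.sum_range]
  exact Finset.sum_congr rfl fun p _ => by rw [position_orderEmbOfFin]

theorem position_lt_card {I : Finset (Fin m)} {a : Fin m} (ha : a ∈ I) : position I a < I.card :=
  Finset.card_lt_card (Finset.filter_ssubset.2 ⟨a, ha, lt_irrefl _⟩)

theorem position_lt_position {I : Finset (Fin m)} {a b : Fin m} (ha : a ∈ I) (hab : a < b) :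
    position I a < position I b := by
  refine Finset.card_lt_card (Finset.ssubset_iff_of_subset ?_ |>.2 ⟨a, ?_, ?_⟩)
  · exact Finset.monotone_filter_right _ fun c _ hc => lt_trans hc hab
  · simp [ha, hab]
  · simp

theorem position_injOn {I : Finset (Fin m)} {a b : Fin m} (ha : a ∈ I) (hb : b ∈ I)
    (h : position I a = position I b) : a = b := by
  rcases lt_trichotomy a b with hab | hab | hab
  · exact absurd h (position_lt_position ha hab).ne
  · exact hab
  · exact absurd h (position_lt_position hb hab).ne'

theorem position_lt_iff {I : Finset (Fin m)} {a b : Fin m} (ha : a ∈ I) (hb : b ∈ I) :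
    position I a < position I b ↔ a < b := by
  refine ⟨fun h => ?_, position_lt_position ha⟩
  by_contra hab
  rcases (not_lt.1 hab).lt_or_eq with h' | rfl
  · exact absurd h (position_lt_position hb h').le.not_gt
  · exact lt_irrefl _ h

theorem position_erase_of_le {I : Finset (Fin m)} {a i : Fin m} (h : a ≤ i) :
    position (I.erase i) a = position I a := by
  unfold position
  congr 1
  ext b
  simp only [Finset.mem_filter, Finset.mem_erase]
  exact ⟨fun hb => ⟨hb.1.2, hb.2⟩, fun hb => ⟨⟨(lt_of_lt_of_le hb.2 h).ne, hb.1⟩, hb.2⟩⟩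

theorem position_erase_of_lt {I : Finset (Fin m)} {a i : Fin m} (hi : i ∈ I) (h : i < a) :
    position (I.erase i) a = position I a - 1 := by
  unfold position
  rw [Finset.filter_erase, Finset.card_erase_of_mem (by simp [hi, h])]

end Position

theorem coord_of_lt {d : ℕ} (x : Fin d → unitInterval) {p : ℕ} (h : p < d) :
    coord x p = x ⟨p, h⟩ := dif_pos h

theorem coord_of_le {d : ℕ} (x : Fin d → unitInterval) {p : ℕ} (h : d ≤ p) : coord x p = 0 :=
  dif_neg (not_lt.2 h)

theorem coord_nonneg {d : ℕ} (x : Fin d → unitInterval) (p : ℕ) : 0 ≤ coord x p := by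
  unfold coord
  split_ifs
  · exact (x _).2.1
  · exact le_rfl

theorem coord_le_one {d : ℕ} (x : Fin d → unitInterval) (p : ℕ) : coord x p ≤ 1 :=
  (le_abs_self _).trans (norm_coord_le x p)

theorem coord_pos {d : ℕ} {x : Fin d → unitInterval} (hx : x ∉ cubeBoundary d) {p : ℕ}
    (hp : p < d) : 0 < coord x p := by
  refine (coord_nonneg x p).lt_of_ne' fun h => hx ⟨⟨p, hp⟩, Or.inl (Subtype.ext ?_)⟩
  rwa [coord_of_lt x hp] at h

theorem coord_lt_one {d : ℕ} {x : Fin d → unitInterval} (hx : x ∉ cubeBoundary d) (p : ℕ) :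
    coord x p < 1 := by
  by_cases hp : p < d
  · refine (coord_le_one x p).lt_of_ne fun h => hx ⟨⟨p, hp⟩, Or.inr (Subtype.ext ?_)⟩
    rwa [coord_of_lt x hp] at h
  · rw [coord_of_le x (not_lt.1 hp)]
    exact one_pos

theorem coord_ext {d : ℕ} {x y : Fin d → unitInterval} (h : ∀ p < d, coord x p = coord y p) :
    x = y := by
  funext i
  have := h i i.2
  rw [coord_of_lt x i.2, coord_of_lt y i.2] at this
  exact Subtype.ext this

theorem coord_insertNth {n : ℕ} (p : Fin (n + 1)) (e : unitInterval) (x : Fin n → unitInterval)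
    (q : ℕ) : coord (p.insertNth (α := fun _ => unitInterval) e x) q =
      if q < p then coord x q else if q = p then (e : ℝ) else coord x (q - 1) := by
  have hp := p.2
  split_ifs with h1 h2
  · rw [coord_of_lt _ (show q < n + 1 by omega), coord_of_lt _ (show q < n by omega),
      Fin.insertNth_apply_below (Fin.lt_def.2 h1)]
    simp only [eq_rec_constant]
    rfl
  · subst h2
    rw [coord_of_lt _ p.2, Fin.insertNth_apply_same]
  · by_cases hq : q < n + 1
    · rw [coord_of_lt _ hq, coord_of_lt _ (show q - 1 < n by omega),
        Fin.insertNth_apply_above (Fin.lt_def.2 (show (p : ℕ) < q by omega))]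
      simp only [eq_rec_constant]
      rfl
    · rw [coord_of_le _ (by omega), coord_of_le _ (by omega)]

section Simplex

variable {m : ℕ}

/-- The parametrization of the simplex `I` by a cube. -/
noncomputable def simplexMap {d : ℕ} (I : Finset (Fin m)) (x : Fin d → unitInterval) (a : Fin m) : ℝ :=
  if a ∈ I then (∏ l ∈ Finset.range (position I a), coord x l) * (1 - coord x (position I a)) else 0

/-- The dimension of a nonempty simplex. -/
def simplexDim (I : Finset (Fin m)) : ℕ := I.card - 1

/-- The smallest simplex that contains a point. -/
noncomputable def carrier (y : Fin m → ℝ) : Finset (Fin m) := Finset.univ.filter fun i => y i ≠ 0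

/-- The union of the open simplices in `S`. -/
def openSimplices (S : Finset (Finset (Fin m))) : Set (Fin m → ℝ) :=
  {y | y ∈ stdSimplex ℝ (Fin m) ∧ carrier y ∈ S}

theorem mem_carrier {y : Fin m → ℝ} {a : Fin m} : a ∈ carrier y ↔ y a ≠ 0 := by simp [carrier]

theorem continuous_simplexMap {d : ℕ} (I : Finset (Fin m)) :
    Continuous (simplexMap (d := d) I) := by
  refine continuous_pi fun a => ?_
  unfold simplexMap
  split_ifs
  · have := fun p => continuous_coord (d := d) p
    fun_prop
  · fun_prop

theorem simplexMap_nonneg {d : ℕ} (I : Finset (Fin m)) (x : Fin d → unitInterval) (a : Fin m) :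
    0 ≤ simplexMap I x a := by
  unfold simplexMap
  split_ifs
  · exact mul_nonneg (Finset.prod_nonneg fun l _ => coord_nonneg x l)
      (sub_nonneg.2 (coord_le_one x _))
  · exact le_rfl

/-- The vertex number `p` receives `x₀ ⋯ x_{p-1} (1 - x_p)`, a difference of consecutive partial
products, so the sum telescopes. The default value `0` of `coord x d` makes the last product vanish.
-/
theorem sum_simplexMap {I : Finset (Fin m)} {d : ℕ} (hd : I.card = d + 1)
    (x : Fin d → unitInterval) : ∑ a, simplexMap I x a = 1 := by
  have h : ∑ a, simplexMap I x a = ∑ a ∈ I, ((fun k => (∏ l ∈ Finset.range k, coord x l)) (position I a) -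
      (fun k => (∏ l ∈ Finset.range (k + 1), coord x l)) (position I a)) := by
    unfold simplexMap
    rw [Finset.sum_ite_mem, Finset.univ_inter]
    refine Finset.sum_congr rfl fun a _ => ?_
    simp only [Finset.prod_range_succ]
    ring
  rw [h, sum_position I (fun k => (∏ l ∈ Finset.range k, coord x l) -
    ∏ l ∈ Finset.range (k + 1), coord x l), Finset.sum_range_sub', hd, Finset.prod_range_zero,
    Finset.prod_range_succ, coord_of_le x le_rfl]
  ring

theorem simplexMap_mem_stdSimplex {I : Finset (Fin m)} {d : ℕ} (hd : I.card = d + 1)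
    (x : Fin d → unitInterval) : simplexMap I x ∈ stdSimplex ℝ (Fin m) :=
  ⟨simplexMap_nonneg I x, sum_simplexMap hd x⟩

theorem carrier_simplexMap_subset {d : ℕ} (I : Finset (Fin m)) (x : Fin d → unitInterval) :
    carrier (simplexMap I x) ⊆ I := by
  intro a ha
  by_contra h
  exact mem_carrier.1 ha (if_neg h)

theorem carrier_nonempty {y : Fin m → ℝ} (hy : y ∈ stdSimplex ℝ (Fin m)) :
    (carrier y).Nonempty := by
  by_contra h
  have h0 : ∀ a, y a = 0 := fun a => by
    by_contra ha
    exact h ⟨a, mem_carrier.2 ha⟩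
  have := hy.2
  simp [h0] at this

theorem carrier_simplexMap {I : Finset (Fin m)} {d : ℕ} (hd : I.card = d + 1)
    {x : Fin d → unitInterval} (hx : x ∉ cubeBoundary d) : carrier (simplexMap I x) = I := by
  refine (carrier_simplexMap_subset I x).antisymm fun a ha => mem_carrier.2 ?_
  rw [simplexMap, if_pos ha]
  have hp := position_lt_card ha
  refine (mul_pos (Finset.prod_pos fun l hl => coord_pos hx ?_)
    (sub_pos.2 (coord_lt_one hx _))).ne'
  have := Finset.mem_range.1 hl
  omega

/-- If `x_i = 0`, every vertex after number `i` gets the weight `0`, and such a vertex exists as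
there are `d + 1` vertices. If `x_i = 1`, the vertex number `i` does. -/
theorem carrier_simplexMap_ssubset {I : Finset (Fin m)} {d : ℕ} (hd : I.card = d + 1)
    {x : Fin d → unitInterval} (hx : x ∈ cubeBoundary d) : carrier (simplexMap I x) ⊂ I := by
  refine (carrier_simplexMap_subset I x).ssubset_of_ne fun heq => ?_
  obtain ⟨i, hi⟩ := hx
  have h1 : ∀ a ∈ I, simplexMap I x a ≠ 0 := fun a ha => mem_carrier.1 (heq.symm.subset ha)
  rcases hi with hi | hi
  · obtain ⟨a, ha, hpa⟩ := exists_position_eq (I := I) (p := i + 1) (by have := i.2; omega)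
    refine h1 a ha ?_
    rw [simplexMap, if_pos ha, hpa, Finset.prod_range_succ, coord_of_lt x i.2, hi]
    simp
  · obtain ⟨a, ha, hpa⟩ := exists_position_eq (I := I) (p := i) (by have := i.2; omega)
    refine h1 a ha ?_
    rw [simplexMap, if_pos ha, hpa, coord_of_lt x i.2, hi]
    simp

/-- The coordinates are recovered one after another, dividing by the product of the earlier ones,
which is positive in the interior. -/
theorem simplexMap_injOn {I : Finset (Fin m)} {d : ℕ} (hd : I.card = d + 1) :
    Set.InjOn (simplexMap (d := d) I) (cubeBoundary d)ᶜ := by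
  intro x hx y hy hxy
  refine coord_ext fun p => ?_
  induction p using Nat.strong_induction_on with
  | _ p ih =>
    intro hp
    obtain ⟨a, ha, hpa⟩ := exists_position_eq (I := I) (p := p) (by omega)
    have h := congrFun hxy a
    rw [simplexMap, simplexMap, if_pos ha, if_pos ha, hpa] at h
    have hprod : ∏ l ∈ Finset.range p, coord x l = ∏ l ∈ Finset.range p, coord y l :=
      Finset.prod_congr rfl fun l hl => ih l (Finset.mem_range.1 hl)
        ((Finset.mem_range.1 hl).trans hp)
    have hpos : 0 < ∏ l ∈ Finset.range p, coord y l :=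
      Finset.prod_pos fun l hl => coord_pos hy ((Finset.mem_range.1 hl).trans hp)
    rw [hprod] at h
    linarith [mul_left_cancel₀ hpos.ne' h]

theorem exists_simplexMap_eq {y : Fin m → ℝ} (hy : y ∈ stdSimplex ℝ (Fin m)) {d : ℕ}
    (hd : (carrier y).card = d + 1) : ∃ x : Fin d → unitInterval, simplexMap (carrier y) x = y := by
  set I := carrier y with hI
  -- The weight of the vertices from number `q` on. It has to equal the partial product `x₀ ⋯
  -- x_{q-1}`, which dictates `x_k = T (k + 1) / T k`.
  let T : ℕ → ℝ := fun q => ∑ a ∈ I, if q ≤ position I a then y a else 0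
  have hT0 : T 0 = 1 := by
    rw [← hy.2, ← Finset.sum_subset (Finset.subset_univ I) fun a _ ha => by
      by_contra h; exact ha (mem_carrier.2 h)]
    simp [T]
  have hTnonneg : ∀ q, 0 ≤ T q := fun q => Finset.sum_nonneg fun a _ => by
    split_ifs
    · exact hy.1 a
    · exact le_rfl
  have hTd : T (d + 1) = 0 := Finset.sum_eq_zero fun a ha => by
    rw [if_neg]
    have := position_lt_card ha
    omega
  have hstep : ∀ a ∈ I, T (position I a) = y a + T (position I a + 1) := by
    intro a ha
    simp only [T]
    rw [← Finset.add_sum_erase I _ ha, ← Finset.add_sum_erase I (fun b =>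
      if position I a + 1 ≤ position I b then y b else 0) ha, if_pos le_rfl, if_neg (by omega),
      zero_add]
    congr 1
    refine Finset.sum_congr rfl fun b hb => ?_
    have hb' := Finset.mem_erase.1 hb
    have : position I b ≠ position I a := fun h => hb'.1 (position_injOn hb'.2 ha h)
    by_cases h : position I a ≤ position I b
    · rw [if_pos h, if_pos (by omega)]
    · rw [if_neg h, if_neg (by omega)]
  have hTpos : ∀ k < d + 1, 0 < T k := by
    intro k hk
    obtain ⟨a, ha, rfl⟩ := exists_position_eq (I := I) (p := k) (by omega)
    rw [hstep a ha]
    have : 0 < y a := (hy.1 a).lt_of_ne' (mem_carrier.1 ha)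
    linarith [hTnonneg (position I a + 1)]
  have hTle : ∀ k < d + 1, T (k + 1) ≤ T k := by
    intro k hk
    obtain ⟨a, ha, rfl⟩ := exists_position_eq (I := I) (p := k) (by omega)
    rw [hstep a ha]
    linarith [hy.1 a]
  let x : Fin d → unitInterval := fun k => ⟨T (k + 1) / T k,
    div_nonneg (hTnonneg _) (hTnonneg _), div_le_one_of_le₀ (hTle k (by omega)) (hTnonneg _)⟩
  have hx : ∀ k < d + 1, coord x k = T (k + 1) / T k := by
    intro k hk
    by_cases hkd : k < d
    · rw [coord_of_lt x hkd]
    -- The coordinate beyond the cube is `0` by default, in agreement with `T (d + 1) = 0`.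
    · obtain rfl : k = d := by omega
      rw [coord_of_le x le_rfl, hTd, zero_div]
  have hP : ∀ k < d + 1, ∏ l ∈ Finset.range k, coord x l = T k := by
    intro k
    induction k with
    | zero => intro _; rw [Finset.prod_range_zero, hT0]
    | succ k ih =>
      intro hk
      rw [Finset.prod_range_succ, ih (by omega), hx k (by omega),
        mul_div_cancel₀ _ (hTpos k (by omega)).ne']
  refine ⟨x, funext fun a => ?_⟩
  by_cases ha : a ∈ I
  · have hp : position I a < d + 1 := hd ▸ position_lt_card ha
    rw [simplexMap, if_pos ha, hP _ hp, hx _ hp, mul_sub, mul_one,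
      mul_div_cancel₀ _ (hTpos _ hp).ne', hstep a ha]
    ring
  · rw [simplexMap, if_neg ha]
    by_contra h
    exact ha (mem_carrier.2 fun h' => h h'.symm)

theorem card_eq_simplexDim_add_one {I : Finset (Fin m)} (hI : I.Nonempty) :
    I.card = simplexDim I + 1 := by
  have := hI.card_pos
  unfold simplexDim
  omega

theorem simplexDecomposition {S : Finset (Finset (Fin m))} (hne : ∀ I ∈ S, I.Nonempty)
    (hdown : ∀ I ∈ S, ∀ J ⊆ I, J.Nonempty → J ∈ S) :
    CellDecomposition (openSimplices S) S simplexDim (fun I => simplexMap I) carrier where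
  continuous I _ := continuous_simplexMap I
  cell_mem y hy := hy.2
  map_mem I hI x := by
    have hmem := simplexMap_mem_stdSimplex (card_eq_simplexDim_add_one (hne I hI)) x
    exact ⟨hmem, hdown I hI _ (carrier_simplexMap_subset I x) (carrier_nonempty hmem)⟩
  dim_lt I hI x hx := by
    have hd := card_eq_simplexDim_add_one (hne I hI)
    have h1 := Finset.card_lt_card (carrier_simplexMap_ssubset hd hx)
    have h2 := card_eq_simplexDim_add_one (carrier_nonempty (simplexMap_mem_stdSimplex hd x))
    omega
  cell_map I hI x hx := carrier_simplexMap (card_eq_simplexDim_add_one (hne I hI)) hx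
  injOn I hI := simplexMap_injOn (card_eq_simplexDim_add_one (hne I hI))
  cover y hy := exists_simplexMap_eq hy.1 (card_eq_simplexDim_add_one (carrier_nonempty hy.1))

theorem prod_range_insert {c c' : ℕ → ℝ} {p : ℕ} {e : ℝ}
    (h : ∀ q, c' q = if q < p then c q else if q = p then e else c (q - 1)) {k : ℕ} (hk : p ≤ k) :
    ∏ l ∈ Finset.range (k + 1), c' l = e * ∏ l ∈ Finset.range k, c l := by
  induction k, hk using Nat.le_induction with
  | base =>
    rw [Finset.prod_range_succ, h p, if_neg (lt_irrefl _), if_pos rfl, mul_comm]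
    congr 1
    exact Finset.prod_congr rfl fun l hl => by rw [h l, if_pos (Finset.mem_range.1 hl)]
  | succ k hk ih =>
    rw [Finset.prod_range_succ, ih, Finset.prod_range_succ, h (k + 1), if_neg (by omega),
      if_neg (by omega), Nat.add_sub_cancel, mul_assoc]

theorem prod_range_insert_of_le {c c' : ℕ → ℝ} {p : ℕ} {e : ℝ}
    (h : ∀ q, c' q = if q < p then c q else if q = p then e else c (q - 1)) {k : ℕ} (hk : k ≤ p) :
    ∏ l ∈ Finset.range k, c' l = ∏ l ∈ Finset.range k, c l :=
  Finset.prod_congr rfl fun l hl => by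
    rw [h l, if_pos ((Finset.mem_range.1 hl).trans_le hk)]

/-- The face `x_p = 1` of a simplex omits the vertex with number `p`. -/
theorem simplexMap_insertNth_one {I : Finset (Fin m)} {n : ℕ} {p : Fin (n + 1)} {i : Fin m}
    (hi : i ∈ I) (hp : position I i = p) (x : Fin n → unitInterval) :
    simplexMap I (p.insertNth (α := fun _ => unitInterval) 1 x) = simplexMap (I.erase i) x := by
  funext a
  have hc := coord_insertNth p 1 x
  unfold simplexMap
  rcases lt_trichotomy a i with h | rfl | h
  · by_cases ha : a ∈ I
    · have hpos : position I a < p := hp ▸ position_lt_position ha h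
      rw [if_pos ha, if_pos (Finset.mem_erase.2 ⟨h.ne, ha⟩), position_erase_of_le h.le,
        prod_range_insert_of_le hc hpos.le, hc, if_pos hpos]
    · rw [if_neg ha, if_neg fun h' => ha (Finset.mem_of_mem_erase h')]
  · rw [if_pos hi, if_neg (Finset.notMem_erase _ _), hp, hc, if_neg (lt_irrefl _), if_pos rfl]
    simp
  · by_cases ha : a ∈ I
    · have hpos : p < position I a := hp ▸ position_lt_position hi h
      obtain ⟨k, hk⟩ : ∃ k, position I a = k + 1 := ⟨position I a - 1, by omega⟩
      rw [if_pos ha, if_pos (Finset.mem_erase.2 ⟨h.ne', ha⟩), position_erase_of_lt hi h, hk,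
        prod_range_insert hc (by omega), hc, if_neg (by omega), if_neg (by omega)]
      simp
    · rw [if_neg ha, if_neg fun h' => ha (Finset.mem_of_mem_erase h')]

/-- The last face `x_n = 0` of a simplex omits the last vertex. -/
theorem simplexMap_insertNth_last_zero {I : Finset (Fin m)} {n : ℕ} {i : Fin m}
    (hI : I.card = n + 2) (hi : i ∈ I) (hp : position I i = n + 1) (x : Fin n → unitInterval) :
    simplexMap I ((Fin.last n).insertNth (α := fun _ => unitInterval) 0 x) =
      simplexMap (I.erase i) x := by
  funext a
  have hc := coord_insertNth (Fin.last n) 0 x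
  have hval : ((Fin.last n : Fin (n + 1)) : ℕ) = n := Fin.val_last n
  rw [hval] at hc
  unfold simplexMap
  by_cases ha : a ∈ I
  · have hlt := position_lt_card ha
    rcases eq_or_ne a i with rfl | hne
    · rw [if_pos ha, if_neg (Finset.notMem_erase _ _), hp, prod_range_insert hc le_rfl]
      simp
    · have hne' : position I a ≠ n + 1 := fun h => hne (position_injOn ha hi (h.trans hp.symm))
      have hle : a ≤ i := by
        rw [← not_lt, ← position_lt_iff hi ha]
        omega
      rw [if_pos ha, if_pos (Finset.mem_erase.2 ⟨hne, ha⟩), position_erase_of_le hle,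
        prod_range_insert_of_le hc (by omega), hc]
      split_ifs with h1 h2
      · rfl
      · rw [h2, coord_of_le x le_rfl]
        rfl
      · omega
  · rw [if_neg ha, if_neg fun h' => ha (Finset.mem_of_mem_erase h')]

/-- The other faces `x_p = 0` of a simplex are degenerate. -/
theorem degenerateCube_simplexMap_insertNth_zero (I : Finset (Fin m)) {n : ℕ} (p : Fin n) :
    DegenerateCube fun x : Fin n → unitInterval =>
      simplexMap I (p.castSucc.insertNth (α := fun _ => unitInterval) 0 x) := by
  refine ⟨p, fun x y hxy => funext fun a => ?_⟩
  have hx := coord_insertNth p.castSucc 0 x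
  have hy := coord_insertNth p.castSucc 0 y
  have hcoord : ∀ q < (p : ℕ), coord x q = coord y q := by
    intro q hq
    have hq' : q < n := hq.trans p.2
    rw [coord_of_lt x hq', coord_of_lt y hq', hxy ⟨q, hq'⟩ (Fin.ne_of_val_ne hq.ne)]
  have hval : (p.castSucc : ℕ) = p := rfl
  rw [hval] at hx hy
  simp only [simplexMap]
  split_ifs with ha
  · rcases le_or_gt (position I a) p with h | h
    · rw [prod_range_insert_of_le hx h, prod_range_insert_of_le hy h, hx, hy]
      congr 1
      · exact Finset.prod_congr rfl fun l hl => hcoord l ((Finset.mem_range.1 hl).trans_le h)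
      · split_ifs with h1 h2
        · rw [hcoord _ h1]
        · rfl
        · omega
    · obtain ⟨k, hk⟩ : ∃ k, position I a = k + 1 := ⟨position I a - 1, by omega⟩
      rw [hk, prod_range_insert hx (by omega), prod_range_insert hy (by omega)]
      simp
  · rfl

variable {R : Type*} [CommRing R]

/-- The faces `x_p = 1` give the facets opposite to the vertices `0, …, n`. The facet opposite to
the last vertex is the face `x_n = 0`, whose sign `-(-1) ^ n` is the right one. The other faces `x_p
= 0` are degenerate. -/
theorem formalBoundary_simplexMap {I : Finset (Fin m)} {n : ℕ} (hI : I.card = n + 2) :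
    formalBoundary R (cube R (simplexMap (d := n + 1) I)) -
      ∑ i ∈ I, (-1 : R) ^ position I i • cube R (simplexMap (d := n) (I.erase i)) ∈
        degenerate R (Fin m → ℝ) := by
  have h1 : ∀ p : Fin (n + 1), (fun x : Fin n → unitInterval =>
      simplexMap I (p.insertNth (α := fun _ => unitInterval) 1 x)) =
        simplexMap (I.erase (I.orderEmbOfFin hI p.castSucc)) := fun p => funext fun x =>
    simplexMap_insertNth_one (p := p) (Finset.orderEmbOfFin_mem _ _ _)
      (position_orderEmbOfFin hI p.castSucc) x
  have h2 : (fun x : Fin n → unitInterval =>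
      simplexMap I ((Fin.last n).insertNth (α := fun _ => unitInterval) 0 x)) =
        simplexMap (I.erase (I.orderEmbOfFin hI (Fin.last _))) := funext fun x =>
    simplexMap_insertNth_last_zero hI (Finset.orderEmbOfFin_mem _ _ _)
      (position_orderEmbOfFin hI _) x
  rw [formalBoundary_cube_eq_sum, sum_eq_sum_orderEmbOfFin hI, Fin.sum_univ_castSucc (n := n + 1)]
  simp only [smul_sub, Finset.sum_sub_distrib, h1, position_orderEmbOfFin, Fin.val_castSucc]
  rw [Fin.sum_univ_castSucc (n := n) (f := fun p : Fin (n + 1) => (-1 : R) ^ (p : ℕ) •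
    cube R (fun x : Fin n → unitInterval =>
      simplexMap I (p.insertNth (α := fun _ => unitInterval) 0 x))), h2]
  have h3 : ∑ p : Fin n, (-1 : R) ^ (p.castSucc : ℕ) • cube R (fun x : Fin n → unitInterval =>
      simplexMap I (p.castSucc.insertNth (α := fun _ => unitInterval) 0 x)) ∈
        degenerate R (Fin m → ℝ) :=
    sum_mem fun p _ => Submodule.smul_mem _ _
      (cube_mem_degenerate (degenerateCube_simplexMap_insertNth_zero I p))
  convert neg_mem h3 using 1
  simp only [Fin.val_last, pow_succ, mul_neg, mul_one, neg_smul]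
  abel

end Simplex

/-! ### Simplicial chains -/

section SimplicialChains

variable {R : Type*} [CommRing R] {m : ℕ}

variable (R) in
/-- The boundary of augmented simplicial chains. -/
noncomputable def simplicialBoundary :
    (Finset (Fin m) →₀ R) →ₗ[R] (Finset (Fin m) →₀ R) :=
  Finsupp.linearCombination R fun I =>
    ∑ i ∈ I, (-1 : R) ^ position I i • Finsupp.single (I.erase i) 1

variable (R) in
/-- Simplicial chains as singular chains; the empty simplex goes to zero. -/
noncomputable def simplexChain : (Finset (Fin m) →₀ R) →ₗ[R] FormalChain R (Fin m → ℝ) :=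
  Finsupp.linearCombination R fun I =>
    if I = ∅ then 0 else cube R (simplexMap (d := simplexDim I) I)

theorem simplicialBoundary_single (I : Finset (Fin m)) :
    simplicialBoundary R (Finsupp.single I 1) =
      ∑ i ∈ I, (-1 : R) ^ position I i • Finsupp.single (I.erase i) 1 := by
  simp [simplicialBoundary]

theorem simplexChain_single (I : Finset (Fin m)) :
    simplexChain R (Finsupp.single I 1) =
      if I = ∅ then 0 else cube R (simplexMap (d := simplexDim I) I) := by
  simp [simplexChain]

theorem formalBoundary_simplexChain (ξ : Finset (Fin m) →₀ R) :
    formalBoundary R (simplexChain R ξ) - simplexChain R (simplicialBoundary R ξ) ∈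
      degenerate R (Fin m → ℝ) := by
  suffices h : ∀ I : Finset (Fin m), formalBoundary R (simplexChain R (Finsupp.single I 1)) -
      simplexChain R (simplicialBoundary R (Finsupp.single I 1)) ∈ degenerate R (Fin m → ℝ) by
    induction ξ using Finsupp.induction_linear with
    | zero => simp
    | add f g hf hg =>
      simp only [map_add]
      rw [add_sub_add_comm]
      exact add_mem hf hg
    | single I r =>
      have : Finsupp.single I r = r • Finsupp.single I (1 : R) := by simp
      rw [this]
      simp only [map_smul, ← smul_sub]
      exact Submodule.smul_mem _ _ (h I)
  intro I
  rw [simplicialBoundary_single, simplexChain_single]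
  simp only [map_sum, map_smul, simplexChain_single]
  rcases Nat.lt_or_ge I.card 2 with hI | hI
  · have h1 : ∀ i ∈ I, I.erase i = ∅ := fun i hi => by
      rw [← Finset.card_eq_zero, Finset.card_erase_of_mem hi]; omega
    rw [Finset.sum_eq_zero fun i hi => by rw [if_pos (h1 i hi), smul_zero], sub_zero]
    split_ifs
    · simp
    · have hd : simplexDim I = 0 := by unfold simplexDim; omega
      rw [hd, formalBoundary_cube_zero]
      exact zero_mem _
  · obtain ⟨n, hn⟩ : ∃ n, I.card = n + 2 := ⟨I.card - 2, by omega⟩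
    have hd : simplexDim I = n + 1 := by unfold simplexDim; omega
    have hne : I ≠ ∅ := by rintro rfl; simp at hn
    rw [if_neg hne, hd]
    convert formalBoundary_simplexMap (R := R) hn using 2
    refine Finset.sum_congr rfl fun i hi => ?_
    have hc : (I.erase i).card = n + 1 := by rw [Finset.card_erase_of_mem hi]; omega
    have hd' : simplexDim (I.erase i) = n := by unfold simplexDim; omega
    rw [if_neg (by rw [← Finset.card_eq_zero]; omega), hd']

/-- The augmentation retains the coefficient of the empty simplex, which `simplexChain` discards. -/
theorem augmentation_simplexChain (ξ : Finset (Fin m) →₀ R) :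
    augmentation R (simplexChain R ξ) = simplicialBoundary R ξ ∅ := by
  suffices h : ∀ I : Finset (Fin m), augmentation R (simplexChain R (Finsupp.single I 1)) =
      simplicialBoundary R (Finsupp.single I 1) ∅ by
    induction ξ using Finsupp.induction_linear with
    | zero => simp
    | add f g hf hg => simp only [map_add, hf, hg, Finsupp.add_apply]
    | single I r =>
      have : Finsupp.single I r = r • Finsupp.single I (1 : R) := by simp
      rw [this]
      simp only [map_smul, h, Finsupp.smul_apply]
  intro I
  rw [simplicialBoundary_single, simplexChain_single, Finsupp.finsetSum_apply]
  simp only [Finsupp.smul_apply, Finsupp.single_apply, smul_eq_mul]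
  rcases Finset.eq_empty_or_nonempty I with rfl | hne
  · simp
  rw [if_neg hne.ne_empty, augmentation_cube]
  split_ifs with hd
  · obtain ⟨i, rfl⟩ : ∃ i, I = {i} := Finset.card_eq_one.1 (by
      rw [card_eq_simplexDim_add_one hne, hd])
    simp [position, Finset.filter_singleton]
  · symm
    refine Finset.sum_eq_zero fun i hi => ?_
    rw [if_neg, mul_zero]
    rw [← Finset.card_eq_zero, Finset.card_erase_of_mem hi]
    exact hd

theorem simplexChain_eq_cellCombination {ξ : Finset (Fin m) →₀ R} (h : ξ ∅ = 0) :
    simplexChain R ξ = cellCombination R simplexDim (fun I => simplexMap I) ξ := by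
  have : cellCombination R simplexDim (fun I : Finset (Fin m) => simplexMap I) ξ =
      ξ.sum fun I r => r • cube R (simplexMap (d := simplexDim I) I) := by
    conv_lhs => rw [← Finsupp.sum_single ξ]
    rw [Finsupp.sum, map_sum]
    exact Finset.sum_congr rfl fun I _ => cellCombination_single _ _
  rw [this, simplexChain, Finsupp.linearCombination_apply]
  refine Finset.sum_congr rfl fun I hI => ?_
  have hne : I ≠ ∅ := by
    rintro rfl
    exact Finsupp.mem_support_iff.1 hI h
  simp only [if_neg hne]

end SimplicialChains

/-! ### Transport along homeomorphisms, spheres -/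

section Transport

variable {R : Type*} [CommRing R] {X Y : Type*} [TopologicalSpace X] [TopologicalSpace Y]

/-- A relative cycle is carried to `Y` by `f`, moved into `A'` there and brought back by `g`. Only
`g ∘ f = id` on `U` is needed, and it is applied up to degenerate cubes. -/
theorem RelEq.of_leftInverse {f : X → Y} {g : Y → X} {A U : Set X} {A' U' : Set Y}
    (h : RelEq (chainsIn R A') (chainsIn R U')) (hAU : A ⊆ U)
    (hf : ContinuousOn f U) (hg : ContinuousOn g U') (hfU : Set.MapsTo f U U')
    (hfA : Set.MapsTo f A A') (hgU : Set.MapsTo g U' U) (hgA : Set.MapsTo g A' A)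
    (hA'U' : A' ⊆ U') (hgf : ∀ x ∈ U, g (f x) = x) : RelEq (chainsIn R A) (chainsIn R U) := by
  refine ⟨chainsIn_mono hAU, fun b hb hbA => ?_⟩
  obtain ⟨a, ha, s, hs, h'⟩ := h.2 (push R f b) (push_mem_chainsIn hf hfU hb) (by
    rw [← push_formalBoundary]
    exact push_mem_chainsIn (hf.mono hAU) hfA hbA)
  have hd := push_congr (f := g ∘ f) (g := id) hgf hb
  rw [push_id, ← push_push, h', map_add, push_formalBoundary] at hd
  refine ⟨push R g a - (push R g a + formalBoundary R (push R g s) - b),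
    sub_mem (push_mem_chainsIn (hg.mono hA'U') hgA ha) (degenerate_le_chainsIn _ hd),
    push R g s, push_mem_chainsIn hg hgU hs, ?_⟩
  abel

open Classical in
/-- The extension of a map between subsets by a constant. -/
noncomputable def extendMap {P : Set X} {Q : Set Y} (e : P → Q) (q : Y) (x : X) : Y :=
  if h : x ∈ P then e ⟨x, h⟩ else q

theorem extendMap_of_mem {P : Set X} {Q : Set Y} (e : P → Q) (q : Y) {x : X} (h : x ∈ P) :
    extendMap e q x = e ⟨x, h⟩ := dif_pos h

theorem continuousOn_extendMap {P : Set X} {Q : Set Y} {e : P → Q} (he : Continuous e) (q : Y) :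
    ContinuousOn (extendMap e q) P := by
  rw [continuousOn_iff_continuous_domRestrict]
  convert continuous_subtype_val.comp he using 1
  funext x
  exact extendMap_of_mem e q x.2

theorem mapsTo_extendMap {P : Set X} {Q : Set Y} (e : P → Q) (q : Y) :
    Set.MapsTo (extendMap e q) P Q := fun x hx => by
  rw [extendMap_of_mem e q hx]
  exact (e ⟨x, hx⟩).2

theorem extendMap_extendMap {P : Set X} {Q : Set Y} (e : P ≃ Q) (p : X) (q : Y) {x : X}
    (h : x ∈ P) : extendMap e.symm p (extendMap e q x) = x := by
  rw [extendMap_of_mem e q h, extendMap_of_mem _ _ (e ⟨x, h⟩).2]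
  simp

/-- The complement of a point of a sphere is contractible. -/
theorem relEq_sphere_compl {V : Type*} [NormedAddCommGroup V] [NormedSpace ℝ V] {q : V}
    (hq : ‖q‖ = 1) :
    RelEq (chainsIn R {-q}) (chainsIn R (Metric.sphere (0 : V) 1 ∩ {q}ᶜ)) := by
  have hne : ∀ y : V, ‖y‖ = 1 → y ≠ q → ∀ t : unitInterval,
      (1 - (t : ℝ)) • y - (t : ℝ) • q ≠ 0 := by
    intro y hy hyq t h0
    have h1 := sub_eq_zero.1 h0
    have h2 := congrArg norm h1
    rw [norm_smul, norm_smul, hy, hq, mul_one, mul_one, Real.norm_of_nonneg (by linarith [t.2.2]),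
      Real.norm_of_nonneg t.2.1] at h2
    -- The segment from `y` to `-q` meets the origin only at its midpoint, and only if `y = q`.
    have h3 : (t : ℝ) = 1 / 2 := by linarith
    rw [h3] at h1
    norm_num at h1
    exact hyq h1
  have hnorm : ∀ w : V, w ≠ 0 → ‖‖w‖⁻¹ • w‖ = 1 := fun w hw => by
    rw [norm_smul, norm_inv, norm_norm, inv_mul_cancel₀ (norm_ne_zero_iff.2 hw)]
  have hqq : -q ≠ q := by
    intro h
    have h2 : (2 : ℝ) • q = 0 := by
      rw [two_smul]
      nth_rewrite 1 [← h]
      exact neg_add_cancel q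
    have : q = 0 := (smul_eq_zero.1 h2).resolve_left two_ne_zero
    rw [this, norm_zero] at hq
    exact zero_ne_one hq
  -- The straight segment from `y` to the antipode `-q`, projected radially back to the sphere.
  refine relEq_of_homotopy (fun y t => ‖(1 - (t : ℝ)) • y - (t : ℝ) • q‖⁻¹ •
    ((1 - (t : ℝ)) • y - (t : ℝ) • q)) ?_ ?_ ?_ ?_ ?_ ?_
  · rintro _ rfl
    exact ⟨by simpa using hq, hqq⟩
  · refine ContinuousOn.smul (ContinuousOn.inv₀ (Continuous.continuousOn (by fun_prop)) ?_)
      (Continuous.continuousOn (by fun_prop))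
    rintro ⟨y, t⟩ ⟨⟨hy, hyq⟩, _⟩
    exact norm_ne_zero_iff.2 (hne y (by simpa using hy) hyq t)
  · rintro y ⟨hy, _⟩
    have hy' : ‖y‖ = 1 := by simpa using hy
    simp [hy']
  · rintro y ⟨hy, _⟩
    simp [hq]
  · rintro y ⟨hy, hyq⟩ t
    have hy' : ‖y‖ = 1 := by simpa using hy
    have hw := hne y hy' hyq t
    refine ⟨by simpa using hnorm _ hw, fun h => ?_⟩
    have h' : ‖(1 - (t : ℝ)) • y - (t : ℝ) • q‖⁻¹ • ((1 - (t : ℝ)) • y - (t : ℝ) • q) = q := h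
    set s := ‖(1 - (t : ℝ)) • y - (t : ℝ) • q‖ with hs
    have hspos : 0 < s := norm_pos_iff.2 hw
    rw [inv_smul_eq_iff₀ hspos.ne'] at h'
    have h1 : (1 - (t : ℝ)) • y = (s + t) • q := by rw [add_smul, ← h']; abel
    have h2 := congrArg norm h1
    have ht0 := t.2.1
    rw [norm_smul, norm_smul, hy', hq, mul_one, mul_one, Real.norm_of_nonneg (by linarith [t.2.2]),
      Real.norm_of_nonneg (by linarith)] at h2
    rw [h2] at h1
    exact hyq (smul_right_injective V (by linarith : s + (t : ℝ) ≠ 0) h1)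
  · rintro y rfl t
    have h1 : (1 - (t : ℝ)) • -q - (t : ℝ) • q = -q := by module
    rw [h1, norm_neg, hq]
    simp

theorem mem_cubeBoundary_of_cubeRadius {d : ℕ} {x : Fin d → unitInterval}
    (hx : cubeRadius x = 1) : x ∈ cubeBoundary d := by
  by_contra h
  have h1 : ∀ i, ‖2 * (x i : ℝ) - 1‖ < 1 := by
    intro i
    have h0 := (x i).2.1
    have h1 := (x i).2.2
    have h2 : (x i : ℝ) ≠ 0 := fun h' => h ⟨i, Or.inl (Subtype.ext h')⟩
    have h3 : (x i : ℝ) ≠ 1 := fun h' => h ⟨i, Or.inr (Subtype.ext h')⟩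
    have h4 := h0.lt_of_ne' h2
    have h5 := h1.lt_of_ne h3
    rw [Real.norm_eq_abs, abs_lt]
    constructor <;> linarith
  exact absurd hx ((pi_norm_lt_iff (x := fun i => 2 * (x i : ℝ) - 1) one_pos).2 h1).ne

/-- The boundary of the cube is homeomorphic to the sphere. -/
theorem exists_homeomorph_cubeBoundary_sphere (d : ℕ) :
    Nonempty (cubeBoundary d ≃ₜ Metric.sphere (0 : EuclideanSpace ℝ (Fin d)) 1) := by
  let w : (Fin d → unitInterval) → EuclideanSpace ℝ (Fin d) :=
    fun x => WithLp.toLp 2 fun i => 2 * (x i : ℝ) - 1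
  have hw : Continuous w := by
    refine (PiLp.continuous_toLp 2 fun _ : Fin d => ℝ).comp ?_
    fun_prop
  have hw0 : ∀ x ∈ cubeBoundary d, w x ≠ 0 := by
    intro x hx h
    have h1 := cubeRadius_eq_one hx
    have h2 : (fun i => 2 * (x i : ℝ) - 1) = 0 := funext fun i => congrArg (fun v => v.ofLp i) h
    rw [cubeRadius, h2, norm_zero] at h1
    exact zero_ne_one h1
  -- Radial projection from the centre of the cube. The inverse rescales by the sup norm;
  -- compactness spares the proof of its continuity.
  let f : cubeBoundary d → Metric.sphere (0 : EuclideanSpace ℝ (Fin d)) 1 := fun x =>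
    ⟨‖w x‖⁻¹ • w x, by
      rw [mem_sphere_zero_iff_norm, norm_smul, norm_inv, norm_norm,
        inv_mul_cancel₀ (norm_ne_zero_iff.2 (hw0 x x.2))]⟩
  have hf : Continuous f := by
    have hw' : Continuous fun x : cubeBoundary d => w x := hw.comp continuous_subtype_val
    exact Continuous.subtype_mk
      ((hw'.norm.inv₀ fun x => norm_ne_zero_iff.2 (hw0 x x.2)).smul hw') _
  have hinj : Function.Injective f := by
    intro x y hxy
    have h1 : ‖w x‖⁻¹ • w x = ‖w y‖⁻¹ • w y := congrArg Subtype.val hxy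
    have hx0 := norm_pos_iff.2 (hw0 x x.2)
    have hy0 := norm_pos_iff.2 (hw0 y y.2)
    set a := ‖w x‖⁻¹ with ha
    set b := ‖w y‖⁻¹ with hb
    have ha0 : 0 < a := inv_pos.2 hx0
    have hb0 : 0 < b := inv_pos.2 hy0
    have h2 : ∀ i, a * (2 * ((x : Fin d → unitInterval) i : ℝ) - 1) =
        b * (2 * ((y : Fin d → unitInterval) i : ℝ) - 1) := fun i =>
      congrArg (fun v => v.ofLp i) h1
    have h3 : a • (fun i => 2 * ((x : Fin d → unitInterval) i : ℝ) - 1) =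
        b • (fun i => 2 * ((y : Fin d → unitInterval) i : ℝ) - 1) := funext h2
    have h4 := congrArg norm h3
    rw [norm_smul, norm_smul] at h4
    have h5 := cubeRadius_eq_one x.2
    have h6 := cubeRadius_eq_one y.2
    unfold cubeRadius at h5 h6
    rw [h5, h6, mul_one, mul_one, Real.norm_of_nonneg ha0.le, Real.norm_of_nonneg hb0.le] at h4
    refine Subtype.ext (funext fun i => Subtype.ext ?_)
    have := h2 i
    rw [h4] at this
    linarith [mul_left_cancel₀ hb0.ne' this]
  have hsurj : Function.Surjective f := by
    rintro ⟨y, hy⟩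
    rw [mem_sphere_zero_iff_norm] at hy
    set s : ℝ := ‖(fun i => y i : Fin d → ℝ)‖ with hs
    have hy0 : y ≠ 0 := by rintro rfl; rw [norm_zero] at hy; exact zero_ne_one hy
    have hs0 : 0 < s := by
      refine norm_pos_iff.2 fun h => hy0 ?_
      ext i
      exact congrFun h i
    have hle : ∀ i, |y i| ≤ s := fun i => norm_le_pi_norm (fun i => y i : Fin d → ℝ) i
    let x : Fin d → unitInterval := fun i => ⟨(1 + y i / s) / 2, by
      have h1 : |y i / s| ≤ 1 := by
        rw [abs_div, abs_of_pos hs0]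
        exact div_le_one_of_le₀ (hle i) hs0.le
      rw [abs_le] at h1
      constructor <;> linarith [h1.1, h1.2]⟩
    have hx : (fun i => 2 * (x i : ℝ) - 1) = s⁻¹ • (fun i => y i : Fin d → ℝ) := by
      funext i
      simp only [x, Pi.smul_apply, smul_eq_mul]
      ring
    have hxb : x ∈ cubeBoundary d := by
      refine mem_cubeBoundary_of_cubeRadius ?_
      rw [cubeRadius, hx, norm_smul, norm_inv, Real.norm_of_nonneg hs0.le, ← hs,
        inv_mul_cancel₀ hs0.ne']
    refine ⟨⟨x, hxb⟩, Subtype.ext ?_⟩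
    have hwx : w x = s⁻¹ • y := by
      ext i
      exact congrFun hx i
    change ‖w x‖⁻¹ • w x = y
    rw [hwx, norm_smul, hy, mul_one, norm_inv, Real.norm_of_nonneg hs0.le, inv_inv, smul_smul,
      mul_inv_cancel₀ hs0.ne', one_smul]
  have : CompactSpace (cubeBoundary d) :=
    isCompact_iff_compactSpace.1 (isCellAttachment_id d).isClosed.isCompact
  exact ⟨Continuous.homeoOfEquivCompactToT2 (f := Equiv.ofBijective f ⟨hinj, hsurj⟩) hf⟩

end Transport

/-! ### Simplicial homology -/

section Simplicial

variable {R : Type*} [CommRing R] {m : ℕ}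

/-- The cubes of distinct nonempty simplices are independent modulo degenerate cubes. The empty
simplex is excluded because its coefficient is invisible to singular chains. -/
theorem eq_zero_of_simplexChain_mem {ξ : Finset (Fin m) →₀ R}
    (h : simplexChain R ξ ∈ degenerate R (Fin m → ℝ)) {J : Finset (Fin m)} (hJ : J ≠ ∅) :
    ξ J = 0 := by
  classical
  have hdec := simplexDecomposition (m := m) (S := Finset.univ.filter Finset.Nonempty)
    (fun I hI => (Finset.mem_filter.1 hI).2) (fun I _ J _ hJ => by simpa using hJ)
  have h0 : simplexChain R (ξ.erase ∅) = simplexChain R ξ := by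
    conv_rhs => rw [← Finsupp.single_add_erase ∅ ξ, map_add]
    rw [simplexChain, Finsupp.linearCombination_single, if_pos rfl, smul_zero, zero_add]
  have h1 := hdec.eq_zero_of_mem_degenerate (ξ := ξ.erase ∅) (R := R) (by
    rw [Finsupp.mem_supported']
    intro I hI
    have : I = ∅ := by
      by_contra hne
      exact hI (by simpa using Finset.nonempty_iff_ne_empty.2 hne)
    rw [this, Finsupp.erase_same]) (by
    rwa [← simplexChain_eq_cellCombination Finsupp.erase_same, h0])
  rw [← Finsupp.erase_ne hJ, h1, Finsupp.zero_apply]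

/-- Inherited from singular chains: at nonempty simplices from the square of the singular boundary,
at the empty one from the vanishing of the augmentation on boundaries. -/
theorem simplicialBoundary_simplicialBoundary (ξ : Finset (Fin m) →₀ R) :
    simplicialBoundary R (simplicialBoundary R ξ) = 0 := by
  have h1 := formalBoundary_simplexChain ξ
  ext J
  rw [Finsupp.zero_apply]
  rcases eq_or_ne J ∅ with rfl | hJ
  · rw [← augmentation_simplexChain]
    have h2 := augmentation_of_mem_degenerate h1
    rwa [map_sub, augmentation_formalBoundary, zero_sub, neg_eq_zero] at h2
  · refine eq_zero_of_simplexChain_mem ?_ hJ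
    have h2 := add_mem (formalBoundary_simplexChain (simplicialBoundary R ξ))
      (formalBoundary_mem_degenerate h1)
    rw [map_sub, formalBoundary_formalBoundary] at h2
    convert neg_mem h2 using 1
    abel

theorem simplicialBoundary_filter (ξ : Finset (Fin m) →₀ R) (q : ℕ) :
    simplicialBoundary R (ξ.filter fun J => J.card = q + 1) =
      (simplicialBoundary R ξ).filter fun J => J.card = q := by
  induction ξ using Finsupp.induction_linear with
  | zero => rw [Finsupp.filter_zero, map_zero, Finsupp.filter_zero]
  | add f g hf hg => rw [Finsupp.filter_add, map_add, map_add, Finsupp.filter_add, hf, hg]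
  | single I r =>
    have : Finsupp.single I r = r • Finsupp.single I (1 : R) := by simp
    ext J
    rw [this, map_smul, Finsupp.filter_apply, simplicialBoundary_single]
    by_cases hI : I.card = q + 1
    · rw [← this, Finsupp.filter_single_of_pos (fun J : Finset (Fin m) => J.card = q + 1) hI, this,
        map_smul, simplicialBoundary_single]
      split_ifs with hJ
      · rfl
      · rw [Finsupp.smul_apply, Finsupp.finsetSum_apply, Finset.sum_eq_zero, smul_zero]
        intro i hi
        rw [Finsupp.smul_apply, Finsupp.single_apply, if_neg, smul_zero]
        rintro rfl
        exact hJ (by rw [Finset.card_erase_of_mem hi, hI]; rfl)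
    · rw [← this, Finsupp.filter_single_of_neg (fun J : Finset (Fin m) => J.card = q + 1) hI,
        map_zero, Finsupp.zero_apply]
      split_ifs with hJ
      · rw [Finsupp.smul_apply, Finsupp.finsetSum_apply, Finset.sum_eq_zero, smul_zero]
        intro i hi
        rw [Finsupp.smul_apply, Finsupp.single_apply, if_neg, smul_zero]
        rintro rfl
        rw [Finset.card_erase_of_mem hi] at hJ
        have := Finset.card_pos.2 ⟨i, hi⟩
        omega
      · rfl

end Simplicial

/-! ### Top cycles and dimension of a triangulated sphere -/

section SphereComplex

variable {R : Type*} [CommRing R] {m : ℕ}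

theorem formalBoundary_simplexMap_mem_cellChains {S : Finset (Finset (Fin m))}
    (hne : ∀ I ∈ S, I.Nonempty)
    (hdown : ∀ I ∈ S, ∀ i ∈ I, (I.erase i).Nonempty → I.erase i ∈ S) {I : Finset (Fin m)}
    (hI : I ∈ S) : formalBoundary R (cube R (simplexMap (d := simplexDim I) I)) ∈
      cellChains R {J | J ∈ S ∧ simplexDim J < simplexDim I} simplexDim fun J => simplexMap J := by
  have h := formalBoundary_simplexChain (R := R) (Finsupp.single I 1)
  rw [simplexChain_single, if_neg (hne I hI).ne_empty, simplicialBoundary_single] at h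
  rw [← sub_add_cancel (formalBoundary R (cube R (simplexMap (d := simplexDim I) I)))]
  refine Submodule.add_mem_sup h ?_
  rw [map_sum]
  refine sum_mem fun i hi => ?_
  rw [map_smul, simplexChain_single]
  refine Submodule.smul_mem _ _ ?_
  split_ifs with h0
  · exact zero_mem _
  · have h1 := Finset.nonempty_iff_ne_empty.2 h0
    refine Submodule.subset_span ⟨_, ⟨hdown I hI i hi h1, ?_⟩, rfl⟩
    have := card_eq_simplexDim_add_one h1
    have := card_eq_simplexDim_add_one (hne I hI)
    rw [Finset.card_erase_of_mem hi] at *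
    omega

theorem simplexChain_mem_cellChains {S : Set (Finset (Fin m))} (hS : ∅ ∉ S)
    {ξ : Finset (Fin m) →₀ R} (hξ : ξ ∈ Finsupp.supported R R S) :
    simplexChain R ξ ∈ cellChains R S simplexDim fun J => simplexMap J := by
  refine mem_cellChains.2 ⟨ξ, hξ, ?_⟩
  rw [simplexChain_eq_cellCombination ((Finsupp.mem_supported' R _).1 hξ _ hS), sub_self]
  exact zero_mem _

theorem exists_simplexChain_of_mem_cellChains {S : Set (Finset (Fin m))} (hS : ∅ ∉ S)
    {z : FormalChain R (Fin m → ℝ)}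
    (hz : z ∈ cellChains R S simplexDim fun J : Finset (Fin m) => simplexMap J) :
    ∃ ξ ∈ Finsupp.supported R R S, z - simplexChain R ξ ∈ degenerate R (Fin m → ℝ) := by
  obtain ⟨ξ, hξ, h⟩ := mem_cellChains.1 hz
  exact ⟨ξ, hξ, by
    rwa [simplexChain_eq_cellCombination ((Finsupp.mem_supported' R _).1 hξ _ hS)]⟩

/-- The simplicial chains of a complex compute the homology of its realization. -/
theorem relEq_openSimplices {S : Finset (Finset (Fin m))} (hne : ∀ I ∈ S, I.Nonempty)
    (hdown : ∀ I ∈ S, ∀ J ⊆ I, J.Nonempty → J ∈ S) :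
    RelEq (cellChains R (S : Set (Finset (Fin m))) simplexDim fun J => simplexMap J)
      (chainsIn R (openSimplices S)) :=
  (simplexDecomposition hne hdown).relEq_cellChains fun _ hI =>
    formalBoundary_simplexMap_mem_cellChains hne
      (fun I hI _ _ h => hdown I hI _ (Finset.erase_subset _ _) h) hI

/-- If `ζ` is the boundary of a cellular chain, up to degenerate cubes, then it is the boundary of a
simplicial chain, at the nonempty simplices. -/
theorem exists_simplicialBoundary_of_relEq {S : Set (Finset (Fin m))} (hS : ∅ ∉ S)
    {B : Submodule R (FormalChain R (Fin m → ℝ))}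
    (hB : RelEq (cellChains R S simplexDim fun J => simplexMap J) B)
    {ζ : Finset (Fin m) →₀ R} (hζ : ζ ∈ Finsupp.supported R R S) {s : FormalChain R (Fin m → ℝ)}
    (hs : s ∈ B) (h : simplexChain R ζ - formalBoundary R s ∈ degenerate R (Fin m → ℝ)) :
    ∃ ξ ∈ Finsupp.supported R R S, ∀ J, J ≠ ∅ → ζ J = simplicialBoundary R ξ J := by
  obtain ⟨z', hz', t, _, hst⟩ := hB.2 s hs (by
    rw [← sub_sub_cancel (simplexChain R ζ) (formalBoundary R s)]
    exact sub_mem (simplexChain_mem_cellChains hS hζ) (Submodule.mem_sup_left h))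
  obtain ⟨ξ, hξ, hd⟩ := exists_simplexChain_of_mem_cellChains hS hz'
  refine ⟨ξ, hξ, fun J hJ => ?_⟩
  rw [← sub_eq_zero, ← Finsupp.sub_apply]
  refine eq_zero_of_simplexChain_mem ?_ hJ
  have h1 := formalBoundary_simplexChain ξ
  have h2 := formalBoundary_mem_degenerate hd
  rw [hst, map_add, formalBoundary_formalBoundary, add_zero] at h
  rw [map_sub] at h2 ⊢
  convert add_mem (add_mem h h2) h1 using 1
  abel

/-- A cycle that is homologous to a combination of `0`-cubes at a point, and whose augmentation
vanishes, is a boundary. -/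
theorem exists_of_relEq_singleton {X : Type*} [TopologicalSpace X] {a : X}
    {B : Submodule R (FormalChain R X)}
    (hB : RelEq (chainsIn R {a}) B) {z : FormalChain R X} (hz : z ∈ B)
    (hd : formalBoundary R z ∈ degenerate R X) (haug : augmentation R z = 0) :
    ∃ s ∈ B, z - formalBoundary R s ∈ degenerate R X := by
  obtain ⟨u, hu, s, hs, rfl⟩ := hB.2 z hz (degenerate_le_chainsIn _ hd)
  obtain ⟨d, hd', _, hr, rfl⟩ := Submodule.mem_sup.1 (chainsIn_singleton a hu)
  obtain ⟨r, rfl⟩ := Submodule.mem_span_singleton.1 hr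
  rw [map_add, map_add, augmentation_formalBoundary, augmentation_of_mem_degenerate hd', map_smul,
    pointChain, augmentation_cube, if_pos rfl, zero_add, add_zero, smul_eq_mul, mul_one] at haug
  subst haug
  exact ⟨s, hs, by simpa using hd'⟩

variable {S : Finset (Finset (Fin m))} {V : Type*} [NormedAddCommGroup V] [NormedSpace ℝ V]

/-- The module `B` consists of the chains of the realization without the centre `p` of the simplex
`I`. It has the homology of a point, since a sphere minus a point contracts to the antipode, and
that of the simplicial chains without `I`, by the radial homotopy. -/
theorem exists_relEq_erase (hne : ∀ I ∈ S, I.Nonempty)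
    (hdown : ∀ I ∈ S, ∀ J ⊆ I, J.Nonempty → J ∈ S)
    (e : openSimplices S ≃ₜ Metric.sphere (0 : V) 1) {I : Finset (Fin m)} (hI : I ∈ S)
    (hmax : ∀ J ∈ S, J.card ≤ I.card) :
    ∃ (a : Fin m → ℝ) (B : Submodule R (FormalChain R (Fin m → ℝ))), RelEq (chainsIn R {a}) B ∧
      RelEq (cellChains R (S.erase I : Set (Finset (Fin m))) simplexDim fun J => simplexMap J) B ∧
      pointChain R a ∈ B := by
  classical
  have hdec := simplexDecomposition hne hdown
  have hdim : ∀ J ∈ S, simplexDim J ≤ simplexDim I := fun J hJ => Nat.sub_le_sub_right (hmax J hJ) 1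
  have hatt := hdec.isCellAttachment hI hdim
  set p := simplexMap (d := simplexDim I) I (cubeCenter _) with hp
  have hpS : p ∈ openSimplices S := hdec.map_mem I hI _
  set q : V := (e ⟨p, hpS⟩).1 with hq
  have hqS : ‖q‖ = 1 := mem_sphere_zero_iff_norm.1 (e ⟨p, hpS⟩).2
  have hqS' : -q ∈ Metric.sphere (0 : V) 1 := by rwa [mem_sphere_zero_iff_norm, norm_neg]
  have hleft : ∀ x ∈ openSimplices S, extendMap e.symm 0 (extendMap e 0 x) = x := fun x hx =>
    extendMap_extendMap e.toEquiv 0 0 hx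
  have hright : ∀ y ∈ Metric.sphere (0 : V) 1, extendMap e 0 (extendMap e.symm 0 y) = y :=
    fun y hy => extendMap_extendMap e.toEquiv.symm 0 0 hy
  have hpq : extendMap e 0 p = q := extendMap_of_mem _ _ hpS
  have hqp : extendMap e.symm 0 q = p := by rw [← hpq, hleft p hpS]
  have hqq : -q ≠ q := by
    intro h
    have h2 : (2 : ℝ) • q = 0 := by
      rw [two_smul]
      nth_rewrite 1 [← h]
      exact neg_add_cancel q
    rw [(smul_eq_zero.1 h2).resolve_left two_ne_zero, norm_zero] at hqS
    exact zero_ne_one hqS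
  have ha : extendMap e.symm 0 (-q) ∈ openSimplices S ∩ {p}ᶜ :=
    ⟨mapsTo_extendMap _ _ hqS', fun h => hqq (by
      rw [← hright _ hqS', Set.mem_singleton_iff.1 h, hpq])⟩
  refine ⟨extendMap e.symm 0 (-q), chainsIn R (openSimplices S ∩ {p}ᶜ), ?_, ?_, ?_⟩
  · refine (relEq_sphere_compl (R := R) hqS).of_leftInverse (f := extendMap e 0)
      (g := extendMap e.symm 0) (Set.singleton_subset_iff.2 ha) ?_ ?_ ?_ ?_ ?_ ?_ ?_ ?_
    · exact (continuousOn_extendMap e.continuous 0).mono Set.inter_subset_left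
    · exact (continuousOn_extendMap e.symm.continuous 0).mono Set.inter_subset_left
    · rintro x ⟨hx, hxp⟩
      refine ⟨mapsTo_extendMap _ _ hx, fun h => hxp ?_⟩
      rw [Set.mem_singleton_iff, ← hleft x hx, Set.mem_singleton_iff.1 h, hqp]
    · rintro _ rfl
      exact hright _ hqS'
    · rintro y ⟨hy, hyq⟩
      refine ⟨mapsTo_extendMap _ _ hy, fun h => hyq ?_⟩
      rw [Set.mem_singleton_iff, ← hright y hy, Set.mem_singleton_iff.1 h, hpq]
    · rintro _ rfl
      rfl
    · exact Set.singleton_subset_iff.2 ⟨hqS', hqq⟩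
    · exact fun x hx => hleft x hx.1
  · refine RelEq.trans ((hdec.erase hdim).relEq_cellChains fun J hJ => ?_) hatt.relEq_compl_center
    refine formalBoundary_simplexMap_mem_cellChains
      (fun I hI => hne I (Finset.mem_of_mem_erase hI)) (fun L hL i hi h => ?_) hJ
    have hLS := Finset.mem_of_mem_erase hL
    refine Finset.mem_erase.2 ⟨fun h' => ?_, hdown L hLS _ (Finset.erase_subset _ _) h⟩
    have h1 := hmax L hLS
    have h2 := Finset.card_erase_lt_of_mem hi
    rw [h'] at h2
    omega
  · exact cube_mem_chainsIn continuous_const fun _ => ha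

/-- The chains of a simplicial sphere without an open top-dimensional simplex are acyclic. -/
theorem exists_simplicialBoundary_eq (hne : ∀ I ∈ S, I.Nonempty)
    (hdown : ∀ I ∈ S, ∀ J ⊆ I, J.Nonempty → J ∈ S)
    (e : openSimplices S ≃ₜ Metric.sphere (0 : V) 1) {I : Finset (Fin m)} (hI : I ∈ S)
    (hmax : ∀ J ∈ S, J.card ≤ I.card) {ζ : Finset (Fin m) →₀ R}
    (hζ : ζ ∈ Finsupp.supported R R (S.erase I : Set (Finset (Fin m))))
    (hd : simplicialBoundary R ζ = 0) :
    ∃ ξ ∈ Finsupp.supported R R (S.erase I : Set (Finset (Fin m))),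
      ∀ J, J ≠ ∅ → ζ J = simplicialBoundary R ξ J := by
  have hS : ∅ ∉ (S.erase I : Set (Finset (Fin m))) := fun h => by
    simpa using hne _ (Finset.mem_of_mem_erase h)
  obtain ⟨a, B, h1, h2, _⟩ := exists_relEq_erase (R := R) hne hdown e hI hmax
  obtain ⟨s, hs, h3⟩ := exists_of_relEq_singleton h1 (h2.1 (simplexChain_mem_cellChains hS hζ)) (by
    have := formalBoundary_simplexChain ζ
    rwa [hd, map_zero, sub_zero] at this) (by rw [augmentation_simplexChain, hd]; rfl)
  exact exists_simplicialBoundary_of_relEq hS h2 hζ hs h3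

/-- The point of the contractible complement is homologous to a simplicial chain without `I`, which
keeps its augmentation `1`. This handles the sphere of dimension `0`, where a second vertex must be
found. -/
theorem exists_simplicialBoundary_empty_eq_one (hne : ∀ I ∈ S, I.Nonempty)
    (hdown : ∀ I ∈ S, ∀ J ⊆ I, J.Nonempty → J ∈ S)
    (e : openSimplices S ≃ₜ Metric.sphere (0 : V) 1) {I : Finset (Fin m)} (hI : I ∈ S)
    (hmax : ∀ J ∈ S, J.card ≤ I.card) :
    ∃ ξ ∈ Finsupp.supported R R (S.erase I : Set (Finset (Fin m))),
      simplicialBoundary R ξ ∅ = 1 := by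
  have hS : ∅ ∉ (S.erase I : Set (Finset (Fin m))) := fun h => by
    simpa using hne _ (Finset.mem_of_mem_erase h)
  obtain ⟨a, B, _, h2, h3⟩ := exists_relEq_erase (R := R) hne hdown e hI hmax
  obtain ⟨z, hz, s, _, h4⟩ := h2.2 _ h3 (by
    rw [pointChain, formalBoundary_cube_zero]; exact zero_mem _)
  obtain ⟨ξ, hξ, hd⟩ := exists_simplexChain_of_mem_cellChains hS hz
  refine ⟨ξ, hξ, ?_⟩
  have h5 := congrArg (augmentation R) h4
  have h6 := augmentation_of_mem_degenerate hd
  rw [map_sub, sub_eq_zero] at h6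
  rw [map_add, augmentation_formalBoundary, add_zero, h6, pointChain, augmentation_cube,
    if_pos rfl, augmentation_simplexChain] at h5
  exact h5.symm

theorem filter_mem_supported_erase {I : Finset (Fin m)} {ξ : Finset (Fin m) →₀ R} {q : ℕ}
    (hξ : ξ ∈ Finsupp.supported R R (S.erase I : Set (Finset (Fin m)))) :
    ξ.filter (fun J => J.card = q) ∈ Finsupp.supported R R {J | J ∈ S ∧ J.card = q} := by
  rw [Finsupp.mem_supported'] at hξ ⊢
  intro J hJ
  rw [Finsupp.filter_apply]
  split_ifs with h
  · exact hξ J fun hJ' => hJ ⟨Finset.mem_of_mem_erase hJ', h⟩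
  · rfl

/-- In a simplicial sphere, every simplex of the top dimension occurs with the coefficient `1` in
a cycle. -/
theorem exists_cycle (hne : ∀ I ∈ S, I.Nonempty)
    (hdown : ∀ I ∈ S, ∀ J ⊆ I, J.Nonempty → J ∈ S)
    (e : openSimplices S ≃ₜ Metric.sphere (0 : V) 1) {I : Finset (Fin m)} (hI : I ∈ S)
    (hmax : ∀ J ∈ S, J.card ≤ I.card) :
    ∃ ζ ∈ Finsupp.supported R R {J | J ∈ S ∧ J.card = I.card},
      simplicialBoundary R ζ = 0 ∧ ζ I = 1 := by
  -- The boundary of `I` must bound a chain that avoids `I`; the difference of `I` and that chain is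
  -- the cycle.
  suffices h : ∃ ξ ∈ Finsupp.supported R R (S.erase I : Set (Finset (Fin m))),
      simplicialBoundary R (ξ.filter fun J => J.card = I.card) =
        simplicialBoundary R (Finsupp.single I 1) by
    obtain ⟨ξ, hξ, h⟩ := h
    refine ⟨Finsupp.single I 1 - ξ.filter fun J => J.card = I.card,
      sub_mem (Finsupp.single_mem_supported R _ ⟨hI, rfl⟩) (filter_mem_supported_erase hξ),
      by rw [map_sub, h, sub_self], ?_⟩
    rw [Finsupp.sub_apply, Finsupp.single_eq_same, Finsupp.filter_apply_pos (fun J : Finset (Fin m) => J.card = I.card) _ rfl,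
      (Finsupp.mem_supported' R _).1 hξ I (by simp), sub_zero]
  have hpos := (hne I hI).card_pos
  obtain ⟨q, hq⟩ : ∃ q, I.card = q + 1 := ⟨I.card - 1, by omega⟩
  rw [hq]
  have hsingle : simplicialBoundary R (Finsupp.single I 1) =
      (simplicialBoundary R (Finsupp.single I 1)).filter fun J => J.card = q := by
    rw [← simplicialBoundary_filter,
      Finsupp.filter_single_of_pos (fun J : Finset (Fin m) => J.card = q + 1) hq]
  -- For a vertex `I` the boundary is the empty simplex, about which `exists_simplicialBoundary_eq`
  -- says nothing.
  rcases Nat.eq_zero_or_pos q with rfl | hq0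
  · obtain ⟨ξ, hξ, h⟩ := exists_simplicialBoundary_empty_eq_one (R := R) hne hdown e hI hmax
    refine ⟨ξ, hξ, ?_⟩
    rw [simplicialBoundary_filter, hsingle]
    ext J
    rw [Finsupp.filter_apply, Finsupp.filter_apply]
    split_ifs with hJ
    · rw [Finset.card_eq_zero.1 hJ, h]
      obtain ⟨i, rfl⟩ := Finset.card_eq_one.1 hq
      rw [simplicialBoundary_single]
      simp [position, Finset.filter_singleton]
    · rfl
  · obtain ⟨ξ, hξ, h⟩ := exists_simplicialBoundary_eq (R := R) hne hdown e hI hmax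
      (ζ := simplicialBoundary R (Finsupp.single I 1)) (by
        rw [simplicialBoundary_single]
        refine sum_mem fun i hi => Submodule.smul_mem _ _ (Finsupp.single_mem_supported R _ ?_)
        have hc := Finset.card_erase_of_mem hi
        refine Finset.mem_coe.2 (Finset.mem_erase.2 ⟨fun h => ?_, hdown I hI _
          (Finset.erase_subset _ _) (Finset.card_pos.1 (by omega))⟩)
        rw [h] at hc
        omega) (simplicialBoundary_simplicialBoundary _)
    refine ⟨ξ, hξ, ?_⟩
    rw [simplicialBoundary_filter, hsingle]
    ext J
    rw [Finsupp.filter_apply, Finsupp.filter_apply]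
    split_ifs with hJ
    · exact (h J (by rintro rfl; rw [Finset.card_empty] at hJ; omega)).symm
    · rfl

/-- Top-dimensional cycles of a simplicial sphere are determined by one coefficient. -/
theorem cycle_eq_zero (hne : ∀ I ∈ S, I.Nonempty)
    (hdown : ∀ I ∈ S, ∀ J ⊆ I, J.Nonempty → J ∈ S)
    (e : openSimplices S ≃ₜ Metric.sphere (0 : V) 1) {I : Finset (Fin m)} (hI : I ∈ S)
    (hmax : ∀ J ∈ S, J.card ≤ I.card) {ζ : Finset (Fin m) →₀ R}
    (hζ : ζ ∈ Finsupp.supported R R {J | J ∈ S ∧ J.card = I.card})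
    (hd : simplicialBoundary R ζ = 0) (h0 : ζ I = 0) : ζ = 0 := by
  rw [Finsupp.mem_supported'] at hζ
  -- With coefficient `0` at `I` the cycle lies in the complex without `I` and bounds there; but
  -- there are no simplices of the next dimension.
  obtain ⟨ξ, hξ, h⟩ := exists_simplicialBoundary_eq (R := R) hne hdown e hI hmax (ζ := ζ) (by
    rw [Finsupp.mem_supported']
    intro J hJ
    rcases eq_or_ne J I with rfl | hJI
    · exact h0
    · exact hζ J fun h => hJ (Finset.mem_coe.2 (Finset.mem_erase.2 ⟨hJI, h.1⟩))) hd
  have h1 : ξ.filter (fun J => J.card = I.card + 1) = 0 := by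
    ext J
    rw [Finsupp.filter_apply]
    split_ifs with hJ
    · refine (Finsupp.mem_supported' R _).1 hξ J fun hJS => ?_
      have := hmax J (Finset.mem_of_mem_erase hJS)
      omega
    · rfl
  have h2 := simplicialBoundary_filter ξ I.card
  rw [h1, map_zero] at h2
  ext J
  by_cases hJ : J ∈ S ∧ J.card = I.card
  · rw [h J (hne J hJ.1).ne_empty]
    have h3 := DFunLike.congr_fun h2 J
    rw [Finsupp.filter_apply_pos (fun J : Finset (Fin m) => J.card = I.card) _ hJ.2] at h3
    exact h3.symm
  · exact hζ J hJ

/-- The dimension of a simplicial sphere. -/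
theorem card_eq_of_homeomorph (hne : ∀ I ∈ S, I.Nonempty)
    (hdown : ∀ I ∈ S, ∀ J ⊆ I, J.Nonempty → J ∈ S) {N : ℕ}
    (e : openSimplices S ≃ₜ Metric.sphere (0 : EuclideanSpace ℝ (Fin (N + 1))) 1)
    {I : Finset (Fin m)} (hI : I ∈ S) (hmax : ∀ J ∈ S, J.card ≤ I.card) : I.card = N + 1 := by
  -- Otherwise a top cycle of `K`, of dimension `q ≠ N`, is transported to the boundary of the `(N +
  -- 1)`-cube, bounds there, and is transported back as a boundary. This is impossible, as `K` has
  -- no simplices of dimension `q + 1`.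
  by_contra hcard
  obtain ⟨ζ, hζ, hd, h1⟩ := exists_cycle (R := ℤ) hne hdown e hI hmax
  obtain ⟨e'⟩ := exists_homeomorph_cubeBoundary_sphere (N + 1)
  set f := e.trans e'.symm with hf
  have hS : ∅ ∉ (S : Set (Finset (Fin m))) := fun h => by simpa using hne _ h
  have hζS : ζ ∈ Finsupp.supported ℤ ℤ (S : Set (Finset (Fin m))) :=
    Finsupp.supported_mono (fun J hJ => hJ.1) hζ
  have hrel := relEq_openSimplices (R := ℤ) hne hdown
  set z := simplexChain ℤ ζ with hz
  have hzX : z ∈ chainsIn ℤ (openSimplices S) := hrel.1 (simplexChain_mem_cellChains hS hζS)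
  have hdz : formalBoundary ℤ z ∈ degenerate ℤ _ := by
    have := formalBoundary_simplexChain ζ
    rwa [hd, map_zero, sub_zero] at this
  have haug : augmentation ℤ z = 0 := by rw [augmentation_simplexChain, hd]; rfl
  have hq := card_eq_simplexDim_add_one (hne I hI)
  set q := simplexDim I with hqdef
  have hdeg : degreePart ℤ q z = z := by
    have hζ0 : ζ ∅ = 0 := (Finsupp.mem_supported' ℤ _).1 hζS _ hS
    rw [hz, simplexChain_eq_cellCombination hζ0, degreePart_cellCombination]
    congr 1
    refine Finsupp.filter_eq_self_iff _ _ |>.2 fun J hJ => ?_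
    have hJ' : J ∈ S ∧ J.card = I.card := by
      by_contra h
      exact hJ ((Finsupp.mem_supported' ℤ _).1 hζ J h)
    have := card_eq_simplexDim_add_one (hne J hJ'.1)
    omega
  set F : (Fin m → ℝ) → (Fin (N + 1) → unitInterval) := extendMap f 0 with hF
  set G : (Fin (N + 1) → unitInterval) → (Fin m → ℝ) := extendMap f.symm 0 with hG
  have hFc := continuousOn_extendMap f.continuous (0 : Fin (N + 1) → unitInterval)
  have hGc := continuousOn_extendMap f.symm.continuous (0 : Fin m → ℝ)
  have hFz := push_mem_chainsIn hFc (mapsTo_extendMap f 0) hzX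
  have hdFz : formalBoundary ℤ (push ℤ F z) ∈ degenerate ℤ _ := by
    rw [← push_formalBoundary]; exact push_mem_degenerate _ hdz
  obtain ⟨s, hs, h2⟩ : ∃ s ∈ chainsIn ℤ (cubeBoundary (N + 1)),
      push ℤ F z - formalBoundary ℤ s ∈ degenerate ℤ _ := by
    -- The boundary of the cube consists of the contractible box and the lid, which has dimension
    -- `N`. Hence the lid disappears from the part of degree `q`; for `q = 0` the vanishing
    -- augmentation finishes the argument.
    obtain ⟨_, hu, s, hs, h3⟩ := (cubeRelEq ℤ N).relEq_cubeBoundary.2 _ hFz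
      (Submodule.mem_sup_left (degenerate_le_chainsIn _ hdFz))
    obtain ⟨j, hj, _, hr, rfl⟩ := Submodule.mem_sup.1 hu
    obtain ⟨r, rfl⟩ := Submodule.mem_span_singleton.1 hr
    have h4 := congrArg (degreePart ℤ q) h3
    rw [degreePart_push, hdeg, map_add, map_add, map_smul, degreePart_cube,
      if_neg (by omega), smul_zero, add_zero, degreePart_formalBoundary] at h4
    have h5 := congrArg (formalBoundary ℤ) h4
    rw [map_add, formalBoundary_formalBoundary, add_zero] at h5
    have h6 := congrArg (augmentation ℤ) h4
    rw [augmentation_push, haug, map_add, augmentation_formalBoundary, add_zero] at h6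
    obtain ⟨t, ht, h7⟩ := exists_of_relEq_singleton (relEq_zero_cubeBox (R := ℤ) N)
      (degreePart_mem_chainsIn q hj) (h5 ▸ hdFz) h6.symm
    refine ⟨t + degreePart ℤ (q + 1) s, add_mem
      (chainsIn_mono (isCellAttachment_cubeLid N).subset ht) (degreePart_mem_chainsIn _ hs), ?_⟩
    rw [h4, map_add]
    convert h7 using 1
    abel
  have h8 := push_mem_degenerate G h2
  have h9 := push_congr (f := G ∘ F) (g := id)
    (fun x hx => extendMap_extendMap f.toEquiv 0 0 hx) hzX
  rw [push_id, ← push_push] at h9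
  rw [map_sub, push_formalBoundary] at h8
  obtain ⟨ξ, hξ, h10⟩ := exists_simplicialBoundary_of_relEq hS hrel hζS
    (push_mem_chainsIn hGc (mapsTo_extendMap f.symm 0) hs) (by
      convert sub_mem h8 h9 using 1
      abel)
  have h11 : ξ.filter (fun J => J.card = I.card + 1) = 0 := by
    ext J
    rw [Finsupp.filter_apply]
    split_ifs with hJ
    · refine (Finsupp.mem_supported' ℤ _).1 hξ J fun hJS => ?_
      have := hmax J hJS
      omega
    · rfl
  have h12 := simplicialBoundary_filter ξ I.card
  rw [h11, map_zero] at h12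
  have h13 := DFunLike.congr_fun h12 I
  rw [Finsupp.filter_apply_pos (fun J : Finset (Fin m) => J.card = I.card) _ rfl, ← h10 I
    (hne I hI).ne_empty, h1] at h13
  exact zero_ne_one h13

end SphereComplex

/-! ### Simplicial spheres -/

section IsSimplicialSphere

variable {R : Type*} [CommRing R] {m n : ℕ} {K : AbstractSimplicialComplex (Fin m)}

open Classical in
/-- The finite set of the nonempty simplices of `K`. -/
noncomputable def simplices (K : AbstractSimplicialComplex (Fin m)) : Finset (Finset (Fin m)) :=
  Finset.univ.filter (· ∈ K)

theorem mem_simplices {I : Finset (Fin m)} : I ∈ simplices K ↔ I ∈ K := by simp [simplices]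

theorem nonempty_of_mem_simplices : ∀ I ∈ simplices K, I.Nonempty := fun _ hI =>
  (K.isRelLowerSet_faces (mem_simplices.1 hI)).1

theorem mem_simplices_of_subset : ∀ I ∈ simplices K, ∀ J ⊆ I, J.Nonempty → J ∈ simplices K :=
  fun _ hI _ hJI hJ => mem_simplices.2 ((K.isRelLowerSet_faces (mem_simplices.1 hI)).2 hJI hJ)

theorem IsSimplex.subset {I J : Finset (Fin m)} (hI : IsSimplex K I) (hJ : J ⊆ I) :
    IsSimplex K J := by
  rcases J.eq_empty_or_nonempty with h | h
  · exact Or.inl h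
  · rcases hI with rfl | hI
    · exact Or.inl (Finset.subset_empty.1 hJ)
    · exact Or.inr ((K.isRelLowerSet_faces hI).2 hJ h)

theorem openSimplices_simplices : openSimplices (simplices K) = realization K := by
  ext y
  simp only [openSimplices, realization, Set.mem_ofPred_eq, mem_simplices, carrier]

/-- The unit sphere of the zero space is empty, whereas each vertex is a point of the realization.
-/
theorem IsSimplicialSphere.eq_zero (hK : IsSimplicialSphere K 0) : m = 0 := by
  obtain ⟨e⟩ := hK
  by_contra hm
  let i : Fin m := ⟨0, Nat.pos_of_ne_zero hm⟩
  have hx : (Pi.single i 1 : Fin m → ℝ) ∈ realization K := by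
    refine ⟨single_mem_stdSimplex ℝ i, ?_⟩
    have : Finset.univ.filter (fun j => (Pi.single i 1 : Fin m → ℝ) j ≠ 0) = {i} := by
      ext j
      rcases eq_or_ne j i with rfl | h
      · simp
      · simp [h]
    rw [this]
    exact K.singleton_mem i
  have h := (e ⟨_, hx⟩).2
  rw [mem_sphere_zero_iff_norm, Subsingleton.elim (e ⟨_, hx⟩ : EuclideanSpace ℝ (Fin 0)) 0,
    norm_zero] at h
  exact zero_ne_one h

theorem IsSimplicialSphere.exists_mem (hK : IsSimplicialSphere K (n + 1)) :
    ∃ I ∈ simplices K, ∀ J ∈ simplices K, J.card ≤ I.card := by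
  obtain ⟨e⟩ := hK
  have hne : (Metric.sphere (0 : EuclideanSpace ℝ (Fin (n + 1))) 1).Nonempty :=
    NormedSpace.sphere_nonempty.2 zero_le_one
  obtain ⟨y, hy⟩ := hne
  refine Finset.exists_max_image _ _ ⟨carrier (e.symm ⟨y, hy⟩), ?_⟩
  have : (e.symm ⟨y, hy⟩ : Fin m → ℝ) ∈ openSimplices (simplices K) := by
    rw [openSimplices_simplices]
    exact (e.symm ⟨y, hy⟩).2
  exact this.2

/-- The homeomorphism with the sphere. -/
noncomputable def IsSimplicialSphere.homeomorph (hK : IsSimplicialSphere K n) :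
    openSimplices (simplices K) ≃ₜ Metric.sphere (0 : EuclideanSpace ℝ (Fin n)) 1 :=
  (Homeomorph.setCongr openSimplices_simplices).trans hK.some

theorem IsSimplicialSphere.card_le (hK : IsSimplicialSphere K n) {I : Finset (Fin m)}
    (hI : IsSimplex K I) : I.card ≤ n := by
  rcases hI with rfl | hI
  · simp
  cases n with
  | zero =>
    obtain rfl := hK.eq_zero
    exact Finset.card_le_univ I
  | succ n =>
    obtain ⟨J, hJ, hmax⟩ := hK.exists_mem
    rw [← card_eq_of_homeomorph nonempty_of_mem_simplices mem_simplices_of_subset hK.homeomorph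
      hJ hmax]
    exact hmax I (mem_simplices.2 hI)

theorem IsSimplicialSphere.exists_card_eq (hK : IsSimplicialSphere K n) :
    ∃ I, IsSimplex K I ∧ I.card = n := by
  cases n with
  | zero => exact ⟨∅, Or.inl rfl, rfl⟩
  | succ n =>
    obtain ⟨J, hJ, hmax⟩ := hK.exists_mem
    exact ⟨J, Or.inr (mem_simplices.1 hJ), card_eq_of_homeomorph nonempty_of_mem_simplices
      mem_simplices_of_subset hK.homeomorph hJ hmax⟩

theorem IsSimplicialSphere.setOf_simplex (I : Finset (Fin m)) (hI : I.Nonempty) :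
    {J | IsSimplex K J ∧ J.card = I.card} = {J | J ∈ simplices K ∧ J.card = I.card} := by
  ext J
  simp only [Set.mem_ofPred_eq, IsSimplex, mem_simplices]
  refine and_congr_left fun h => or_iff_right ?_
  rintro rfl
  have := hI.card_pos
  simp only [Finset.card_empty] at h
  omega

theorem IsSimplicialSphere.exists_cycle (hK : IsSimplicialSphere K n) {I : Finset (Fin m)}
    (hI : IsSimplex K I) (hn : I.card = n) :
    ∃ ζ ∈ Finsupp.supported R R {J | IsSimplex K J ∧ J.card = n},
      simplicialBoundary R ζ = 0 ∧ ζ I = 1 := by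
  cases n with
  | zero =>
    obtain rfl := Finset.card_eq_zero.1 hn
    exact ⟨Finsupp.single ∅ 1, Finsupp.single_mem_supported R _ ⟨hI, rfl⟩, by
      rw [simplicialBoundary_single, Finset.sum_empty], Finsupp.single_eq_same⟩
  | succ n =>
    have hne : I.Nonempty := Finset.card_pos.1 (by omega)
    have hIK := hI.resolve_left hne.ne_empty
    rw [← hn, setOf_simplex I hne]
    exact MomentAngle.exists_cycle nonempty_of_mem_simplices mem_simplices_of_subset hK.homeomorph
      (mem_simplices.2 hIK) fun J hJ => hn ▸ hK.card_le (Or.inr (mem_simplices.1 hJ))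

theorem IsSimplicialSphere.cycle_eq_zero (hK : IsSimplicialSphere K n) {I : Finset (Fin m)}
    (hI : IsSimplex K I) (hn : I.card = n) {ζ : Finset (Fin m) →₀ R}
    (hζ : ζ ∈ Finsupp.supported R R {J | IsSimplex K J ∧ J.card = n})
    (hd : simplicialBoundary R ζ = 0) (h0 : ζ I = 0) : ζ = 0 := by
  cases n with
  | zero =>
    obtain rfl := Finset.card_eq_zero.1 hn
    ext J
    by_cases hJ : J = ∅
    · rw [hJ, h0]; rfl
    · exact (Finsupp.mem_supported' R _).1 hζ J fun h => hJ (Finset.card_eq_zero.1 h.2)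
  | succ n =>
    have hne : I.Nonempty := Finset.card_pos.1 (by omega)
    have hIK := hI.resolve_left hne.ne_empty
    rw [← hn, setOf_simplex I hne] at hζ
    exact MomentAngle.cycle_eq_zero nonempty_of_mem_simplices mem_simplices_of_subset hK.homeomorph
      (mem_simplices.2 hIK) (fun J hJ => hn ▸ hK.card_le (Or.inr (mem_simplices.1 hJ))) hζ hd h0

end IsSimplicialSphere

/-! ### Cells of products of discs -/

/-- The types of the cells of the disc: the point `1`, the centre, the open radius from the centre
to `1`, the circle without `1`, and the rest of the open disc. -/
inductive DiscCell
  | point | center | radius | circle | disc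
  deriving DecidableEq

namespace DiscCell

instance : Fintype DiscCell :=
  ⟨{point, center, radius, circle, disc}, fun f => by cases f <;> decide⟩

/-- The dimension of a cell of the disc. -/
def dim : DiscCell → ℕ
  | point => 0
  | center => 0
  | radius => 1
  | circle => 1
  | disc => 2

/-- The parametrization of a cell of the disc. -/
noncomputable def map : DiscCell → (ℕ → ℝ) → ℂ
  | point, _ => 1
  | center, _ => 0
  | radius, c => c 0
  | circle, c => circlePoint (c 0)
  | disc, c => c 0 * circlePoint (c 1)

/-- The cells in the interior of the disc. -/
def IsInner : DiscCell → Prop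
  | point => False
  | circle => False
  | _ => True

instance : DecidablePred IsInner := fun f => by
  cases f <;> unfold IsInner <;> infer_instance

open Classical in
/-- The cell of the disc that contains a point. -/
noncomputable def of (z : ℂ) : DiscCell :=
  if z = 1 then point else if z = 0 then center else if ‖z‖ = 1 then circle
  else if z = (‖z‖ : ℂ) then radius else disc

theorem circlePoint_zero : circlePoint 0 = 1 := by simp [circlePoint]

theorem circlePoint_one : circlePoint 1 = 1 := by
  rw [circlePoint, Complex.ofReal_one, mul_one, Complex.exp_two_pi_mul_I]

theorem circlePoint_eq_iff {s t : ℝ} : circlePoint s = circlePoint t ↔ ∃ n : ℤ, s = t + n := by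
  have h : (2 * Real.pi * Complex.I : ℂ) ≠ 0 := Complex.two_pi_I_ne_zero
  unfold circlePoint
  rw [Complex.exp_eq_exp_iff_exists_int]
  refine exists_congr fun n => ⟨fun hn => ?_, fun hn => ?_⟩
  · have : (2 * Real.pi * Complex.I : ℂ) * s = (2 * Real.pi * Complex.I) * (t + n) := by
      linear_combination hn
    exact_mod_cast mul_left_cancel₀ h this
  · rw [hn]
    push_cast
    ring

theorem circlePoint_injOn : Set.InjOn circlePoint (Set.Ioo 0 1) := by
  intro s hs t ht h
  obtain ⟨n, hn⟩ := circlePoint_eq_iff.1 h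
  have h1 : (-1 : ℝ) < n := by linarith [hs.1, ht.2]
  have h2 : (n : ℝ) < 1 := by linarith [hs.2, ht.1]
  have h1' : -1 < n := by exact_mod_cast h1
  have h2' : n < 1 := by exact_mod_cast h2
  obtain rfl : n = 0 := by omega
  simpa using hn

theorem circlePoint_ne_one {t : ℝ} (ht : t ∈ Set.Ioo (0 : ℝ) 1) : circlePoint t ≠ 1 := by
  intro h
  rw [← circlePoint_zero] at h
  obtain ⟨n, hn⟩ := circlePoint_eq_iff.1 h
  rw [zero_add] at hn
  rw [hn] at ht
  have h1 : 0 < n := by exact_mod_cast ht.1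
  have h2 : n < 1 := by exact_mod_cast ht.2
  omega

theorem exists_circlePoint_eq {z : ℂ} (hz : ‖z‖ = 1) :
    ∃ t ∈ Set.Icc (0 : ℝ) 1, circlePoint t = z := by
  refine ⟨Int.fract (z.arg / (2 * Real.pi)), ⟨Int.fract_nonneg _, (Int.fract_lt_one _).le⟩, ?_⟩
  have h1 : circlePoint (z.arg / (2 * Real.pi)) = z := by
    conv_rhs => rw [← Complex.norm_mul_exp_arg_mul_I z, hz]
    have : (Real.pi : ℂ) ≠ 0 := by exact_mod_cast Real.pi_ne_zero
    rw [circlePoint, Complex.ofReal_one, one_mul]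
    congr 1
    push_cast
    field_simp
  conv_rhs => rw [← h1]
  refine circlePoint_eq_iff.2 ⟨-⌊z.arg / (2 * Real.pi)⌋, ?_⟩
  rw [Int.fract]
  push_cast
  ring

theorem norm_map_le (f : DiscCell) {c : ℕ → ℝ} (hc : ∀ q, c q ∈ Set.Icc (0 : ℝ) 1) :
    ‖f.map c‖ ≤ 1 := by
  have h : |c 0| ≤ 1 := abs_le.2 ⟨by linarith [(hc 0).1], (hc 0).2⟩
  cases f <;> simp [map, norm_circlePoint, h]

theorem isInner_of_iff {z : ℂ} : (of z).IsInner ↔ ‖z‖ ≠ 1 := by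
  unfold of
  split_ifs with h1 h2 h3 h4
  · simp [IsInner, h1]
  · simp [IsInner, h2]
  · simp [IsInner, h3]
  · simp [IsInner, h3]
  · simp [IsInner, h3]

theorem norm_map_of_not_isInner {f : DiscCell} (hf : ¬ f.IsInner) (c : ℕ → ℝ) : ‖f.map c‖ = 1 := by
  cases f <;> simp [IsInner] at hf <;> simp [map, norm_circlePoint]

theorem map_of (z : ℂ) (hz : ‖z‖ ≤ 1) :
    ∃ c : ℕ → ℝ, (∀ q, c q ∈ Set.Icc (0 : ℝ) 1) ∧ (of z).map c = z := by
  unfold of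
  split_ifs with h1 h2 h3 h4
  · exact ⟨fun _ => 0, by simp, h1.symm⟩
  · exact ⟨fun _ => 0, by simp, h2.symm⟩
  · obtain ⟨t, ht, rfl⟩ := exists_circlePoint_eq h3
    exact ⟨fun _ => t, fun _ => ht, rfl⟩
  · exact ⟨fun _ => ‖z‖, fun _ => ⟨norm_nonneg _, hz⟩, h4.symm⟩
  · have hn : (‖z‖ : ℂ) ≠ 0 := by exact_mod_cast norm_ne_zero_iff.2 h2
    obtain ⟨t, ht, h⟩ := exists_circlePoint_eq (z := z / ‖z‖) (by
      rw [norm_div, Complex.norm_real, norm_norm, div_self (norm_ne_zero_iff.2 h2)])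
    refine ⟨fun q => if q = 0 then ‖z‖ else t, fun q => ?_, ?_⟩
    · dsimp only
      split_ifs
      · exact ⟨norm_nonneg _, hz⟩
      · exact ht
    · simp only [map, if_pos, if_neg one_ne_zero, h]
      rw [mul_div_cancel₀ _ hn]

theorem of_map {f : DiscCell} {c : ℕ → ℝ} (hc : ∀ q < f.dim, c q ∈ Set.Ioo (0 : ℝ) 1) :
    of (f.map c) = f := by
  cases f
  · simp [map, of]
  · simp [map, of]
  · have h := hc 0 (by decide)
    have h1 : (c 0 : ℂ) ≠ 1 := by exact_mod_cast h.2.ne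
    have h2 : (c 0 : ℂ) ≠ 0 := by exact_mod_cast h.1.ne'
    have h3 : ‖(c 0 : ℂ)‖ = c 0 := by rw [Complex.norm_real, Real.norm_of_nonneg h.1.le]
    change of (c 0 : ℂ) = radius
    unfold of
    rw [if_neg h1, if_neg h2, h3, if_neg h.2.ne, if_pos rfl]
  · have h := hc 0 (by decide)
    change of (circlePoint (c 0)) = circle
    unfold of
    rw [if_neg (circlePoint_ne_one h), if_neg, if_pos (norm_circlePoint _)]
    intro h0
    have := norm_circlePoint (c 0)
    rw [h0, norm_zero] at this
    exact zero_ne_one this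
  · have h := hc 0 (by decide)
    have h' := hc 1 (by decide)
    have h3 : ‖(c 0 : ℂ) * circlePoint (c 1)‖ = c 0 := by
      rw [norm_mul, Complex.norm_real, Real.norm_of_nonneg h.1.le, norm_circlePoint, mul_one]
    have h2 : (c 0 : ℂ) ≠ 0 := by exact_mod_cast h.1.ne'
    change of ((c 0 : ℂ) * circlePoint (c 1)) = disc
    unfold of
    rw [h3, if_neg fun h0 => ?_, if_neg fun h0 => ?_, if_neg h.2.ne, if_neg fun h0 => ?_]
    · exact circlePoint_ne_one h' (mul_left_cancel₀ h2 (by rw [h0, mul_one]))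
    · rw [h0, norm_zero] at h3
      exact h.1.ne h3
    · rw [h0, norm_one] at h3
      exact h.2.ne h3.symm

theorem map_inj {f : DiscCell} {c c' : ℕ → ℝ} (hc : ∀ q < f.dim, c q ∈ Set.Ioo (0 : ℝ) 1)
    (hc' : ∀ q < f.dim, c' q ∈ Set.Ioo (0 : ℝ) 1) (h : f.map c = f.map c') :
    ∀ q < f.dim, c q = c' q := by
  intro q hq
  cases f <;> simp only [dim, Nat.not_lt_zero] at hq hc hc'
  · obtain rfl : q = 0 := by omega
    simpa [map] using h
  · obtain rfl : q = 0 := by omega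
    exact circlePoint_injOn (hc 0 hq) (hc' 0 hq) h
  · have h0 : c 0 = c' 0 := by
      have := congrArg norm h
      simpa only [map, norm_mul, Complex.norm_real, norm_circlePoint, mul_one,
        Real.norm_of_nonneg (hc 0 two_pos).1.le, Real.norm_of_nonneg (hc' 0 two_pos).1.le] using this
    have h2 : (c' 0 : ℂ) ≠ 0 := by exact_mod_cast (hc' 0 two_pos).1.ne'
    have h1 : c 1 = c' 1 := circlePoint_injOn (hc 1 one_lt_two) (hc' 1 one_lt_two) (by
      rw [map, map, h0] at h
      exact mul_left_cancel₀ h2 h)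
    interval_cases q
    · exact h0
    · exact h1

theorem dim_of_le_one {z : ℂ} (h : ‖z‖ = 1 ∨ z = ‖z‖) : (of z).dim ≤ 1 := by
  unfold of
  split_ifs with h1 h2 h3 h4
  · simp [dim]
  · simp [dim]
  · simp [dim]
  · simp [dim]
  · exact absurd h (by tauto)

/-- This is why the disc has five cells. In polar coordinates the sides `t = 0` and `t = 1` of the
square go to the radius and the side `s = 0` to the centre, so these have to be cells too for the
boundary to lie in lower dimensional cells. -/
theorem dim_of_map_lt {f : DiscCell} {c : ℕ → ℝ} (hc : ∀ q, c q ∈ Set.Icc (0 : ℝ) 1)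
    (h : ∃ q < f.dim, c q = 0 ∨ c q = 1) : (of (f.map c)).dim < f.dim := by
  obtain ⟨q, hq, h⟩ := h
  cases f <;> simp only [dim, Nat.not_lt_zero] at hq
  · obtain rfl : q = 0 := by omega
    rcases h with h | h <;> simp [map, of, h, dim]
  · obtain rfl : q = 0 := by omega
    rcases h with h | h <;> simp [map, of, h, dim, circlePoint_zero, circlePoint_one]
  · refine Nat.lt_succ_of_le (dim_of_le_one ?_)
    have h3 : ‖(c 0 : ℂ) * circlePoint (c 1)‖ = c 0 := by
      rw [norm_mul, Complex.norm_real, Real.norm_of_nonneg (hc 0).1, norm_circlePoint, mul_one]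
    rw [map, h3]
    interval_cases q
    · rcases h with h | h
      · right; simp [h]
      · left; exact h
    · right
      rcases h with h | h <;> simp [h, circlePoint_zero, circlePoint_one]

theorem dim_of_map_le {f : DiscCell} {c : ℕ → ℝ} (hc : ∀ q, c q ∈ Set.Icc (0 : ℝ) 1) :
    (of (f.map c)).dim ≤ f.dim := by
  by_cases h : ∃ q < f.dim, c q = 0 ∨ c q = 1
  · exact (dim_of_map_lt hc h).le
  · push Not at h
    rw [of_map fun q hq => ⟨(hc q).1.lt_of_ne' (h q hq).1, (hc q).2.lt_of_ne (h q hq).2⟩]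

theorem continuous_map (f : DiscCell) {X : Type*} [TopologicalSpace X] {c : ℕ → X → ℝ}
    (hc : ∀ q, Continuous (c q)) : Continuous fun x => f.map fun q => c q x := by
  have h0 := hc 0
  have h1 := hc 1
  cases f <;> unfold map <;> (try unfold circlePoint) <;> fun_prop

theorem map_congr {f : DiscCell} {c c' : ℕ → ℝ} (h : ∀ q < f.dim, c q = c' q) :
    f.map c = f.map c' := by
  cases f <;> simp only [dim] at h <;> simp [map, h]

end DiscCell

/-! ### The cell decomposition of the moment-angle complex -/

section ProductCells

variable {m : ℕ}

/-- The sum of the terms before the `a`-th one. -/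
def partialSum (f : Fin m → ℕ) (a : Fin m) : ℕ := ∑ b ∈ Finset.univ.filter (· < a), f b

/-- The coordinates of a product cube are pairs of a factor and a coordinate of that factor; this
locates such a pair in the linear order used by `offset`. -/
theorem finSigmaFinEquiv_eq_partialSum (f : Fin m → ℕ) (a : Fin m) (q : Fin (f a)) :
    (finSigmaFinEquiv ⟨a, q⟩ : ℕ) = partialSum f a + q := by
  rw [finSigmaFinEquiv_apply, partialSum]
  congr 1
  refine Finset.sum_bij (fun i _ => Fin.castLE a.2.le i) ?_ ?_ ?_ ?_
  · intro i _
    simp only [Finset.mem_filter, Finset.mem_univ, true_and, Fin.lt_def, Fin.val_castLE]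
    exact i.2
  · intro i _ j _ h
    exact Fin.castLE_injective _ h
  · intro b hb
    simp only [Finset.mem_filter, Finset.mem_univ, true_and] at hb
    exact ⟨⟨b, hb⟩, Finset.mem_univ _, rfl⟩
  · intro i _
    rfl

theorem partialSum_add_lt {f : Fin m → ℕ} {a : Fin m} {q : ℕ} (hq : q < f a) :
    partialSum f a + q < ∑ b, f b := by
  have := (finSigmaFinEquiv (⟨a, ⟨q, hq⟩⟩ : (i : Fin m) × Fin (f i))).2
  rwa [finSigmaFinEquiv_eq_partialSum] at this

theorem exists_partialSum_add_eq {f : Fin m → ℕ} {p : ℕ} (hp : p < ∑ b, f b) :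
    ∃ a, ∃ q < f a, partialSum f a + q = p := by
  obtain ⟨⟨a, q⟩, h⟩ := finSigmaFinEquiv.surjective (⟨p, hp⟩ : Fin (∑ b, f b))
  refine ⟨a, q, q.2, ?_⟩
  rw [← finSigmaFinEquiv_eq_partialSum, h]

theorem sum_partialSum {M : Type*} [AddCommMonoid M] (f : Fin m → ℕ) {d : ℕ}
    (hd : ∑ b, f b = d) (F : ℕ → M) :
    ∑ p : Fin d, F p = ∑ a, ∑ q ∈ Finset.range (f a), F (partialSum f a + q) := by
  subst hd
  rw [← finSigmaFinEquiv.sum_comp, Fintype.sum_sigma]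
  refine Finset.sum_congr rfl fun a _ => ?_
  rw [Finset.sum_range]
  exact Finset.sum_congr rfl fun q _ => by rw [finSigmaFinEquiv_eq_partialSum]

theorem partialSum_add_le {f : Fin m → ℕ} {a b : Fin m} (h : a < b) :
    partialSum f a + f a ≤ partialSum f b := by
  have : partialSum f a + f a = ∑ c ∈ insert a (Finset.univ.filter (· < a)), f c := by
    rw [Finset.sum_insert (by simp), add_comm]
    rfl
  rw [this]
  refine Finset.sum_le_sum_of_subset fun c hc => ?_
  rcases Finset.mem_insert.1 hc with rfl | hc
  · simpa using h
  · simpa using (Finset.mem_filter.1 hc).2.trans h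

theorem partialSum_update_of_le {f : Fin m → ℕ} {a b : Fin m} (h : b ≤ a) (k : ℕ) :
    partialSum (Function.update f a k) b = partialSum f b :=
  Finset.sum_congr rfl fun c hc => by
    rw [Function.update_of_ne]
    exact ((Finset.mem_filter.1 hc).2.trans_le h).ne

theorem partialSum_update_of_lt {f : Fin m → ℕ} {a b : Fin m} (h : a < b) (k : ℕ) :
    partialSum (Function.update f a k) b + f a = partialSum f b + k := by
  unfold partialSum
  have ha : a ∈ Finset.univ.filter (· < b) := by simpa using h
  rw [← Finset.sum_erase_add _ _ ha, ← Finset.sum_erase_add _ f ha, Function.update_self,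
    Finset.sum_congr rfl fun c hc => Function.update_of_ne (Finset.ne_of_mem_erase hc) k f]
  exact add_right_comm _ _ _

/-- The dimension of a product of cells. -/
def productDim (τ : Fin m → DiscCell) : ℕ := ∑ a, (τ a).dim

/-- The number of coordinates before the `a`-th factor of a product of cells. -/
def productOffset (τ : Fin m → DiscCell) (a : Fin m) : ℕ := partialSum (fun b => (τ b).dim) a

/-- The parametrization of a product of cells. -/
noncomputable def productMap {d : ℕ} (τ : Fin m → DiscCell) (x : Fin d → unitInterval)
    (a : Fin m) : ℂ :=
  (τ a).map fun q => coord x (productOffset τ a + q)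

/-- The inner factors of a product of cells. -/
def innerSet (τ : Fin m → DiscCell) : Finset (Fin m) := Finset.univ.filter fun a => (τ a).IsInner

/-- The product cell that contains a point. -/
noncomputable def productCell (z : Fin m → ℂ) (a : Fin m) : DiscCell := DiscCell.of (z a)

variable {K : AbstractSimplicialComplex (Fin m)}

open Classical in
/-- The product cells in the moment-angle complex. -/
noncomputable def momentAngleCells (K : AbstractSimplicialComplex (Fin m)) :
    Finset (Fin m → DiscCell) :=
  Finset.univ.filter fun τ => IsSimplex K (innerSet τ)

theorem mem_momentAngleCells {τ : Fin m → DiscCell} :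
    τ ∈ momentAngleCells K ↔ IsSimplex K (innerSet τ) := by
  simp [momentAngleCells]

theorem coord_mem_Icc {d : ℕ} (x : Fin d → unitInterval) (p : ℕ) :
    coord x p ∈ Set.Icc (0 : ℝ) 1 := ⟨coord_nonneg x p, coord_le_one x p⟩

/-- The set of coordinates of norm less than `1` is the smallest possible `J` in the definition of
`momentAngle`. -/
theorem mem_momentAngle_iff {z : Fin m → ℂ} :
    z ∈ momentAngle K ↔ (∀ i, ‖z i‖ ≤ 1) ∧ productCell z ∈ momentAngleCells K := by
  rw [mem_momentAngleCells]
  refine and_congr_right fun hz => ⟨?_, fun h => ⟨_, h, fun j hj => ?_⟩⟩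
  · rintro ⟨J, hJ, h⟩
    refine hJ.subset fun i hi => ?_
    by_contra hiJ
    exact DiscCell.isInner_of_iff.1 (Finset.mem_filter.1 hi).2 (h i hiJ)
  · by_contra h'
    exact hj (Finset.mem_filter.2 ⟨Finset.mem_univ _, DiscCell.isInner_of_iff.2 h'⟩)

theorem coord_mem_Ioo {d : ℕ} {x : Fin d → unitInterval} (hx : x ∉ cubeBoundary d) {p : ℕ}
    (hp : p < d) : coord x p ∈ Set.Ioo (0 : ℝ) 1 := ⟨coord_pos hx hp, coord_lt_one hx p⟩

theorem productOffset_add_lt {τ : Fin m → DiscCell} {a : Fin m} {q : ℕ} (hq : q < (τ a).dim) :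
    productOffset τ a + q < productDim τ :=
  partialSum_add_lt (f := fun b => (τ b).dim) hq

/-- The decomposition of the moment-angle complex into products of cells of the disc. -/
theorem momentAngleDecomposition (K : AbstractSimplicialComplex (Fin m)) :
    CellDecomposition (momentAngle K) (momentAngleCells K) productDim (fun τ => productMap τ)
      productCell where
  continuous τ _ := continuous_pi fun a =>
    (τ a).continuous_map fun q => continuous_coord (productOffset τ a + q)
  cell_mem y hy := (mem_momentAngle_iff.1 hy).2
  map_mem τ hτ x := by
    refine ⟨fun i => (τ i).norm_map_le fun q => coord_mem_Icc x _, innerSet τ,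
      mem_momentAngleCells.1 hτ, fun j hj => DiscCell.norm_map_of_not_isInner ?_ _⟩
    simpa [innerSet] using hj
  dim_lt τ _ x hx := by
    obtain ⟨p, hp⟩ := hx
    obtain ⟨a, q, hq, hpq⟩ := exists_partialSum_add_eq (f := fun b => (τ b).dim) p.2
    refine Finset.sum_lt_sum (fun b _ => DiscCell.dim_of_map_le fun q => coord_mem_Icc x _)
      ⟨a, Finset.mem_univ _, DiscCell.dim_of_map_lt (fun q => coord_mem_Icc x _) ⟨q, hq, ?_⟩⟩
    have hpq' : productOffset τ a + q = p := hpq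
    rw [hpq', coord_of_lt x p.2]
    rcases hp with hp | hp <;> simp [hp]
  cell_map τ _ x hx := funext fun a =>
    DiscCell.of_map fun q hq => coord_mem_Ioo hx (productOffset_add_lt hq)
  injOn τ _ x hx y hy hxy := by
    refine coord_ext fun p hp => ?_
    obtain ⟨a, q, hq, rfl⟩ := exists_partialSum_add_eq (f := fun b => (τ b).dim) hp
    exact DiscCell.map_inj (fun q hq => coord_mem_Ioo hx (productOffset_add_lt hq))
      (fun q hq => coord_mem_Ioo hy (productOffset_add_lt hq)) (congrFun hxy a) q hq
  cover y hy := by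
    choose c hc hcy using fun a => DiscCell.map_of (y a) (hy.1 a)
    let e := finSigmaFinEquiv (m := m) (n := fun a => (productCell y a).dim)
    refine ⟨fun p => ⟨c (e.symm p).1 (e.symm p).2, hc _ _⟩, funext fun a => ?_⟩
    rw [← hcy a]
    refine DiscCell.map_congr fun q hq => ?_
    rw [coord_of_lt _ (productOffset_add_lt hq)]
    have : (⟨productOffset (productCell y) a + q, productOffset_add_lt hq⟩ :
        Fin (productDim (productCell y))) = e ⟨a, ⟨q, hq⟩⟩ :=
      Fin.ext (finSigmaFinEquiv_eq_partialSum (fun b => (productCell y b).dim) a ⟨q, hq⟩).symm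
    rw [this]
    dsimp only
    rw [Equiv.symm_apply_apply]

end ProductCells

/-! ### The boundary of a product cell -/

section ProductBoundary

variable {m : ℕ} {R : Type*} [CommRing R]

theorem dim_update (τ : Fin m → DiscCell) (a : Fin m) (f : DiscCell) :
    (fun b => (Function.update τ a f b).dim) =
      Function.update (fun b => (τ b).dim) a f.dim :=
  funext fun b => Function.apply_update (fun _ => DiscCell.dim) τ a f b

theorem productDim_update (τ : Fin m → DiscCell) (a : Fin m) (f : DiscCell) :
    productDim (Function.update τ a f) + (τ a).dim = productDim τ + f.dim := by
  unfold productDim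
  rw [dim_update, ← Finset.sum_erase_add _ _ (Finset.mem_univ a),
    ← Finset.sum_erase_add _ (fun b => (τ b).dim) (Finset.mem_univ a), Function.update_self,
    Finset.sum_congr rfl fun c hc => Function.update_of_ne (Finset.ne_of_mem_erase hc) _ _]
  exact add_right_comm _ _ _

theorem innerSet_update_subset {τ : Fin m → DiscCell} {a : Fin m} (h : (τ a).IsInner)
    (f : DiscCell) : innerSet (Function.update τ a f) ⊆ innerSet τ := by
  intro b hb
  simp only [innerSet, Finset.mem_filter, Finset.mem_univ, true_and] at hb ⊢
  rcases eq_or_ne b a with rfl | hne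
  · exact h
  · rwa [Function.update_of_ne hne] at hb

theorem productOffset_add_le {τ : Fin m → DiscCell} {a b : Fin m} (h : a < b) :
    productOffset τ a + (τ a).dim ≤ productOffset τ b :=
  partialSum_add_le (f := fun b => (τ b).dim) h

/-- Restricting one coordinate of the factor `a` affects this factor alone, apart from a shift by
one of the coordinates of later factors, which matches the drop in the dimension of the factor. -/
theorem productMap_insertNth {τ : Fin m → DiscCell} {a : Fin m} {q : ℕ} {e : unitInterval}
    {f : DiscCell} {n : ℕ} {p : Fin (n + 1)} (hf : f.dim + 1 = (τ a).dim) (hq : q < (τ a).dim)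
    (hp : (p : ℕ) = productOffset τ a + q)
    (hmap : ∀ c : ℕ → ℝ, (τ a).map (fun r => if r < q then c r else if r = q then (e : ℝ)
      else c (r - 1)) = f.map c) (x : Fin n → unitInterval) :
    productMap τ (p.insertNth (α := fun _ => unitInterval) e x) =
      productMap (Function.update τ a f) x := by
  funext b
  unfold productMap
  rcases lt_trichotomy b a with h | rfl | h
  · have hoff : productOffset (Function.update τ a f) b = productOffset τ b := by
      unfold productOffset
      rw [dim_update, partialSum_update_of_le h.le]
    have := productOffset_add_le (τ := τ) h
    rw [Function.update_of_ne h.ne, hoff]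
    refine DiscCell.map_congr fun r hr => ?_
    rw [coord_insertNth, if_pos (by omega)]
  · have hoff : productOffset (Function.update τ b f) b = productOffset τ b := by
      unfold productOffset
      rw [dim_update, partialSum_update_of_le le_rfl]
    rw [Function.update_self, hoff, ← hmap]
    refine DiscCell.map_congr fun r hr => ?_
    rw [coord_insertNth, hp]
    by_cases h1 : r < q
    · rw [if_pos h1, if_pos (by omega)]
    · by_cases h2 : r = q
      · rw [if_neg h1, if_neg (by omega), if_pos h2, if_pos (by omega)]
      · rw [if_neg h1, if_neg (by omega), if_neg h2, if_neg (by omega)]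
        congr 1
        omega
  · have hoff : productOffset (Function.update τ a f) b + (τ a).dim =
        productOffset τ b + f.dim := by
      unfold productOffset
      rw [dim_update]
      exact partialSum_update_of_lt (f := fun b => (τ b).dim) h _
    have := productOffset_add_le (τ := τ) h
    rw [Function.update_of_ne h.ne']
    refine DiscCell.map_congr fun r hr => ?_
    rw [coord_insertNth, if_neg (by omega), if_neg (by omega)]
    congr 1
    omega

/-- At the centre of a disc the angle is irrelevant; after removal of the radius it is the
coordinate at the offset of `a`. -/
theorem degenerateCube_productMap_insertNth_zero {τ : Fin m → DiscCell} {a : Fin m}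
    (ha : τ a = .disc) {n : ℕ} {p : Fin (n + 1)} (hp : (p : ℕ) = productOffset τ a)
    (hn : productOffset τ a < n) :
    DegenerateCube fun x : Fin n → unitInterval =>
      productMap τ (p.insertNth (α := fun _ => unitInterval) 0 x) := by
  refine ⟨⟨_, hn⟩, fun x y hxy => funext fun b => ?_⟩
  have hcoord : ∀ r, r ≠ productOffset τ a → coord x r = coord y r := by
    intro r hr
    by_cases hrn : r < n
    · rw [coord_of_lt x hrn, coord_of_lt y hrn, hxy ⟨r, hrn⟩ (Fin.ne_of_val_ne hr)]
    · rw [coord_of_le x (not_lt.1 hrn), coord_of_le y (not_lt.1 hrn)]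
  unfold productMap
  rcases lt_trichotomy b a with h | rfl | h
  · have := productOffset_add_le (τ := τ) h
    refine DiscCell.map_congr fun r hr => ?_
    rw [coord_insertNth, coord_insertNth, if_pos (by omega), if_pos (by omega),
      hcoord _ (by omega)]
  · simp [ha, DiscCell.map, coord_insertNth, hp]
  · have := productOffset_add_le (τ := τ) h
    rw [ha] at this
    simp only [DiscCell.dim] at this
    refine DiscCell.map_congr fun r hr => ?_
    rw [coord_insertNth, coord_insertNth, if_neg (by omega), if_neg (by omega), if_neg (by omega),
      if_neg (by omega), hcoord _ (by omega)]

variable (R) in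
/-- The contribution of the `a`-th factor to the boundary of a product of cells. -/
noncomputable def boundaryTerm (n : ℕ) (τ : Fin m → DiscCell) (a : Fin m) :
    FormalChain R (Fin m → ℂ) :=
  match τ a with
  | .radius => cube R (productMap (d := n) (Function.update τ a .point)) -
      cube R (productMap (d := n) (Function.update τ a .center))
  | .disc => cube R (productMap (d := n) (Function.update τ a .circle))
  | _ => 0

/-- The faces are grouped by factors. The two ends of a circle coincide and cancel, as do the two
radii bounding the slit disc; the face at the centre of a disc is degenerate, and the rim remains.
-/
theorem formalBoundary_productMap {τ : Fin m → DiscCell} {n : ℕ} (hd : productDim τ = n + 1) :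
    formalBoundary R (cube R (productMap (d := n + 1) τ)) -
      ∑ a, (-1 : R) ^ productOffset τ a • boundaryTerm R n τ a ∈ degenerate R (Fin m → ℂ) := by
  let face : Fin (n + 1) → unitInterval → FormalChain R (Fin m → ℂ) := fun p e =>
    cube R fun x : Fin n → unitInterval =>
      productMap τ (p.insertNth (α := fun _ => unitInterval) e x)
  let F : ℕ → FormalChain R (Fin m → ℂ) := fun p =>
    if h : p < n + 1 then (-1 : R) ^ p • (face ⟨p, h⟩ 1 - face ⟨p, h⟩ 0) else 0
  have hsum : formalBoundary R (cube R (productMap (d := n + 1) τ)) = ∑ p : Fin (n + 1), F p := by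
    rw [formalBoundary_cube_eq_sum]
    refine Finset.sum_congr rfl fun p _ => ?_
    simp only [F, dif_pos p.2]
    rfl
  rw [hsum, sum_partialSum (fun b => (τ b).dim) hd F, ← Finset.sum_sub_distrib]
  refine sum_mem fun a _ => ?_
  have hlt : ∀ q < (τ a).dim, productOffset τ a + q < n + 1 := fun q hq =>
    hd ▸ productOffset_add_lt hq
  have hF : ∀ q (hq : q < (τ a).dim), F (productOffset τ a + q) =
      (-1 : R) ^ (productOffset τ a + q) •
        (face ⟨_, hlt q hq⟩ 1 - face ⟨_, hlt q hq⟩ 0) := fun q hq => dif_pos (hlt q hq)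
  have hface : ∀ q (hq : q < (τ a).dim) (e : unitInterval) (f : DiscCell),
      f.dim + 1 = (τ a).dim → (∀ c : ℕ → ℝ, (τ a).map (fun r => if r < q then c r else
        if r = q then (e : ℝ) else c (r - 1)) = f.map c) →
      face ⟨_, hlt q hq⟩ e = cube R (productMap (d := n) (Function.update τ a f)) :=
    fun q hq e f hf hmap => congrArg (fun g : (Fin n → unitInterval) → Fin m → ℂ => cube R g)
      (funext fun x => productMap_insertNth (p := ⟨_, hlt q hq⟩) hf hq rfl hmap x)
  change ∑ q ∈ Finset.range (τ a).dim, F (productOffset τ a + q) - _ ∈ _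
  cases ha : τ a with
  | point => simp [boundaryTerm, ha, DiscCell.dim]
  | center => simp [boundaryTerm, ha, DiscCell.dim]
  | radius =>
    have h0 : 0 < (τ a).dim := by rw [ha]; decide
    simp only [DiscCell.dim, Finset.sum_range_one]
    rw [hF 0 h0, hface 0 h0 1 .point (by rw [ha]; rfl) (by simp [ha, DiscCell.map]),
      hface 0 h0 0 .center (by rw [ha]; rfl) (by simp [ha, DiscCell.map]), add_zero]
    simp [boundaryTerm, ha]
  | circle =>
    have h0 : 0 < (τ a).dim := by rw [ha]; decide
    simp only [DiscCell.dim, Finset.sum_range_one]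
    rw [hF 0 h0, hface 0 h0 1 .point (by rw [ha]; rfl)
      (by simp [ha, DiscCell.map, DiscCell.circlePoint_one]),
      hface 0 h0 0 .point (by rw [ha]; rfl)
      (by simp [ha, DiscCell.map, DiscCell.circlePoint_zero]), sub_self]
    simp [boundaryTerm, ha]
  | disc =>
    have h0 : 0 < (τ a).dim := by rw [ha]; decide
    have h1 : 1 < (τ a).dim := by rw [ha]; decide
    simp only [DiscCell.dim, Finset.sum_range_succ, Finset.sum_range_zero, zero_add]
    rw [hF 0 h0, hF 1 h1, hface 0 h0 1 .circle (by rw [ha]; rfl) (by simp [ha, DiscCell.map]),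
      hface 1 h1 1 .radius (by rw [ha]; rfl)
        (by simp [ha, DiscCell.map, DiscCell.circlePoint_one]),
      hface 1 h1 0 .radius (by rw [ha]; rfl)
        (by simp [ha, DiscCell.map, DiscCell.circlePoint_zero]), sub_self, smul_zero, add_zero]
    have hpow : (-1 : R) ^ (productOffset τ a + 0) = (-1 : R) ^ productOffset τ a := rfl
    have hb : boundaryTerm R n τ a =
        cube R (productMap (d := n) (Function.update τ a .circle)) := by
      simp [boundaryTerm, ha]
    rw [hb, hpow, ← smul_sub, sub_right_comm, sub_self, zero_sub]
    refine Submodule.smul_mem _ _ (neg_mem (cube_mem_degenerate ?_))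
    exact degenerateCube_productMap_insertNth_zero ha rfl (by have := hlt 1 h1; omega)

variable {K : AbstractSimplicialComplex (Fin m)}

theorem cube_productMap_mem_cellChains {T : Set (Fin m → DiscCell)} {σ : Fin m → DiscCell}
    (hσ : σ ∈ T) {n : ℕ} (hn : productDim σ = n) :
    cube R (productMap (d := n) σ) ∈ cellChains R T productDim fun τ => productMap τ := by
  subst hn
  refine mem_cellChains.2 ⟨Finsupp.single σ 1, Finsupp.single_mem_supported _ _ hσ, ?_⟩
  rw [cellCombination_single, one_smul, sub_self]
  exact zero_mem _

theorem formalBoundary_productMap_mem_cellChains {τ : Fin m → DiscCell}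
    (hτ : τ ∈ momentAngleCells K) :
    formalBoundary R (cube R (productMap (d := productDim τ) τ)) ∈
      cellChains R {σ | σ ∈ momentAngleCells K ∧ productDim σ < productDim τ} productDim
        fun τ => productMap τ := by
  cases hd : productDim τ with
  | zero =>
    rw [formalBoundary_cube_zero]
    exact zero_mem _
  | succ n =>
    have hmem : ∀ a f, (τ a).IsInner → f.dim + 1 = (τ a).dim →
        cube R (productMap (d := n) (Function.update τ a f)) ∈
          cellChains R {σ | σ ∈ momentAngleCells K ∧ productDim σ < n + 1} productDim
            fun τ => productMap τ := by
      intro a f ha hf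
      have := productDim_update τ a f
      have hn : productDim (Function.update τ a f) = n := by omega
      have hmem' : Function.update τ a f ∈ {σ | σ ∈ momentAngleCells K ∧ productDim σ < n + 1} := by
        refine ⟨?_, by omega⟩
        exact mem_momentAngleCells.2
          ((mem_momentAngleCells.1 hτ).subset (innerSet_update_subset ha f))
      exact cube_productMap_mem_cellChains hmem' hn
    have h := formalBoundary_productMap (R := R) hd
    rw [← sub_add_cancel (formalBoundary R _) (∑ a, (-1 : R) ^ productOffset τ a •
      boundaryTerm R n τ a)]
    refine add_mem (Submodule.mem_sup_left h) (sum_mem fun a _ => Submodule.smul_mem _ _ ?_)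
    cases ha : τ a with
    | radius =>
      simp only [boundaryTerm, ha]
      exact sub_mem (hmem a _ (by simp [ha, DiscCell.IsInner]) (by rw [ha]; rfl))
        (hmem a _ (by simp [ha, DiscCell.IsInner]) (by rw [ha]; rfl))
    | disc =>
      simp only [boundaryTerm, ha]
      exact hmem a _ (by simp [ha, DiscCell.IsInner]) (by rw [ha]; rfl)
    | _ => simp [boundaryTerm, ha]

theorem relEq_momentAngle (R : Type*) [CommRing R] (K : AbstractSimplicialComplex (Fin m)) :
    RelEq (cellChains R (momentAngleCells K : Set (Fin m → DiscCell)) productDim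
      fun τ => productMap τ) (chainsIn R (momentAngle K)) :=
  (momentAngleDecomposition K).relEq_cellChains fun _ hτ =>
    formalBoundary_productMap_mem_cellChains hτ

end ProductBoundary

/-! ### Top-dimensional cells and simplicial cycles -/

section TopCells

variable {m : ℕ} {R : Type*} [CommRing R]

/-- The cell `D_I T_J` with `J` the complement of `I`. -/
def topCell (I : Finset (Fin m)) (a : Fin m) : DiscCell := if a ∈ I then .disc else .circle

theorem mem_innerSet {τ : Fin m → DiscCell} {a : Fin m} : a ∈ innerSet τ ↔ (τ a).IsInner := by
  simp [innerSet]

theorem innerSet_topCell (I : Finset (Fin m)) : innerSet (topCell I) = I := by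
  ext a
  by_cases h : a ∈ I <;> simp [mem_innerSet, topCell, h, DiscCell.IsInner]

theorem dim_topCell (I : Finset (Fin m)) (a : Fin m) :
    (topCell I a).dim = 1 + if a ∈ I then 1 else 0 := by
  by_cases h : a ∈ I <;> simp [topCell, h, DiscCell.dim]

theorem productDim_topCell (I : Finset (Fin m)) : productDim (topCell I) = m + I.card := by
  simp [productDim, dim_topCell, Finset.sum_add_distrib]

/-- Each earlier factor contributes one coordinate, and a second one if it is a disc. So the
cellular sign differs from the simplicial one by `(-1) ^ a`, which `cellSign` absorbs. -/
theorem productOffset_topCell (I : Finset (Fin m)) (a : Fin m) :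
    productOffset (topCell I) a = a + position I a := by
  have h : (Finset.univ.filter (· < a)).card = a := by
    rw [Finset.filter_gt_eq_Iio, Fin.card_Iio]
  have h' : (Finset.univ.filter (· < a)).filter (· ∈ I) = I.filter (· < a) := by
    ext b
    simp [and_comm]
  simp only [productOffset, partialSum, dim_topCell, Finset.sum_add_distrib, Finset.sum_const,
    smul_eq_mul, mul_one, h, position, ← Finset.sum_filter, h']

/-- A factor has dimension at most `2` if it is inner and at most `1` otherwise. Equality forces
discs and circles, so top cells are the `topCell I`; the cells with a centre or a radius play no
role in the top degree. -/
theorem productDim_le (τ : Fin m → DiscCell) : productDim τ ≤ m + (innerSet τ).card := by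
  rw [← productDim_topCell]
  refine Finset.sum_le_sum fun a _ => ?_
  rw [dim_topCell]
  cases h : τ a <;> simp [mem_innerSet, h, DiscCell.IsInner, DiscCell.dim]

theorem eq_topCell {τ : Fin m → DiscCell} (h : productDim τ = m + (innerSet τ).card) :
    τ = topCell (innerSet τ) := by
  have hle : ∀ a ∈ Finset.univ, (τ a).dim ≤ (topCell (innerSet τ) a).dim := fun a _ => by
    rw [dim_topCell]
    cases h : τ a <;> simp [mem_innerSet, h, DiscCell.IsInner, DiscCell.dim]
  rw [← productDim_topCell] at h
  funext a
  have ha := (Finset.sum_eq_sum_iff_of_le hle).1 h a (Finset.mem_univ a)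
  rw [dim_topCell] at ha
  cases h : τ a <;> simp [mem_innerSet, h, DiscCell.IsInner, DiscCell.dim, topCell] at ha ⊢

theorem update_topCell {I : Finset (Fin m)} (i : Fin m) :
    Function.update (topCell I) i .circle = topCell (I.erase i) := by
  funext a
  rcases eq_or_ne a i with rfl | h
  · simp [topCell]
  · simp [topCell, h]

theorem productMap_topCell (d : ℕ) (I : Finset (Fin m)) :
    productMap (topCell I) = cellMap d I Iᶜ := by
  have hoff : ∀ a, productOffset (topCell I) a = offset I Iᶜ a := fun a => by
    unfold productOffset offset partialSum
    refine Finset.sum_congr rfl fun b _ => ?_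
    change (topCell I b).dim = _
    rw [dim_topCell]
    by_cases h : b ∈ I <;> simp [h]
  funext x a
  unfold productMap cellMap
  rw [hoff]
  by_cases h : a ∈ I <;> simp [topCell, h, DiscCell.map]

variable (R) in
/-- The sign that relates the orientations of a simplex `I` and of the cell `D_I T_J`. -/
def cellSign (I : Finset (Fin m)) : R := (-1) ^ ∑ i ∈ I, (i : ℕ)

theorem cellSign_mul_self (I : Finset (Fin m)) : cellSign R I * cellSign R I = 1 := by
  rw [cellSign, ← pow_add, ← two_mul, pow_mul]
  simp

theorem cellSign_erase {I : Finset (Fin m)} {i : Fin m} (hi : i ∈ I) :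
    cellSign R (I.erase i) = cellSign R I * (-1) ^ (i : ℕ) := by
  unfold cellSign
  rw [← Finset.sum_erase_add _ _ hi, pow_add, mul_assoc, ← pow_add, ← two_mul, pow_mul]
  simp

variable (R) in
/-- The chain of cells that corresponds to a simplicial chain. -/
noncomputable def discChain (d : ℕ) : (Finset (Fin m) →₀ R) →ₗ[R] FormalChain R (Fin m → ℂ) :=
  Finsupp.linearCombination R fun I => cellSign R I • cube R (productMap (d := d) (topCell I))

theorem discChain_single (d : ℕ) (I : Finset (Fin m)) :
    discChain R d (Finsupp.single I 1) =
      cellSign R I • cube R (productMap (d := d) (topCell I)) := by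
  simp [discChain]

theorem formalBoundary_topCell {I : Finset (Fin m)} {d : ℕ} (hI : m + I.card = d + 1) :
    formalBoundary R (cube R (productMap (d := d + 1) (topCell I))) -
      ∑ i ∈ I, (-1 : R) ^ ((i : ℕ) + position I i) •
        cube R (productMap (d := d) (topCell (I.erase i))) ∈ degenerate R (Fin m → ℂ) := by
  have h := formalBoundary_productMap (R := R) (τ := topCell I) (n := d)
    (by rw [productDim_topCell, hI])
  convert h using 2
  rw [← Finset.sum_subset (Finset.subset_univ I)]
  · refine Finset.sum_congr rfl fun i hi => ?_
    have hd : topCell I i = .disc := if_pos hi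
    rw [productOffset_topCell, ← update_topCell]
    simp [boundaryTerm, hd]
  · intro i _ hi
    have hd : topCell I i = .circle := if_neg hi
    simp [boundaryTerm, hd]

theorem linearMap_mem_of_supported {α M : Type*} [AddCommGroup M] [Module R M]
    (f : (α →₀ R) →ₗ[R] M) {T : Set α} {N : Submodule R M}
    (h : ∀ a ∈ T, f (Finsupp.single a 1) ∈ N) {ξ : α →₀ R} (hξ : ξ ∈ Finsupp.supported R R T) :
    f ξ ∈ N := by
  rw [Finsupp.supported_eq_span_single] at hξ
  have : Submodule.span R ((fun i => Finsupp.single i (1 : R)) '' T) ≤ N.comap f := by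
    rw [Submodule.span_le]
    rintro _ ⟨a, ha, rfl⟩
    exact h a ha
  exact this hξ

/-- The twist by `cellSign` turns the cellular boundary into the simplicial one: removing `i` from
`I` changes `cellSign` by `(-1) ^ i`, the excess sign of the cellular boundary. -/
theorem formalBoundary_discChain {d : ℕ} {ζ : Finset (Fin m) →₀ R}
    (hζ : ζ ∈ Finsupp.supported R R {I | m + I.card = d + 1}) :
    formalBoundary R (discChain R (d + 1) ζ) - discChain R d (simplicialBoundary R ζ) ∈
      degenerate R (Fin m → ℂ) := by
  refine linearMap_mem_of_supported (formalBoundary R ∘ₗ discChain R (d + 1) -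
    discChain R d ∘ₗ simplicialBoundary R) (fun I hI => ?_) hζ
  rw [LinearMap.sub_apply, LinearMap.comp_apply, LinearMap.comp_apply, discChain_single,
    simplicialBoundary_single, map_smul, map_sum]
  have h := Submodule.smul_mem _ (cellSign R I) (formalBoundary_topCell (R := R) hI)
  convert h using 1
  rw [smul_sub, Finset.smul_sum]
  congr 1
  refine Finset.sum_congr rfl fun i hi => ?_
  rw [map_smul, discChain_single, cellSign_erase hi, smul_smul, smul_smul]
  congr 1
  ring

variable (R) in
/-- The combination of cells that corresponds to a simplicial chain. -/
noncomputable def topCombination : (Finset (Fin m) →₀ R) →ₗ[R] (Fin m → DiscCell) →₀ R :=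
  Finsupp.linearCombination R fun I => cellSign R I • Finsupp.single (topCell I) 1

theorem topCombination_single (I : Finset (Fin m)) :
    topCombination R (Finsupp.single I 1) = cellSign R I • Finsupp.single (topCell I) 1 := by
  simp [topCombination]

theorem topCell_injective : Function.Injective (topCell (m := m)) := fun I J h => by
  rw [← innerSet_topCell I, h, innerSet_topCell]

theorem topCombination_apply (ζ : Finset (Fin m) →₀ R) (I : Finset (Fin m)) :
    topCombination R ζ (topCell I) = cellSign R I * ζ I := by
  classical
  induction ζ using Finsupp.induction_linear with
  | zero => simp
  | add f g hf hg => rw [map_add, Finsupp.add_apply, hf, hg, Finsupp.add_apply, mul_add]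
  | single J r =>
    rw [show Finsupp.single J r = r • Finsupp.single J (1 : R) by simp, map_smul,
      topCombination_single]
    simp only [Finsupp.smul_apply, Finsupp.single_apply, topCell_injective.eq_iff, smul_eq_mul]
    split_ifs with h
    · rw [h]; ring
    · ring

theorem topCombination_injective : Function.Injective (topCombination R (m := m)) := by
  refine (injective_iff_map_eq_zero _).2 fun ζ h => Finsupp.ext fun I => ?_
  have := topCombination_apply ζ I
  rw [h, Finsupp.zero_apply] at this
  rw [Finsupp.zero_apply, ← one_mul (ζ I), ← cellSign_mul_self I, mul_assoc, ← this, mul_zero]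

theorem cellCombination_topCombination {d : ℕ} {ζ : Finset (Fin m) →₀ R}
    (hζ : ζ ∈ Finsupp.supported R R {I | m + I.card = d}) :
    cellCombination R productDim (fun τ => productMap τ) (topCombination R ζ) =
      discChain R d ζ := by
  rw [← sub_eq_zero, ← Submodule.mem_bot R]
  refine linearMap_mem_of_supported (cellCombination R productDim (fun τ => productMap τ) ∘ₗ
    topCombination R - discChain R d) (fun I hI => ?_) hζ
  rw [LinearMap.sub_apply, LinearMap.comp_apply, topCombination_single, discChain_single, map_smul,
    cellCombination_single, one_smul, ← smul_sub]
  obtain rfl : productDim (topCell I) = d := (productDim_topCell I).trans hI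
  rw [sub_self, smul_zero]
  exact zero_mem _

variable {K : AbstractSimplicialComplex (Fin m)}

theorem topCombination_mem_supported {ζ : Finset (Fin m) →₀ R}
    (hζ : ζ ∈ Finsupp.supported R R {I | IsSimplex K I}) :
    topCombination R ζ ∈ Finsupp.supported R R (momentAngleCells K : Set (Fin m → DiscCell)) := by
  refine linearMap_mem_of_supported _ (fun I hI => ?_) hζ
  rw [topCombination_single]
  refine Submodule.smul_mem _ _ (Finsupp.single_mem_supported _ _ ?_)
  rw [Finset.mem_coe, mem_momentAngleCells, innerSet_topCell]
  exact hI

theorem eq_zero_of_discChain_mem_degenerate {d : ℕ} {ζ : Finset (Fin m) →₀ R}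
    (hζ : ζ ∈ Finsupp.supported R R {I | IsSimplex K I ∧ m + I.card = d})
    (h : discChain R d ζ ∈ degenerate R (Fin m → ℂ)) : ζ = 0 := by
  have h1 : ζ ∈ Finsupp.supported R R {I | IsSimplex K I} :=
    Finsupp.supported_mono (fun _ hI => hI.1) hζ
  have h2 : ζ ∈ Finsupp.supported R R {I | m + I.card = d} :=
    Finsupp.supported_mono (fun _ hI => hI.2) hζ
  rw [← cellCombination_topCombination h2] at h
  have := (momentAngleDecomposition K).eq_zero_of_mem_degenerate
    (topCombination_mem_supported h1) h
  exact topCombination_injective (this.trans (map_zero _).symm)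

variable {n : ℕ}

theorem exists_topCombination_eq (hle : ∀ I, IsSimplex K I → I.card ≤ n)
    {ξ : (Fin m → DiscCell) →₀ R}
    (hξ : ξ ∈ Finsupp.supported R R {τ | τ ∈ momentAngleCells K ∧ productDim τ = m + n}) :
    ∃ ζ ∈ Finsupp.supported R R {I | IsSimplex K I ∧ I.card = n}, topCombination R ζ = ξ := by
  refine linearMap_mem_of_supported LinearMap.id (N := (Finsupp.supported R R
    {I | IsSimplex K I ∧ I.card = n}).map (topCombination R)) (fun τ hτ => ?_) hξ
  have hI := mem_momentAngleCells.1 hτ.1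
  have h1 := hle _ hI
  have h2 := productDim_le τ
  have h3 : productDim τ = m + n := hτ.2
  have hcard : (innerSet τ).card = n := by omega
  refine ⟨cellSign R (innerSet τ) • Finsupp.single (innerSet τ) 1,
    Submodule.smul_mem _ _ (Finsupp.single_mem_supported _ _ ⟨hI, hcard⟩), ?_⟩
  rw [map_smul, topCombination_single, smul_smul, cellSign_mul_self, one_smul,
    ← eq_topCell (by omega)]
  rfl

theorem exists_discChain (hle : ∀ I, IsSimplex K I → I.card ≤ n)
    {a : FormalChain R (Fin m → ℂ)}
    (ha : a ∈ cellChains R (momentAngleCells K : Set (Fin m → DiscCell)) productDim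
      fun τ => productMap τ) :
    ∃ ζ ∈ Finsupp.supported R R {I | IsSimplex K I ∧ I.card = n},
      degreePart R (m + n) a - discChain R (m + n) ζ ∈ degenerate R (Fin m → ℂ) := by
  obtain ⟨ξ, hξ, h⟩ := mem_cellChains.1 ha
  have h' := degreePart_mem_degenerate (m + n) h
  rw [map_sub, degreePart_cellCombination] at h'
  have hmem : ξ.filter (fun τ => productDim τ = m + n) ∈
      Finsupp.supported R R {τ | τ ∈ momentAngleCells K ∧ productDim τ = m + n} := by
    intro τ hτ
    have hτ' := Finset.mem_coe.1 hτ
    rw [Finsupp.support_filter, Finset.mem_filter] at hτ'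
    exact ⟨hξ hτ'.1, hτ'.2⟩
  obtain ⟨ζ, hζ, hζξ⟩ := exists_topCombination_eq hle hmem
  refine ⟨ζ, hζ, ?_⟩
  rwa [← hζξ, cellCombination_topCombination (d := m + n)
    (Finsupp.supported_mono (fun I hI => congrArg (m + ·) hI.2) hζ)] at h'

/-- There are no cells of dimension `m + n + 1`, so no top cellular cycle is a cellular boundary. -/
theorem degreePart_mem_degenerate_of_lt (hle : ∀ I, IsSimplex K I → I.card ≤ n)
    {a : FormalChain R (Fin m → ℂ)}
    (ha : a ∈ cellChains R (momentAngleCells K : Set (Fin m → DiscCell)) productDim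
      fun τ => productMap τ) :
    degreePart R (m + n + 1) a ∈ degenerate R (Fin m → ℂ) := by
  obtain ⟨ξ, hξ, h⟩ := mem_cellChains.1 ha
  have h' := degreePart_mem_degenerate (m + n + 1) h
  rw [map_sub, degreePart_cellCombination] at h'
  have : ξ.filter (fun τ => productDim τ = m + n + 1) = 0 := by
    refine (Finsupp.filter_eq_zero_iff _ _).2 fun τ hτ => ?_
    by_contra hne
    have h1 := hle _ (mem_momentAngleCells.1 (hξ (Finsupp.mem_support_iff.2 hne)))
    have h2 := productDim_le τ
    omega
  rwa [this, map_zero, sub_zero] at h'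

theorem formalBoundary_discChain_mem_degenerate {ζ : Finset (Fin m) →₀ R}
    (hζ : ζ ∈ Finsupp.supported R R {I | I.card = n}) (h : simplicialBoundary R ζ = 0) :
    formalBoundary R (discChain R (m + n) ζ) ∈ degenerate R (Fin m → ℂ) := by
  cases hmn : m + n with
  | zero =>
    refine linearMap_mem_of_supported (formalBoundary R ∘ₗ discChain R 0) (fun I _ => ?_) hζ
    rw [LinearMap.comp_apply, discChain_single, map_smul, formalBoundary_cube_zero, smul_zero]
    exact zero_mem _
  | succ d =>
    have := formalBoundary_discChain (R := R) (d := d) (ζ := ζ)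
      (Finsupp.supported_mono (fun I hI => (congrArg (m + ·) hI).trans hmn) hζ)
    rwa [h, map_zero, sub_zero] at this

theorem simplicialBoundary_eq_zero (hcard : 0 < n ∨ m = 0) {ζ : Finset (Fin m) →₀ R}
    (hζ : ζ ∈ Finsupp.supported R R {I | IsSimplex K I ∧ I.card = n})
    (h : formalBoundary R (discChain R (m + n) ζ) ∈ degenerate R (Fin m → ℂ)) :
    simplicialBoundary R ζ = 0 := by
  have hsupp : simplicialBoundary R ζ ∈
      Finsupp.supported R R {I | IsSimplex K I ∧ I.card + 1 = n} := by
    refine linearMap_mem_of_supported _ (fun I hI => ?_) hζ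
    rw [simplicialBoundary_single]
    refine sum_mem fun i hi => Submodule.smul_mem _ _ (Finsupp.single_mem_supported _ _ ⟨?_, ?_⟩)
    · exact hI.1.subset (Finset.erase_subset _ _)
    · rw [Finset.card_erase_add_one hi, hI.2]
  cases n with
  | zero =>
    have : ({I | IsSimplex K I ∧ I.card + 1 = 0} : Set (Finset (Fin m))) = ∅ := by
      ext I; simp
    rw [this, Finsupp.supported_empty] at hsupp
    exact (Submodule.mem_bot R).1 hsupp
  | succ n =>
    have hsub : {I : Finset (Fin m) | IsSimplex K I ∧ I.card = n + 1} ⊆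
        {I | m + I.card = m + n + 1} := fun I hI => congrArg (m + ·) hI.2
    have hsub' : {I : Finset (Fin m) | IsSimplex K I ∧ I.card + 1 = n + 1} ⊆
        {I | IsSimplex K I ∧ m + I.card = m + n} := fun I hI =>
      ⟨hI.1, congrArg (m + ·) (Nat.succ_injective hI.2)⟩
    have h1 := formalBoundary_discChain (R := R) (Finsupp.supported_mono hsub hζ)
    refine eq_zero_of_discChain_mem_degenerate (Finsupp.supported_mono hsub' hsupp) ?_
    have h2 := sub_mem h h1
    rwa [← add_assoc, sub_sub_cancel] at h2

/-- Any relative comparison with cellular chains gives a cellular chain in mixed degrees; its part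
of degree `m + n` consists of top cells. It is a cycle with `z`, hence so is the simplicial chain.
-/
theorem IsSimplicialSphere.exists_discChain (hK : IsSimplicialSphere K n)
    {z : FormalChain R (Fin m → ℂ)} (hz : z ∈ chainsIn R (momentAngle K))
    (hdeg : degreePart R (m + n) z = z) (h : formalBoundary R z ∈ degenerate R (Fin m → ℂ)) :
    ∃ ζ ∈ Finsupp.supported R R {I | IsSimplex K I ∧ I.card = n}, simplicialBoundary R ζ = 0 ∧
      ∃ s ∈ chainsIn R (momentAngle K),
        z - discChain R (m + n) ζ - formalBoundary R s ∈ degenerate R (Fin m → ℂ) := by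
  obtain ⟨a, ha, s, hs, rfl⟩ := (relEq_momentAngle R K).2 z hz (Submodule.mem_sup_left h)
  obtain ⟨ζ, hζ, haζ⟩ := MomentAngle.exists_discChain (fun I hI => hK.card_le hI) ha
  rw [map_add, degreePart_formalBoundary] at hdeg
  have key : a + formalBoundary R s - discChain R (m + n) ζ -
      formalBoundary R (degreePart R (m + n + 1) s) ∈ degenerate R (Fin m → ℂ) := by
    rw [← hdeg]
    convert haζ using 1
    abel
  refine ⟨ζ, hζ, simplicialBoundary_eq_zero ?_ hζ ?_, _, degreePart_mem_chainsIn _ hs, key⟩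
  · cases n with
    | zero => exact Or.inr hK.eq_zero
    | succ n => exact Or.inl n.succ_pos
  · have h1 := sub_mem h (formalBoundary_mem_degenerate key)
    rwa [map_sub, map_sub, formalBoundary_formalBoundary, sub_zero, sub_sub_cancel] at h1

theorem IsSimplicialSphere.eq_zero_of_discChain (hK : IsSimplicialSphere K n)
    {ζ : Finset (Fin m) →₀ R} (hζ : ζ ∈ Finsupp.supported R R {I | IsSimplex K I ∧ I.card = n})
    {s : FormalChain R (Fin m → ℂ)} (hs : s ∈ chainsIn R (momentAngle K))
    (h : discChain R (m + n) ζ - formalBoundary R s ∈ degenerate R (Fin m → ℂ)) : ζ = 0 := by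
  have hsub : {I : Finset (Fin m) | IsSimplex K I ∧ I.card = n} ⊆
      {I | IsSimplex K I ∧ m + I.card = m + n} := fun I hI => ⟨hI.1, congrArg (m + ·) hI.2⟩
  have hζ' := Finsupp.supported_mono (R := R) hsub hζ
  have h1 : ζ ∈ Finsupp.supported R R {I | IsSimplex K I} :=
    Finsupp.supported_mono (fun _ hI => hI.1) hζ
  have h2 : ζ ∈ Finsupp.supported R R {I | m + I.card = m + n} :=
    Finsupp.supported_mono (fun _ hI => hI.2) hζ'
  have hcell : discChain R (m + n) ζ ∈ cellChains R
      (momentAngleCells K : Set (Fin m → DiscCell)) productDim fun τ => productMap τ := by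
    refine mem_cellChains.2 ⟨_, topCombination_mem_supported h1, ?_⟩
    rw [cellCombination_topCombination h2, sub_self]
    exact zero_mem _
  have hdegree : degreePart R (m + n) (discChain R (m + n) ζ) = discChain R (m + n) ζ := by
    rw [← sub_eq_zero, ← Submodule.mem_bot R]
    refine linearMap_mem_of_supported (degreePart R (m + n) ∘ₗ discChain R (m + n) -
      discChain R (m + n)) (fun I _ => ?_) hζ
    rw [LinearMap.sub_apply, LinearMap.comp_apply, discChain_single, map_smul, degreePart_cube,
      if_pos rfl, sub_self]
    exact zero_mem _
  have hbd : formalBoundary R s ∈ cellChains R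
      (momentAngleCells K : Set (Fin m → DiscCell)) productDim fun τ => productMap τ := by
    have := sub_mem hcell (Submodule.mem_sup_left h : _ ∈ cellChains R
      (momentAngleCells K : Set (Fin m → DiscCell)) productDim fun τ => productMap τ)
    rwa [sub_sub_cancel] at this
  obtain ⟨a, ha, t, _, rfl⟩ := (relEq_momentAngle R K).2 s hs hbd
  refine eq_zero_of_discChain_mem_degenerate hζ' ?_
  have h3 := degreePart_mem_degenerate (m + n) h
  rw [map_add, formalBoundary_formalBoundary, add_zero, map_sub, hdegree,
    degreePart_formalBoundary] at h3
  have h4 := formalBoundary_mem_degenerate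
    (degreePart_mem_degenerate_of_lt (fun I hI => hK.card_le hI) ha)
  have h5 := add_mem h3 h4
  rwa [sub_add_cancel] at h5

end TopCells

/-! ### The Koszul differential on monomials -/

section KoszulComplex

variable {k : Type*} [CommRing k] {m : ℕ} {K : AbstractSimplicialComplex (Fin m)}

variable (k) in
/-- The product `u_{j₁} ⋯ u_{j_q}` over `J = {j₁ < ⋯ < j_q}`. -/
noncomputable def exteriorProd (J : Finset (Fin m)) : ExteriorAlgebra k (Fin m → k) :=
  ((J.sort (· ≤ ·)).map (u k)).prod

theorem exteriorProd_insert {a : Fin m} {J : Finset (Fin m)} (h : ∀ b ∈ J, a < b) :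
    exteriorProd k (insert a J) = u k a * exteriorProd k J := by
  rw [exteriorProd, Finset.sort_insert _ (fun b hb => (h b hb).le) fun ha => lt_irrefl _ (h a ha),
    List.map_cons, List.prod_cons, exteriorProd]

/-- The contraction is an antiderivation, so it changes sign at each factor `u_j` with `j < i` that
it passes. The induction adds the smallest element, which is the leftmost factor. -/
theorem contractLeft_exteriorProd (i : Fin m) (J : Finset (Fin m)) :
    CliffordAlgebra.contractLeft (LinearMap.proj i : (Fin m → k) →ₗ[k] k) (exteriorProd k J) =
      if i ∈ J then (-1 : k) ^ position J i • exteriorProd k (J.erase i) else 0 := by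
  induction J using Finset.induction_on_min with
  | empty => simp [exteriorProd]
  | insert a s has ih =>
    have ha : a ∉ s := fun h => lt_irrefl _ (has a h)
    rw [exteriorProd_insert has, u, ExteriorAlgebra.ι, CliffordAlgebra.contractLeft_ι_mul, ih,
      LinearMap.proj_apply]
    rcases eq_or_ne i a with rfl | hne
    · have hp : position (insert i s) i = 0 := by
        rw [position, Finset.card_eq_zero, Finset.filter_eq_empty_iff]
        intro b hb
        rcases Finset.mem_insert.1 hb with rfl | hb
        · exact lt_irrefl _
        · exact (has b hb).le.not_gt
      simp [ha, hp]
    · rw [Pi.single_eq_of_ne hne, zero_smul, zero_sub]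
      by_cases hi : i ∈ s
      · have hp : position (insert a s) i = position s i + 1 := by
          unfold position
          rw [Finset.filter_insert, if_pos (has i hi), Finset.card_insert_of_notMem]
          exact fun h => ha (Finset.mem_filter.1 h).1
        rw [if_pos hi, if_pos (Finset.mem_insert_of_mem hi), Finset.erase_insert_of_ne hne.symm,
          exteriorProd_insert fun b hb => has b (Finset.mem_of_mem_erase hb), hp, pow_succ,
          mul_neg_one, neg_smul, mul_smul_comm]
        rfl
      · rw [if_neg hi, if_neg, mul_zero, neg_zero]
        rw [Finset.mem_insert]
        tauto

theorem prod_v_eq_zero {I : Finset (Fin m)} (hI : ¬ IsSimplex K I) : ∏ i ∈ I, v k K i = 0 := by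
  unfold v
  rw [← map_prod]
  exact Ideal.Quotient.eq_zero_iff_mem.2 (Ideal.subset_span ⟨I, hI, rfl⟩)

/-- By this relation sums may run over all subsets, without asking which of them are simplices. -/
theorem monomial_eq_zero {I : Finset (Fin m)} (hI : ¬ IsSimplex K I) (J : Finset (Fin m)) :
    monomial k K I J = 0 := by
  rw [monomial, prod_v_eq_zero hI, TensorProduct.zero_tmul]

theorem koszulD_monomial {I J : Finset (Fin m)} (h : Disjoint I J) :
    koszulD k K (monomial k K I J) =
      ∑ j ∈ J, (-1 : k) ^ position J j • monomial k K (insert j I) (J.erase j) := by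
  unfold koszulD
  rw [LinearMap.sum_apply, ← Finset.sum_subset (Finset.subset_univ J)]
  · refine Finset.sum_congr rfl fun j hj => ?_
    have hjI : j ∉ I := fun hjI => Finset.disjoint_left.1 h hjI hj
    have := contractLeft_exteriorProd (k := k) j J
    rw [if_pos hj] at this
    rw [monomial, monomial, TensorProduct.map_tmul, Finset.prod_insert hjI,
      LinearMap.mulLeft_apply]
    erw [this]
    rw [TensorProduct.tmul_smul]
    rfl
  · intro j _ hj
    have := contractLeft_exteriorProd (k := k) j J
    rw [if_neg hj] at this
    rw [monomial, TensorProduct.map_tmul]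
    erw [this]
    rw [TensorProduct.tmul_zero]

theorem position_compl (I : Finset (Fin m)) (a : Fin m) :
    position Iᶜ a + position I a = a := by
  have h : (Finset.univ.filter (· < a)).card = a := by
    rw [Finset.filter_gt_eq_Iio, Fin.card_Iio]
  have h1 : Iᶜ.filter (· < a) = (Finset.univ.filter (· < a)).filter (· ∉ I) := by
    ext b
    simp [and_comm]
  have h2 : I.filter (· < a) = (Finset.univ.filter (· < a)).filter (· ∈ I) := by
    ext b
    simp [and_comm]
  conv_rhs => rw [← h]
  rw [position, position, h1, h2, add_comm, Finset.card_filter_add_card_filter_not]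

theorem koszulD_monomial_compl (I : Finset (Fin m)) :
    koszulD k K (monomial k K I Iᶜ) =
      ∑ j ∈ Iᶜ, (-1 : k) ^ ((j : ℕ) + position I j) • monomial k K (insert j I) (insert j I)ᶜ := by
  rw [koszulD_monomial disjoint_compl_right]
  refine Finset.sum_congr rfl fun j _ => ?_
  rw [Finset.compl_insert]
  congr 1
  -- The exponents `position Iᶜ j` and `j + position I j` differ by twice `position I j`.
  rw [← position_compl I j, add_assoc, ← two_mul, pow_add, pow_mul]
  simp

theorem monomial_mem_subcomplexC {I J : Finset (Fin m)} (h : Disjoint I J) :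
    monomial k K I J ∈ subcomplexC k K := by
  by_cases hI : IsSimplex K I
  · exact Submodule.subset_span ⟨I, J, hI, h, rfl⟩
  · rw [monomial_eq_zero hI]
    exact zero_mem _

/-- The element of the Koszul complex that corresponds to a function on the simplices. -/
noncomputable def koszulSum (K : AbstractSimplicialComplex (Fin m)) (r : ℕ)
    (y : Finset (Fin m) → k) : Koszul k K :=
  ∑ I ∈ Finset.univ.filter fun I : Finset (Fin m) => I.card = r,
    (cellSign k I * y I) • monomial k K I Iᶜ

theorem koszulSum_mem (r : ℕ) (y : Finset (Fin m) → k) : koszulSum K r y ∈ subcomplexC k K :=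
  sum_mem fun _ _ => Submodule.smul_mem _ _ (monomial_mem_subcomplexC disjoint_compl_right)

/-- On monomials with complementary index sets the twisted Koszul differential is the simplicial
coboundary, the transpose of `simplicialBoundary`. The double sums are matched by `(I, j) ↦ (insert
j I, j)`. -/
theorem koszulD_koszulSum (r : ℕ) (y : Finset (Fin m) → k) :
    koszulD k K (koszulSum K r y) =
      koszulSum K (r + 1) fun I => ∑ i ∈ I, (-1 : k) ^ position I i * y (I.erase i) := by
  unfold koszulSum
  rw [map_sum]
  simp only [map_smul, koszulD_monomial_compl, Finset.smul_sum, Finset.mul_sum, Finset.sum_smul,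
    Finset.sum_sigma']
  refine Finset.sum_bij' (fun p _ => ⟨insert p.2 p.1, p.2⟩) (fun p _ => ⟨p.1.erase p.2, p.2⟩)
    ?_ ?_ ?_ ?_ ?_
  · rintro ⟨I, j⟩ h
    simp only [Finset.mem_sigma, Finset.mem_filter, Finset.mem_univ, true_and,
      Finset.mem_compl] at h ⊢
    rw [Finset.card_insert_of_notMem h.2, h.1]
    exact ⟨rfl, Finset.mem_insert_self _ _⟩
  · rintro ⟨I, j⟩ h
    simp only [Finset.mem_sigma, Finset.mem_filter, Finset.mem_univ, true_and,
      Finset.mem_compl] at h ⊢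
    rw [Finset.card_erase_of_mem h.2, h.1]
    exact ⟨rfl, Finset.notMem_erase _ _⟩
  · rintro ⟨I, j⟩ h
    simp only [Finset.mem_sigma, Finset.mem_compl] at h
    simp [Finset.erase_insert h.2]
  · rintro ⟨I, j⟩ h
    simp only [Finset.mem_sigma] at h
    simp [Finset.insert_erase h.2]
  · rintro ⟨I, j⟩ h
    simp only [Finset.mem_sigma, Finset.mem_compl] at h
    have hs := cellSign_erase (R := k) (Finset.mem_insert_self j I)
    have hp := position_erase_of_le (I := insert j I) (le_refl j)
    rw [Finset.erase_insert h.2] at hs hp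
    dsimp only
    rw [smul_smul, Finset.erase_insert h.2, hs, ← hp, pow_add]
    congr 1
    have : ((-1 : k) ^ (j : ℕ)) * (-1) ^ (j : ℕ) = 1 := by
      rw [← mul_pow]; simp
    linear_combination (cellSign k (insert j I) * y I * (-1) ^ position I j) * this

end KoszulComplex

/-! ### Singular chains of subspaces as formal chains -/

section ToFormal

variable {R : Type*} [CommRing R] {E : Type*} [TopologicalSpace E] {U : Set E} {d : ℕ}

variable (R) in
/-- The inclusion of singular chains of a subspace into formal chains. -/
noncomputable def toFormal (U : Set E) (d : ℕ) : (SingularCube d U →₀ R) →ₗ[R] FormalChain R E :=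
  Finsupp.lmapDomain R R fun c => (⟨d, fun x => (c x : E)⟩ : FormalCube E)

variable (R) in
/-- The span of the degenerate singular cubes. -/
def singularDegenerate (d : ℕ) (X : Type*) [TopologicalSpace X] :
    Submodule R (SingularCube d X →₀ R) :=
  Finsupp.supported R R {c | IsDegenerate c}

variable (R) in
/-- The boundary of singular chains with coefficients in `R`. -/
noncomputable def singularBoundary (d : ℕ) (X : Type*) [TopologicalSpace X] :
    (SingularCube (d + 1) X →₀ R) →ₗ[R] (SingularCube d X →₀ R) :=
  Finsupp.linearCombination R fun c => ∑ i : Fin (d + 1), (-1 : R) ^ (i : ℕ) •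
    (Finsupp.single (c.comp (cubeFace i 1)) (1 : R) - Finsupp.single (c.comp (cubeFace i 0)) 1)

theorem singularBoundary_int (d : ℕ) (X : Type*) [TopologicalSpace X] :
    singularBoundary ℤ d X = freeBoundary d X := rfl

theorem degenerateChains_eq (d : ℕ) (X : Type*) [TopologicalSpace X] :
    degenerateChains d X = singularDegenerate ℤ d X := by
  rw [singularDegenerate, Finsupp.supported_eq_span_single, degenerateChains]
  congr 1
  ext a
  exact ⟨fun ⟨c, hc, h⟩ => ⟨c, hc, h.symm⟩, fun ⟨c, hc, h⟩ => ⟨c, hc, h.symm⟩⟩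

theorem toFormal_single (c : SingularCube d U) :
    toFormal R U d (Finsupp.single c 1) = cube R fun x => (c x : E) := by
  rw [toFormal, Finsupp.lmapDomain_apply, Finsupp.mapDomain_single]
  rfl

theorem singularCube_injective : Function.Injective fun c : SingularCube d U =>
    (⟨d, fun x => (c x : E)⟩ : FormalCube E) := by
  intro c c' h
  have h' := eq_of_heq (Sigma.mk.inj h).2
  exact ContinuousMap.ext fun x => Subtype.ext (congrFun h' x)

theorem isDegenerate_iff {c : SingularCube d U} :
    IsDegenerate c ↔ DegenerateCube fun x => (c x : E) :=
  exists_congr fun _ => forall_congr' fun _ => forall_congr' fun _ => imp_congr_right fun _ =>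
    Subtype.ext_iff

theorem toFormal_mem_degenerate_iff {a : SingularCube d U →₀ R} :
    toFormal R U d a ∈ degenerate R E ↔ a ∈ singularDegenerate R d U := by
  classical
  constructor
  · intro h c hc
    refine isDegenerate_iff.2 (h (show (⟨d, fun x => (c x : E)⟩ : FormalCube E) ∈ _ from ?_))
    rw [Finset.mem_coe, Finsupp.mem_support_iff, toFormal, Finsupp.lmapDomain_apply,
      Finsupp.mapDomain_apply singularCube_injective]
    exact Finsupp.mem_support_iff.1 hc
  · intro h
    refine linearMap_mem_of_supported _ (fun c hc => ?_) h
    rw [toFormal_single]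
    exact cube_mem_degenerate (isDegenerate_iff.1 hc)

theorem toFormal_mem_chainsIn (a : SingularCube d U →₀ R) : toFormal R U d a ∈ chainsIn R U := by
  have h : a ∈ Finsupp.supported R R (Set.univ : Set (SingularCube d U)) := by simp
  refine linearMap_mem_of_supported _ (fun c _ => ?_) h
  rw [toFormal_single]
  exact cube_mem_chainsIn (continuous_subtype_val.comp c.continuous) fun x => (c x).2

theorem degreePart_toFormal (a : SingularCube d U →₀ R) :
    degreePart R d (toFormal R U d a) = toFormal R U d a := by
  suffices h : degreePart R d ∘ₗ toFormal R U d = toFormal R U d from LinearMap.congr_fun h a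
  refine Finsupp.lhom_ext' fun c => LinearMap.ext_ring ?_
  simp only [LinearMap.comp_apply, Finsupp.lsingle_apply, toFormal_single, degreePart_cube, if_pos]

theorem toFormal_singularBoundary (a : SingularCube (d + 1) U →₀ R) :
    toFormal R U d (singularBoundary R d U a) = formalBoundary R (toFormal R U (d + 1) a) := by
  suffices h : toFormal R U d ∘ₗ singularBoundary R d U =
      formalBoundary R ∘ₗ toFormal R U (d + 1) from LinearMap.congr_fun h a
  refine Finsupp.lhom_ext' fun c => LinearMap.ext_ring ?_
  simp only [LinearMap.comp_apply, Finsupp.lsingle_apply, toFormal_single,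
    formalBoundary_cube_eq_sum, singularBoundary, Finsupp.linearCombination_single, one_smul,
    map_sum, map_smul, map_sub]
  rfl

theorem formalBoundary_toFormal_zero (a : SingularCube 0 U →₀ R) :
    formalBoundary R (toFormal R U 0 a) = 0 := by
  suffices h : formalBoundary R ∘ₗ toFormal R U 0 = 0 from LinearMap.congr_fun h a
  refine Finsupp.lhom_ext' fun c => LinearMap.ext_ring ?_
  simp only [LinearMap.comp_apply, Finsupp.lsingle_apply, toFormal_single,
    formalBoundary_cube_zero, LinearMap.zero_apply]

/-- The discontinuous or stray cubes allowed in `chainsIn` are all degenerate, so modulo those a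
chain of `U` is, in each degree, a singular chain of the subspace. -/
theorem exists_toFormal {z : FormalChain R E} (hz : z ∈ chainsIn R U) (d : ℕ) :
    ∃ a, degreePart R d z - toFormal R U d a ∈ degenerate R E := by
  have h : chainsIn R U ≤ (LinearMap.range (toFormal R U d) ⊔ degenerate R E).comap
      (degreePart R d) := by
    refine supported_le_of_cube fun q c hc => ?_
    rw [Submodule.mem_comap, degreePart_cube]
    split_ifs with hq
    · subst hq
      rcases hc with ⟨hc, hU⟩ | hc
      · refine Submodule.mem_sup_left ⟨Finsupp.single ⟨fun x => ⟨c x, hU x⟩, hc.subtype_mk _⟩ 1, ?_⟩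
        exact toFormal_single _
      · exact Submodule.mem_sup_right (cube_mem_degenerate hc)
    · exact zero_mem _
  obtain ⟨_, ⟨a, rfl⟩, e, he, hae⟩ := Submodule.mem_sup.1 (h hz)
  refine ⟨a, ?_⟩
  rwa [← hae, add_sub_cancel_left]

end ToFormal

/-! ### Top homology of the moment-angle complex at the chain level -/

section TopHomology

variable {R : Type*} [CommRing R] {m n : ℕ} {K : AbstractSimplicialComplex (Fin m)}

open Classical in
variable (R) in
/-- The singular chain of cells that corresponds to a simplicial chain. -/
noncomputable def cellChain (K : AbstractSimplicialComplex (Fin m)) (d : ℕ) :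
    (Finset (Fin m) →₀ R) →ₗ[R] (SingularCube d (momentAngle K) →₀ R) :=
  Finsupp.linearCombination R fun I =>
    if h : IsSimplex K I then cellSign R I • Finsupp.single (cellCube d h Iᶜ) 1 else 0

theorem cellChain_single {I : Finset (Fin m)} (h : IsSimplex K I) (d : ℕ) :
    cellChain R K d (Finsupp.single I 1) = cellSign R I • Finsupp.single (cellCube d h Iᶜ) 1 := by
  simp [cellChain, h]

theorem toFormal_cellChain {d : ℕ} {ζ : Finset (Fin m) →₀ R}
    (hζ : ζ ∈ Finsupp.supported R R {I | IsSimplex K I}) :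
    toFormal R (momentAngle K) d (cellChain R K d ζ) = discChain R d ζ := by
  rw [← sub_eq_zero, ← Submodule.mem_bot R]
  refine linearMap_mem_of_supported (toFormal R (momentAngle K) d ∘ₗ cellChain R K d -
    discChain R d) (fun I hI => ?_) hζ
  rw [LinearMap.sub_apply, LinearMap.comp_apply, cellChain_single hI, discChain_single, map_smul,
    toFormal_single, productMap_topCell, Submodule.mem_bot, sub_eq_zero]
  rfl

variable (R) in
/-- The cycles among the simplicial chains of dimension `n - 1`. -/
noncomputable def topCycles (K : AbstractSimplicialComplex (Fin m)) (n : ℕ) :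
    Submodule R (Finset (Fin m) →₀ R) :=
  Finsupp.supported R R {I | IsSimplex K I ∧ I.card = n} ⊓ LinearMap.ker (simplicialBoundary R)

theorem supported_isSimplex {ζ : Finset (Fin m) →₀ R}
    (hζ : ζ ∈ Finsupp.supported R R {I | IsSimplex K I ∧ I.card = n}) :
    ζ ∈ Finsupp.supported R R {I | IsSimplex K I} :=
  Finsupp.supported_mono (fun _ hI => hI.1) hζ

theorem formalBoundary_cellChain {ζ : Finset (Fin m) →₀ R} (hζ : ζ ∈ topCycles R K n) :
    formalBoundary R (toFormal R (momentAngle K) (m + n) (cellChain R K (m + n) ζ)) ∈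
      degenerate R (Fin m → ℂ) := by
  rw [toFormal_cellChain (supported_isSimplex hζ.1)]
  exact formalBoundary_discChain_mem_degenerate
    (Finsupp.supported_mono (fun _ hI => hI.2) hζ.1) hζ.2

/-- The bounding formal chain may have several degrees; its part of degree `m + n + 1` suffices and
is replaced by a singular chain of the subspace. -/
theorem IsSimplicialSphere.exists_cellChain (hK : IsSimplicialSphere K n)
    {a : SingularCube (m + n) (momentAngle K) →₀ R}
    (h : formalBoundary R (toFormal R (momentAngle K) (m + n) a) ∈ degenerate R (Fin m → ℂ)) :
    ∃ ζ ∈ topCycles R K n, ∃ s, a - cellChain R K (m + n) ζ -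
      singularBoundary R (m + n) (momentAngle K) s ∈
        singularDegenerate R (m + n) (momentAngle K) := by
  obtain ⟨ζ, hζ, hb, s, hs, hd⟩ := hK.exists_discChain (toFormal_mem_chainsIn a)
    (degreePart_toFormal a) h
  obtain ⟨t, ht⟩ := exists_toFormal hs (m + n + 1)
  refine ⟨ζ, ⟨hζ, hb⟩, t, ?_⟩
  rw [← toFormal_mem_degenerate_iff, map_sub, map_sub, toFormal_singularBoundary]
  have h1 := degreePart_mem_degenerate (m + n) hd
  rw [← toFormal_cellChain (supported_isSimplex hζ), map_sub, map_sub, degreePart_toFormal,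
    degreePart_toFormal, degreePart_formalBoundary] at h1
  have h2 := formalBoundary_mem_degenerate ht
  rw [map_sub] at h2
  convert add_mem h1 h2 using 1
  abel

theorem IsSimplicialSphere.eq_zero_of_cellChain (hK : IsSimplicialSphere K n)
    {ζ : Finset (Fin m) →₀ R} (hζ : ζ ∈ topCycles R K n)
    {s : SingularCube (m + n + 1) (momentAngle K) →₀ R}
    (h : cellChain R K (m + n) ζ - singularBoundary R (m + n) (momentAngle K) s ∈
      singularDegenerate R (m + n) (momentAngle K)) : ζ = 0 := by
  rw [← toFormal_mem_degenerate_iff, map_sub, toFormal_singularBoundary,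
    toFormal_cellChain (supported_isSimplex hζ.1)] at h
  exact hK.eq_zero_of_discChain hζ.1 (toFormal_mem_chainsIn s) h

end TopHomology

/-! ### The integral fundamental class -/

section Homology

variable {m n : ℕ} {K : AbstractSimplicialComplex (Fin m)}

theorem mk_mem_cycles_iff {E : Type*} [TopologicalSpace E] {U : Set E} {d : ℕ}
    (a : SingularCube d U →₀ ℤ) :
    (Submodule.Quotient.mk a : Chain d U) ∈ cycles d U ↔
      formalBoundary ℤ (toFormal ℤ U d a) ∈ degenerate ℤ E := by
  cases d with
  | zero =>
    rw [formalBoundary_toFormal_zero]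
    exact ⟨fun _ => zero_mem _, fun _ => Submodule.mem_top⟩
  | succ d =>
    rw [← toFormal_singularBoundary, toFormal_mem_degenerate_iff, ← degenerateChains_eq,
      singularBoundary_int]
    change boundary d U (Submodule.Quotient.mk a) = 0 ↔ _
    rw [boundary, Submodule.mapQ_apply, Submodule.Quotient.mk_eq_zero]

theorem mk_mem_range_boundary_iff {X : Type*} [TopologicalSpace X] {d : ℕ}
    (a : SingularCube d X →₀ ℤ) :
    (Submodule.Quotient.mk a : Chain d X) ∈ LinearMap.range (boundary d X) ↔
      ∃ s, a - singularBoundary ℤ d X s ∈ singularDegenerate ℤ d X := by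
  simp only [← degenerateChains_eq, singularBoundary_int, ← Submodule.Quotient.eq]
  constructor
  · rintro ⟨s, hs⟩
    obtain ⟨s, rfl⟩ := Submodule.Quotient.mk_surjective _ s
    exact ⟨s, hs.symm⟩
  · rintro ⟨s, hs⟩
    exact ⟨Submodule.Quotient.mk s, hs.symm⟩

/-- The map from simplicial cycles to the cycles of the moment-angle complex. -/
noncomputable def cycleMap (K : AbstractSimplicialComplex (Fin m)) (n : ℕ) :
    topCycles ℤ K n →ₗ[ℤ] cycles (m + n) (momentAngle K) :=
  LinearMap.codRestrict _ ((degenerateChains (m + n) (momentAngle K)).mkQ ∘ₗ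
    cellChain ℤ K (m + n) ∘ₗ (topCycles ℤ K n).subtype) fun ζ =>
      (mk_mem_cycles_iff _).2 (formalBoundary_cellChain ζ.2)

/-- The map from simplicial cycles to the homology of the moment-angle complex. -/
noncomputable def homologyMap (K : AbstractSimplicialComplex (Fin m)) (n : ℕ) :
    topCycles ℤ K n →ₗ[ℤ] Homology (m + n) (momentAngle K) :=
  Submodule.mkQ _ ∘ₗ cycleMap K n

theorem IsSimplicialSphere.homologyMap_surjective (hK : IsSimplicialSphere K n) :
    Function.Surjective (homologyMap K n) := by
  intro x
  obtain ⟨⟨c, hc⟩, rfl⟩ := Submodule.Quotient.mk_surjective _ x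
  obtain ⟨a, rfl⟩ := Submodule.Quotient.mk_surjective _ c
  obtain ⟨ζ, hζ, s, hs⟩ := hK.exists_cellChain ((mk_mem_cycles_iff a).1 hc)
  refine ⟨⟨ζ, hζ⟩, ((Submodule.Quotient.eq _).2 ?_).symm⟩
  exact (mk_mem_range_boundary_iff _).2 ⟨s, hs⟩

theorem IsSimplicialSphere.homologyMap_injective (hK : IsSimplicialSphere K n) :
    Function.Injective (homologyMap K n) := by
  refine (injective_iff_map_eq_zero _).2 fun ζ h => Subtype.ext ?_
  have h' : cycleMap K n ζ ∈ (LinearMap.range (boundary (m + n) (momentAngle K))).submoduleOf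
      (cycles (m + n) (momentAngle K)) := (Submodule.Quotient.mk_eq_zero _).1 h
  obtain ⟨s, hs⟩ := (mk_mem_range_boundary_iff _).1 h'
  exact hK.eq_zero_of_cellChain ζ.2 hs

/-- Evaluation at `I` is an isomorphism from the top cycles to `R`: the coefficient `1` is attained,
and the coefficient determines the cycle. -/
theorem IsSimplicialSphere.exists_topCycle {R : Type*} [CommRing R] (hK : IsSimplicialSphere K n)
    {I : Finset (Fin m)} (hI : IsSimplex K I) (hn : I.card = n) :
    ∃ ζ : topCycles R K n, ζ.1 I = 1 ∧ ∀ ξ : topCycles R K n, ξ = ξ.1 I • ζ := by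
  obtain ⟨ζ, hζ, hb, h1⟩ := hK.exists_cycle (R := R) hI hn
  refine ⟨⟨ζ, hζ, hb⟩, h1, fun ξ => ?_⟩
  have hmem := (ξ - ξ.1 I • (⟨ζ, hζ, hb⟩ : topCycles R K n)).2
  refine sub_eq_zero.1 (Subtype.ext (hK.cycle_eq_zero hI hn hmem.1 hmem.2 ?_))
  simp [h1]

theorem IsSimplicialSphere.exists_isFundamentalClass (hK : IsSimplicialSphere K n) :
    ∃ μ : Homology (m + n) (momentAngle K), IsFundamentalClass μ := by
  obtain ⟨I, hI, hn⟩ := hK.exists_card_eq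
  obtain ⟨ζ, h1, h⟩ := hK.exists_topCycle (R := ℤ) hI hn
  refine ⟨homologyMap K n ζ, fun x => ?_, fun a ha => ?_⟩
  · obtain ⟨ξ, rfl⟩ := hK.homologyMap_surjective x
    exact ⟨ξ.1 I, by rw [← map_smul, ← h ξ]⟩
  · rw [← map_smul] at ha
    have := congrArg (fun ξ : topCycles ℤ K n => ξ.1 I)
      (hK.homologyMap_injective (ha.trans (map_zero _).symm))
    simpa [h1] using this

/-- A fundamental class comes from a simplicial cycle all of whose coefficients are signs. -/
theorem IsSimplicialSphere.exists_of_isFundamentalClass (hK : IsSimplicialSphere K n)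
    {μ : Homology (m + n) (momentAngle K)} (hμ : IsFundamentalClass μ) :
    ∃ ζ : topCycles ℤ K n, homologyMap K n ζ = μ ∧
      ∀ I, IsSimplex K I → I.card = n → IsUnit (ζ.1 I) := by
  obtain ⟨ζ, rfl⟩ := hK.homologyMap_surjective μ
  refine ⟨ζ, rfl, fun I hI hn => ?_⟩
  -- A cycle with coefficient `1` at `I` is an integral multiple of `ζ`, so the coefficient of `ζ`
  -- at `I` divides `1`.
  obtain ⟨ξ, h1, -⟩ := hK.exists_topCycle (R := ℤ) hI hn
  obtain ⟨a, ha⟩ := hμ.1 (homologyMap K n ξ)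
  rw [← map_smul] at ha
  have := congrArg (fun ξ : topCycles ℤ K n => ξ.1 I) (hK.homologyMap_injective ha)
  have h2 : 1 = a * ζ.1 I := by simpa [h1] using this
  exact IsUnit.of_mul_eq_one a (by rw [mul_comm, ← h2])

end Homology

/-! ### Cochains as functionals on chains with coefficients in `k` -/

section Cochains

variable {k : Type*} [CommRing k] {d : ℕ} {X : Type*} [TopologicalSpace X]

/-- The extension of a cochain to chains with coefficients in `k`. -/
noncomputable def functional (z : Cochain k d X) : (SingularCube d X →₀ k) →ₗ[k] k :=
  Finsupp.linearCombination k fun c => z (Chain.of c)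

theorem functional_single (z : Cochain k d X) (c : SingularCube d X) :
    functional z (Finsupp.single c 1) = z (Chain.of c) := by
  simp [functional]

theorem functional_of_mem_degenerate (z : Cochain k d X) {a : SingularCube d X →₀ k}
    (ha : a ∈ singularDegenerate k d X) : functional z a = 0 := by
  rw [← Submodule.mem_bot k]
  refine linearMap_mem_of_supported _ (fun c hc => ?_) ha
  have h : (Chain.of c : Chain d X) = 0 :=
    (Submodule.Quotient.mk_eq_zero _).2 (Submodule.subset_span ⟨c, hc, rfl⟩)
  rw [functional_single, Submodule.mem_bot, h, map_zero]

/-- The cochain given by a functional on chains with coefficients in `k`. -/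
noncomputable def ofFunctional (f : (SingularCube d X →₀ k) →ₗ[k] k)
    (hf : ∀ a ∈ singularDegenerate k d X, f a = 0) : Cochain k d X :=
  Submodule.liftQ _ (Finsupp.lift k ℤ (SingularCube d X) fun c => f (Finsupp.single c 1)) (by
    rw [degenerateChains, Submodule.span_le]
    rintro _ ⟨c, hc, rfl⟩
    simp only [SetLike.mem_coe, LinearMap.mem_ker]
    rw [Finsupp.lift_apply, Finsupp.sum_single_index (by simp), one_smul]
    exact hf _ (Finsupp.single_mem_supported _ _ hc))

theorem ofFunctional_of (f : (SingularCube d X →₀ k) →ₗ[k] k)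
    (hf : ∀ a ∈ singularDegenerate k d X, f a = 0) (c : SingularCube d X) :
    ofFunctional f hf (Chain.of c) = f (Finsupp.single c 1) := by
  rw [ofFunctional, Chain.of, Submodule.liftQ_apply, Finsupp.lift_apply,
    Finsupp.sum_single_index (by simp), one_smul]

theorem functional_ofFunctional (f : (SingularCube d X →₀ k) →ₗ[k] k)
    (hf : ∀ a ∈ singularDegenerate k d X, f a = 0) : functional (ofFunctional f hf) = f := by
  refine Finsupp.lhom_ext' fun c => LinearMap.ext_ring ?_
  simp only [LinearMap.comp_apply, Finsupp.lsingle_apply, functional_single, ofFunctional_of]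

theorem functional_injective : Function.Injective (functional : Cochain k d X → _) := by
  intro y z h
  refine Submodule.linearMap_qext _ (Finsupp.lhom_ext' fun c => LinearMap.ext_ring ?_)
  have := LinearMap.congr_fun h (Finsupp.single c 1)
  rwa [functional_single, functional_single] at this

theorem functional_coboundary (z : Cochain k d X) :
    functional (coboundary k d X z) = functional z ∘ₗ singularBoundary k d X := by
  refine Finsupp.lhom_ext' fun c => LinearMap.ext_ring ?_
  simp only [LinearMap.comp_apply, Finsupp.lsingle_apply, functional_single, singularBoundary,
    Finsupp.linearCombination_single, one_smul, map_sum, map_smul, map_sub]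
  change z (boundary d X (Submodule.Quotient.mk (Finsupp.single c 1))) = _
  rw [boundary, Submodule.mapQ_apply, freeBoundary, Finsupp.linearCombination_single, one_smul,
    ← Submodule.mkQ_apply, map_sum, map_sum]
  refine Finset.sum_congr rfl fun i _ => ?_
  rw [map_smul, map_smul, map_sub, map_sub, zsmul_eq_mul, smul_eq_mul]
  push_cast
  rfl

theorem functional_sub (y z : Cochain k d X) : functional (y - z) = functional y - functional z := by
  refine Finsupp.lhom_ext' fun c => LinearMap.ext_ring ?_
  simp only [LinearMap.comp_apply, Finsupp.lsingle_apply, functional_single, LinearMap.sub_apply]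

theorem functional_zero : functional (0 : Cochain k d X) = 0 := by
  rw [← sub_self (0 : Cochain k d X), functional_sub, sub_self]

variable (k) in
/-- The change of coefficients from the integers to `k`. -/
noncomputable def castChain {α : Type*} : (α →₀ ℤ) →+ (α →₀ k) :=
  Finsupp.mapRange.addMonoidHom (Int.castAddHom k)

theorem castChain_apply {α : Type*} (a : α →₀ ℤ) (x : α) : castChain k a x = (a x : k) := rfl

theorem castChain_single {α : Type*} (x : α) (r : ℤ) :
    castChain k (Finsupp.single x r) = (r : k) • Finsupp.single x 1 := by
  simp [castChain]

variable {m n : ℕ} {K : AbstractSimplicialComplex (Fin m)}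

theorem simplicialBoundary_castChain (ζ : Finset (Fin m) →₀ ℤ) :
    simplicialBoundary k (castChain k ζ) = castChain k (simplicialBoundary ℤ ζ) := by
  induction ζ using Finsupp.induction_linear with
  | zero => simp
  | add f g hf hg => simp only [map_add, hf, hg]
  | single I r =>
    rw [show Finsupp.single I r = r • Finsupp.single I (1 : ℤ) by simp, map_zsmul, map_zsmul,
      map_zsmul, map_zsmul, castChain_single, Int.cast_one, one_smul, simplicialBoundary_single,
      simplicialBoundary_single, map_sum]
    congr 1
    refine Finset.sum_congr rfl fun i _ => ?_
    rw [map_zsmul, castChain_single, Int.cast_one, one_smul]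
    ext J
    simp

theorem castChain_mem_topCycles {ζ : Finset (Fin m) →₀ ℤ} (hζ : ζ ∈ topCycles ℤ K n) :
    castChain k ζ ∈ topCycles k K n := by
  refine ⟨fun I hI => hζ.1 ?_, ?_⟩
  · rw [Finset.mem_coe, Finsupp.mem_support_iff] at hI ⊢
    intro h
    rw [castChain_apply, h, Int.cast_zero] at hI
    exact hI rfl
  · have h : simplicialBoundary ℤ ζ = 0 := hζ.2
    exact LinearMap.mem_ker.2 (by rw [simplicialBoundary_castChain, h, map_zero])

/-- A cochain is additive on integral chains; passing to its `k`-linear extension makes duality over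
a field available. -/
theorem apply_cellChain (z : Cochain k d (momentAngle K)) {ζ : Finset (Fin m) →₀ ℤ}
    (hζ : ζ ∈ Finsupp.supported ℤ ℤ {I | IsSimplex K I}) :
    z (Submodule.Quotient.mk (cellChain ℤ K d ζ)) =
      functional z (cellChain k K d (castChain k ζ)) := by
  rw [← sub_eq_zero, ← Submodule.mem_bot ℤ]
  let f : (Finset (Fin m) →₀ ℤ) →+ k :=
    (z.toAddMonoidHom.comp (Submodule.mkQ _).toAddMonoidHom).comp
      (cellChain ℤ K d).toAddMonoidHom -
    (functional z).toAddMonoidHom.comp ((cellChain k K d).toAddMonoidHom.comp (castChain k))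
  refine linearMap_mem_of_supported f.toIntLinearMap (fun I hI => ?_) hζ
  change z (Submodule.Quotient.mk (cellChain ℤ K d (Finsupp.single I 1))) -
    functional z (cellChain k K d (castChain k (Finsupp.single I 1))) ∈ _
  rw [castChain_single, Int.cast_one, one_smul, cellChain_single hI, cellChain_single hI,
    map_smul, functional_single, ← Submodule.mkQ_apply, map_smul, map_smul, Submodule.mem_bot,
    cellSign, cellSign, zsmul_eq_mul, smul_eq_mul, sub_eq_zero]
  push_cast
  rfl

end Cochains

/-! ### The fundamental cohomology class and its representatives -/

section Representation

variable {k : Type*} [Field k] {m n : ℕ} {K : AbstractSimplicialComplex (Fin m)}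

/-- Duality over a field: the functionals that vanish on the kernel of `f` are those that factor
through `f`. -/
theorem exists_comp_eq_of_ker_le {V W : Type*} [AddCommGroup V] [Module k V] [AddCommGroup W]
    [Module k W] (f : V →ₗ[k] W) (h : V →ₗ[k] k) (hf : ∀ x, f x = 0 → h x = 0) :
    ∃ g : W →ₗ[k] k, ∀ x, g (f x) = h x := by
  have : h ∈ (LinearMap.ker f).dualAnnihilator :=
    (Submodule.mem_dualAnnihilator h).2 fun x hx => hf x (LinearMap.mem_ker.1 hx)
  rw [← LinearMap.range_dualMap_eq_dualAnnihilator_ker] at this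
  obtain ⟨g, rfl⟩ := this
  exact ⟨g, fun x => rfl⟩

theorem exists_comp_eq_of_ker_le_on {V W : Type*} [AddCommGroup V] [Module k V] [AddCommGroup W]
    [Module k W] {T : Submodule k V} (f : V →ₗ[k] W) (h : V →ₗ[k] k)
    (hf : ∀ x ∈ T, f x = 0 → h x = 0) : ∃ g : W →ₗ[k] k, ∀ x ∈ T, g (f x) = h x := by
  obtain ⟨g, hg⟩ := exists_comp_eq_of_ker_le (f ∘ₗ T.subtype) (h ∘ₗ T.subtype)
    fun x hx => hf x.1 x.2 hx
  exact ⟨g, fun x hx => hg ⟨x, hx⟩⟩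

/-- Such a cochain factors through the boundary modulo degenerate chains; the factor is the
primitive. In degree `0` every chain is a cycle, so the cochain is zero. -/
theorem mem_coboundaries_of_forall {E : Type*} [TopologicalSpace E] {U : Set E} {d : ℕ}
    {w : Cochain k d U}
    (h : ∀ a, formalBoundary k (toFormal k U d a) ∈ degenerate k E → functional w a = 0) :
    w ∈ coboundaries k d U := by
  cases d with
  | zero =>
    have : w = 0 := functional_injective (LinearMap.ext fun a => by
      rw [h a (by rw [formalBoundary_toFormal_zero]; exact zero_mem _),
        functional_zero, LinearMap.zero_apply])
    exact this
  | succ d =>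
    obtain ⟨g, hg⟩ := exists_comp_eq_of_ker_le
      ((singularDegenerate k d U).mkQ ∘ₗ singularBoundary k d U) (functional w) fun a ha => by
        refine h a ?_
        rw [← toFormal_singularBoundary, toFormal_mem_degenerate_iff]
        exact (Submodule.Quotient.mk_eq_zero _).1 ha
    refine ⟨ofFunctional (g ∘ₗ (singularDegenerate k d U).mkQ) fun a ha => ?_, ?_⟩
    · rw [LinearMap.comp_apply, Submodule.mkQ_apply, (Submodule.Quotient.mk_eq_zero _).2 ha,
        map_zero]
    · refine functional_injective (LinearMap.ext fun a => ?_)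
      rw [functional_coboundary, functional_ofFunctional, ← hg]
      rfl

theorem functional_singularBoundary {d : ℕ} {X : Type*} [TopologicalSpace X]
    (z : cocycles k d X) (s : SingularCube (d + 1) X →₀ k) :
    functional z.1 (singularBoundary k d X s) = 0 := by
  have h : coboundary k d X z.1 = 0 := z.2
  rw [← LinearMap.comp_apply, ← functional_coboundary, h, functional_zero, LinearMap.zero_apply]

theorem kronecker_homologyMap (z : cocycles k (m + n) (momentAngle K)) (ζ : topCycles ℤ K n) :
    kronecker (Submodule.Quotient.mk z) (homologyMap K n ζ) =
      functional z.1 (cellChain k K (m + n) (castChain k ζ.1)) := by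
  rw [← apply_cellChain z.1 (supported_isSimplex ζ.2.1)]
  rfl

/-- The top cycles over `k` form a line, and the reduction of an integral generator spans it, since
its coefficients are `1` or `-1` and hence nonzero in `k`. -/
theorem IsSimplicialSphere.exists_smul_castChain (hK : IsSimplicialSphere K n)
    {ζ : topCycles ℤ K n} (hζ : ∀ I, IsSimplex K I → I.card = n → IsUnit (ζ.1 I))
    {ξ : Finset (Fin m) →₀ k} (hξ : ξ ∈ topCycles k K n) : ∃ c : k, ξ = c • castChain k ζ.1 := by
  obtain ⟨I, hI, hn⟩ := hK.exists_card_eq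
  obtain ⟨θ, -, h⟩ := hK.exists_topCycle (R := k) hI hn
  have h1 : ξ = ξ I • θ.1 := congrArg Subtype.val (h ⟨ξ, hξ⟩)
  have h2 : castChain k ζ.1 = castChain k ζ.1 I • θ.1 :=
    congrArg Subtype.val (h ⟨_, castChain_mem_topCycles ζ.2⟩)
  have h3 : castChain k ζ.1 I ≠ 0 := ((hζ I hI hn).map (Int.castRingHom k)).ne_zero
  have h4 : ξ I = ξ I / castChain k ζ.1 I * castChain k ζ.1 I := (div_mul_cancel₀ _ h3).symm
  refine ⟨ξ I / castChain k ζ.1 I, ?_⟩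
  rw [h4, mul_smul, ← h2] at h1
  exact h1

theorem IsSimplicialSphere.castChain_ne_zero (hK : IsSimplicialSphere K n)
    {ζ : topCycles ℤ K n} (hζ : ∀ I, IsSimplex K I → I.card = n → IsUnit (ζ.1 I)) :
    castChain k ζ.1 ≠ 0 := by
  obtain ⟨I, hI, hn⟩ := hK.exists_card_eq
  intro h
  have h3 : castChain k ζ.1 I ≠ 0 := ((hζ I hI hn).map (Int.castRingHom k)).ne_zero
  exact h3 (by rw [h]; rfl)

theorem IsSimplicialSphere.existsUnique_fundamentalCohomologyClass (hK : IsSimplicialSphere K n)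
    {μ : Homology (m + n) (momentAngle K)} (hμ : IsFundamentalClass μ) :
    ∃! ω : Cohomology k (m + n) (momentAngle K), IsFundamentalCohomologyClass μ ω := by
  obtain ⟨ζ, rfl, hζ⟩ := hK.exists_of_isFundamentalClass hμ
  have hne := hK.castChain_ne_zero (k := k) hζ
  have hcyc := castChain_mem_topCycles (k := k) ζ.2
  refine existsUnique_of_exists_of_unique ?_ ?_
  · have hnot : cellChain k K (m + n) (castChain k ζ.1) ∉
        singularDegenerate k (m + n) (momentAngle K) ⊔
          LinearMap.range (singularBoundary k (m + n) (momentAngle K)) := by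
      intro h
      obtain ⟨a, ha, _, ⟨s, rfl⟩, h⟩ := Submodule.mem_sup.1 h
      refine hne (hK.eq_zero_of_cellChain hcyc (s := s) ?_)
      rwa [← h, add_sub_cancel_right]
    -- A functional that vanishes on boundaries and degenerate chains is a cocycle; this one is
    -- nonzero on the fundamental cycle and is rescaled to take the value `1`.
    obtain ⟨f, hf, hfW⟩ := Submodule.exists_dual_map_eq_bot_of_notMem hnot inferInstance
    have hfW' : ∀ a ∈ singularDegenerate k (m + n) (momentAngle K) ⊔
        LinearMap.range (singularBoundary k (m + n) (momentAngle K)), f a = 0 := fun a ha =>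
      (Submodule.mem_bot k).1 (hfW ▸ Submodule.mem_map_of_mem ha)
    set c := f (cellChain k K (m + n) (castChain k ζ.1)) with hc
    have hdeg : ∀ a ∈ singularDegenerate k (m + n) (momentAngle K), (c⁻¹ • f) a = 0 :=
      fun a ha => by rw [LinearMap.smul_apply, hfW' a (Submodule.mem_sup_left ha), smul_zero]
    have hcoc : ofFunctional (c⁻¹ • f) hdeg ∈ cocycles k (m + n) (momentAngle K) := by
      refine LinearMap.mem_ker.2 (functional_injective (LinearMap.ext fun a => ?_))
      rw [functional_coboundary, functional_ofFunctional, LinearMap.comp_apply,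
        LinearMap.smul_apply, hfW' _ (Submodule.mem_sup_right ⟨a, rfl⟩), smul_zero,
        functional_zero, LinearMap.zero_apply]
    refine ⟨Submodule.Quotient.mk ⟨_, hcoc⟩, ?_⟩
    rw [IsFundamentalCohomologyClass, kronecker_homologyMap, functional_ofFunctional,
      LinearMap.smul_apply, ← hc, smul_eq_mul, inv_mul_cancel₀ hf]
  · intro ω ω' hω hω'
    obtain ⟨y, rfl⟩ := Submodule.Quotient.mk_surjective _ ω
    obtain ⟨z, rfl⟩ := Submodule.Quotient.mk_surjective _ ω'
    refine (Submodule.Quotient.eq _).2 (mem_coboundaries_of_forall fun a ha => ?_)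
    rw [IsFundamentalCohomologyClass, kronecker_homologyMap] at hω hω'
    obtain ⟨ξ, hξ, s, hs⟩ := hK.exists_cellChain ha
    obtain ⟨r, rfl⟩ := hK.exists_smul_castChain hζ hξ
    have h1 := functional_of_mem_degenerate (y - z).1 hs
    rw [map_sub, map_sub, functional_singularBoundary, sub_zero, sub_eq_zero] at h1
    change functional (y - z).1 a = 0
    rw [h1, map_smul, map_smul]
    change r • functional (y.1 - z.1) _ = 0
    rw [functional_sub, LinearMap.sub_apply, hω, hω', sub_self, smul_zero]

open Classical in
/-- The value of a cochain on the cell `D_I T_J`, where `J` is the complement of `I`. -/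
noncomputable def cellValue {d : ℕ} (z : Cochain k d (momentAngle K)) (I : Finset (Fin m)) : k :=
  if h : IsSimplex K I then z (Chain.of (cellCube d h Iᶜ)) else 0

theorem cellValue_of_isSimplex {d : ℕ} (z : Cochain k d (momentAngle K)) {I : Finset (Fin m)}
    (h : IsSimplex K I) : cellValue z I = z (Chain.of (cellCube d h Iᶜ)) := dif_pos h

theorem functional_cellChain {d : ℕ} (z : Cochain k d (momentAngle K)) {ζ : Finset (Fin m) →₀ k}
    (hζ : ζ ∈ Finsupp.supported k k {I | IsSimplex K I}) :
    functional z (cellChain k K d ζ) =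
      Finsupp.linearCombination k (fun I => cellSign k I * cellValue z I) ζ := by
  rw [← sub_eq_zero, ← Submodule.mem_bot k]
  refine linearMap_mem_of_supported (functional z ∘ₗ cellChain k K d -
    Finsupp.linearCombination k (fun I => cellSign k I * cellValue z I)) (fun I hI => ?_) hζ
  rw [LinearMap.sub_apply, LinearMap.comp_apply, cellChain_single hI, map_smul, functional_single,
    Finsupp.linearCombination_single, one_smul, cellValue_of_isSimplex z hI, smul_eq_mul, sub_self]
  exact zero_mem _

/-- From `2|I| + |J| = m + n`, `|I| ≤ n` and `|I| + |J| ≤ m` both inequalities are equalities, so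
only the cells with `|I| = n` and complementary `J` occur. The factor `cellSign` cancels the one in
`koszulSum`. -/
theorem cellularCochain_eq_koszulSum (hle : ∀ I, IsSimplex K I → I.card ≤ n)
    (z : Cochain k (m + n) (momentAngle K)) :
    cellularCochain z = koszulSum K n fun I => cellSign k I * cellValue z I := by
  unfold cellularCochain koszulSum
  rw [Finset.sum_filter]
  refine Finset.sum_congr rfl fun I _ => ?_
  by_cases hI : IsSimplex K I
  · have hcard : ∀ J, Disjoint I J → I.card + J.card ≤ m := fun J hJ => by
      rw [← Finset.card_union_of_disjoint hJ]
      exact (Finset.card_le_univ _).trans_eq (Fintype.card_fin m)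
    have hcompl : I.card + Iᶜ.card = m := by
      rw [Finset.card_add_card_compl, Fintype.card_fin]
    have hIn := hle I hI
    split_ifs with hn
    · rw [Finset.sum_eq_single Iᶜ]
      · rw [dif_pos ⟨hI, disjoint_compl_right, by omega⟩, ← mul_assoc, cellSign_mul_self, one_mul,
          cellValue_of_isSimplex z hI]
      · intro J _ hJ
        rw [dif_neg]
        rintro ⟨-, hd, hc⟩
        have := hcard J hd
        refine hJ (Finset.eq_of_subset_of_card_le
          (Finset.subset_compl_iff_disjoint_left.2 hd) (by omega))
      · exact fun h => absurd (Finset.mem_univ _) h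
    · refine Finset.sum_eq_zero fun J _ => ?_
      rw [dif_neg]
      rintro ⟨-, hd, hc⟩
      have := hcard J hd
      omega
  · rw [monomial_eq_zero hI, smul_zero, ite_self]
    exact Finset.sum_eq_zero fun J _ => dif_neg fun h => hI h.1

/-- A cellular cochain of top degree that vanishes on the cycles is a coboundary. -/
theorem exists_koszulD_eq {η : Finset (Fin m) → k}
    (h : ∀ ζ ∈ topCycles k K n, Finsupp.linearCombination k η ζ = 0) :
    ∃ b ∈ subcomplexC k K, koszulSum K n η = koszulD k K b := by
  -- Vanishing on cycles makes `η` factor through the simplicial boundary; the values of `g` on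
  -- single simplices are a cochain with coboundary `η`.
  obtain ⟨g, hg⟩ := exists_comp_eq_of_ker_le_on
    (T := Finsupp.supported k k {I : Finset (Fin m) | IsSimplex K I ∧ I.card = n})
    (simplicialBoundary k) (Finsupp.linearCombination k η) fun ζ hζ h0 => h ζ ⟨hζ, h0⟩
  have hη : ∀ I, IsSimplex K I → I.card = n →
      η I = ∑ i ∈ I, (-1 : k) ^ position I i * g (Finsupp.single (I.erase i) 1) := by
    intro I hI hn
    have := hg (Finsupp.single I 1) (Finsupp.single_mem_supported _ _ ⟨hI, hn⟩)
    simp only [Finsupp.linearCombination_single, simplicialBoundary_single, map_sum, map_smul,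
      smul_eq_mul, one_mul] at this
    exact this.symm
  have hsum : koszulSum K n η = koszulSum K n fun I =>
      ∑ i ∈ I, (-1 : k) ^ position I i * g (Finsupp.single (I.erase i) 1) := by
    refine Finset.sum_congr rfl fun I hI => ?_
    by_cases hI' : IsSimplex K I
    · rw [hη I hI' (Finset.mem_filter.1 hI).2]
    · rw [monomial_eq_zero hI', smul_zero, smul_zero]
  cases n with
  | zero =>
    refine ⟨0, zero_mem _, ?_⟩
    rw [hsum, map_zero]
    refine Finset.sum_eq_zero fun I hI => ?_
    rw [Finset.card_eq_zero.1 (Finset.mem_filter.1 hI).2]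
    dsimp only
    rw [Finset.sum_empty, mul_zero, zero_smul]
  | succ n =>
    refine ⟨koszulSum K n fun J => g (Finsupp.single J 1), koszulSum_mem _ _, ?_⟩
    rw [hsum, koszulD_koszulSum]

theorem units_smul_koszul (ε : ℤˣ) (x : Koszul k K) : ε • x = ((ε : ℤ) : k) • x := by
  induction x using TensorProduct.induction_on with
  | zero => rw [smul_zero, smul_zero]
  | add x y hx hy => rw [smul_add, smul_add, hx, hy]
  | tmul x y =>
    rw [Units.smul_def, TensorProduct.smul_tmul', TensorProduct.smul_tmul']
    congr 1
    exact (Int.cast_smul_eq_zsmul k _ x).symm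

theorem sub_smul_koszul (a b : k) (x : Koszul k K) : (a - b) • x = a • x - b • x := by
  rw [eq_sub_iff_add_eq, ← add_smul, sub_add_cancel]

theorem koszulSum_sub (r : ℕ) (x y : Finset (Fin m) → k) :
    koszulSum K r (x - y) = koszulSum K r x - koszulSum K r y := by
  simp only [koszulSum, ← Finset.sum_sub_distrib, Pi.sub_apply, mul_sub, sub_smul_koszul]

theorem IsSimplicialSphere.exists_represents (hK : IsSimplicialSphere K n)
    {μ : Homology (m + n) (momentAngle K)} (hμ : IsFundamentalClass μ)
    {ω : Cohomology k (m + n) (momentAngle K)} (hω : IsFundamentalCohomologyClass μ ω)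
    {I : Finset (Fin m)} (hI : IsSimplex K I) (hn : I.card = n) :
    ∃ ε : ℤˣ, Represents (ε • monomial k K I Iᶜ) ω := by
  obtain ⟨ζ, rfl, hζ⟩ := hK.exists_of_isFundamentalClass hμ
  obtain ⟨e, he⟩ := hζ I hI hn
  -- The coefficient of the fundamental cycle at `I`, corrected by the twist between simplices and
  -- cells.
  let ε : ℤˣ := e * (-1) ^ ∑ i ∈ I, (i : ℕ)
  have hε : ((ε : ℤ) : k) = (ζ.1 I : k) * cellSign k I := by
    simp only [ε, ← he, cellSign]
    push_cast
    rfl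
  have hsmul : ε • monomial k K I Iᶜ = ((ε : ℤ) : k) • monomial k K I Iᶜ :=
    units_smul_koszul _ _
  refine ⟨ε, ?_, ?_, ?_⟩
  · rw [hsmul]
    exact Submodule.smul_mem _ _ (monomial_mem_subcomplexC disjoint_compl_right)
  · rw [hsmul, map_smul, koszulD_monomial_compl, Finset.sum_eq_zero, smul_zero]
    intro j hj
    rw [monomial_eq_zero, smul_zero]
    intro h
    have := hK.card_le h
    rw [Finset.card_insert_of_notMem (Finset.mem_compl.1 hj)] at this
    omega
  · rintro z rfl
    rw [IsFundamentalCohomologyClass, kronecker_homologyMap] at hω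
    have hmono : ε • monomial k K I Iᶜ =
        koszulSum K n fun J => if J = I then cellSign k I * ((ε : ℤ) : k) else 0 := by
      rw [hsmul, koszulSum, Finset.sum_eq_single I]
      · rw [if_pos rfl, ← mul_assoc, cellSign_mul_self, one_mul]
      · intro J _ hJ
        rw [if_neg hJ, mul_zero, zero_smul]
      · intro h
        exact absurd (Finset.mem_filter.2 ⟨Finset.mem_univ I, hn⟩) h
    rw [cellularCochain_eq_koszulSum (fun I hI => hK.card_le hI), hmono, ← koszulSum_sub]
    refine exists_koszulD_eq fun ξ hξ => ?_
    obtain ⟨c, rfl⟩ := hK.exists_smul_castChain hζ hξ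
    have hcyc := castChain_mem_topCycles (k := k) ζ.2
    rw [functional_cellChain _ (supported_isSimplex hcyc.1)] at hω
    -- The signed monomial has the value `1` on the fundamental cycle, as does the cocycle `z`. All
    -- top cycles are multiples of this one, so the difference of the two cochains kills every
    -- cycle.
    have hlin : Finsupp.linearCombination k
        (fun J => if J = I then cellSign k I * ((ε : ℤ) : k) else 0) (castChain k ζ.1) = 1 := by
      rw [Finsupp.linearCombination_apply, Finsupp.sum_fintype _ _ (by simp),
        Finset.sum_eq_single I]
      · rw [if_pos rfl, hε, castChain_apply, smul_eq_mul]
        have h1 : (ζ.1 I : k) * ζ.1 I = 1 := by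
          rw [← he, ← Int.cast_mul, Int.units_coe_mul_self, Int.cast_one]
        linear_combination (cellSign k I * cellSign k I) * h1 + cellSign_mul_self (R := k) I
      · intro J _ hJ
        rw [if_neg hJ, smul_zero]
      · exact fun h => absurd (Finset.mem_univ _) h
    have hsub' : ∀ x y : Finset (Fin m) → k, Finsupp.linearCombination k (x - y) =
        Finsupp.linearCombination k x - Finsupp.linearCombination k y := fun x y => by
      ext J
      simp
    rw [map_smul, hsub', LinearMap.sub_apply, hω, hlin, sub_self, smul_zero]

theorem eq_compl_of_bidegree {I J : Finset (Fin m)} (h : Disjoint I J)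
    (hb : bidegree I J = (-((m : ℤ) - n), 2 * (m : ℤ))) : J = Iᶜ := by
  -- The second component alone gives `|I| + |J| = m`, which for disjoint sets means complementary.
  have hsnd : (bidegree I J).2 = 2 * (m : ℤ) := by rw [hb]
  have hb' : (bidegree I J).2 = I.card * 2 + J.card * 2 := by simp [bidegree]
  refine Finset.eq_of_subset_of_card_le (Finset.subset_compl_iff_disjoint_left.2 h) ?_
  have := Finset.card_add_card_compl I
  rw [Fintype.card_fin] at this
  omega

end Representation

end MomentAngle

/-! ### The theorem -/

theorem mainTheorem7 (k : Type*) [Field k] (m n : ℕ) (K : AbstractSimplicialComplex (Fin m))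
    (hK : MomentAngle.IsSimplicialSphere K n) :
    (∃ μ : MomentAngle.Homology (m + n) (MomentAngle.momentAngle K),
      MomentAngle.IsFundamentalClass μ) ∧
    ∀ μ : MomentAngle.Homology (m + n) (MomentAngle.momentAngle K),
      MomentAngle.IsFundamentalClass μ →
      (∃! ω : MomentAngle.Cohomology k (m + n) (MomentAngle.momentAngle K),
        MomentAngle.IsFundamentalCohomologyClass μ ω) ∧
      ∀ ω : MomentAngle.Cohomology k (m + n) (MomentAngle.momentAngle K),
        MomentAngle.IsFundamentalCohomologyClass μ ω →
        ∀ I J : Finset (Fin m), MomentAngle.IsSimplex K I → I.card = n → Disjoint I J →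
          MomentAngle.bidegree I J = (-((m : ℤ) - n), 2 * (m : ℤ)) →
          ∃ ε : ℤˣ, MomentAngle.Represents (ε • MomentAngle.monomial k K I J) ω := by
  refine ⟨hK.exists_isFundamentalClass, fun μ hμ =>
    ⟨hK.existsUnique_fundamentalCohomologyClass hμ, fun ω hω I J hI hn hd hb => ?_⟩⟩
  obtain rfl := MomentAngle.eq_compl_of_bidegree hd hb
  exact hK.exists_represents hμ hω hI hn
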